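/- **Setting.** Let $G=(V,E)$ be a directed graph with $n\ge 2$ nodes, $m$ edges, average degree $\bar d=m/n$, in which every node has an in-neighbour; $\mathcal I(v),\mathcal O(v)$ are the sets of in- and out-neighbours of $v$ and $d_{in}(v)=|\mathcal I(v)|$. Fix $c\in(0,1)$. A $\sqrt c$-walk from $u$, at each step, terminates at the current node with probability $1-\sqrt c$ and otherwise moves to a uniformly random in-neighbour. The reverse PageRank $\pi(w)$ is the probability that a $\sqrt c$-walk from a uniformly random node terminates at $w$. Let $w_1,\dots,w_n$ be the nodes in descending order of $\pi$. Put $c_1=12/(1-\sqrt c)^2$, $d_r=\lceil c_1/\varepsilon^2\rceil$, $f_r=\lceil 3\log(n/\delta)\rceil$, $n_r=d_rf_r$, and call $w_j$ with $j\le j_0$ the hub nodes. **Preprocessing (PRSim).** Sort every out-adjacency list by ascending in-degree, by counting sort of all edges. Calculate all $\pi(w)$ and select the hub nodes. For each hub node $w$ run a backward search: $r_0(w,w)=1$; at level $\ell=0,1,\dots$, each $v$ with $r_\ell(v,w)>\varepsilon/c_1$ adds $\sqrt c\,r_\ell(v,w)/d_{in}(z)$ to $r_{\ell+1}(z,w)$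 for all $z\in\mathcal O(v)$ and gets $\psi_\ell(v,w)=(1-\sqrt c)\,r_\ell(v,w)$; store the list $L_\ell(w)$ of all $(v,\psi_\ell(v,w))$ with $\psi_\ell(v,w)>\varepsilon/c_1$. The index size is the total number of stored tuples. **Variance Bounded Backward Walk** from $w$ with target level $\ell$. Start with $\hat\pi_0(w,w)=1-\sqrt c$. For $i=0,\dots,\ell-1$ and each $x$ with $\hat\pi_i(x,w)\ne 0$: with probability $\sqrt c$, add $\hat\pi_i(x,w)/d_{in}(y)$ to $\hat\pi_{i+1}(y,w)$ for all $y\in\mathcal O(x)$ with $d_{in}(y)\le q:=\hat\pi_i(x,w)/(1-\sqrt c)$, draw $r$ uniformly from $(0,1)$ and add $1-\sqrt c$ to $\hat\pi_{i+1}(y,w)$ for all $y\in\mathcal O(x)$ with $q<d_{in}(y)\le q/r$. The out-adjacency list is scanned only up to the first node with too large an in-degree. **Query** from $u$. In each of $f_r$ rounds, $d_r$ times: sample a $\sqrt c$-walk from $u$, say it terminates at $w$ after $\ell$ steps; sample two independent $\sqrt c$-walks from $w$; unless they are at the same node after the same number $\ge 1$ of steps, add $1/n_r$ to $\widehat{\eta\pi}_\ell(u,w)$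 and, if $w$ is not a hub node, run the Variance Bounded Backward Walk from $w$ with target level $\ell$ and add $\hat\pi_\ell(v,w)/((1-\sqrt c)^2d_r)$ to the estimator $\hat s_B^i(u,v)$ of the current round $i$, for all $v$. Let $\hat s_B(u,v)$ be the median of $\hat s_B^i(u,v)$ over the rounds $i$. For each $(w,\ell)$ with $w$ a hub node and $\widehat{\eta\pi}_\ell(u,w)>\varepsilon/c_1$, add $\widehat{\eta\pi}_\ell(u,w)\psi/(1-\sqrt c)^2$ to $\hat s_I(u,v)$ for all $(v,\psi)\in L_\ell(w)$. Return $\hat s_B+\hat s_I$. Costs are counted in steps of a random access machine with real registers, constant-time random numbers, arrays and hash maps that store only non-zero entries. The preprocessing algorithm leaves the method by which the reverse PageRanks are calculated open; let $T_{PR}$ be the number of steps which that takes (given the reverse PageRanks, the hub nodes are selected in $n$ steps). **Theorem.** Let $c\in(0,1)$, $\gamma>1$, $\kappa_1>0$ and $\kappa_2,a\in\mathbb R$. There is a constant $C>0$, depending only on these, such that the following holds for all $n\ge 2$, all $G$ as above, and all $\varepsilon,\delta\in(0,1)$. Suppose that the reverse PageRanks follow the power law with exponent $\gamma$: $$\kappa_1\,\frac{j^{-1/\gamma}}{n^{1-1/\gamma}}\le\pi(w_j)\le\kappa_2\,\frac{j^{-1/\gamma}}{n^{1-1/\gamma}}\qquad(1\le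 j\le n),$$ and let $j_0=\bigl\lfloor n(\varepsilon\bar d)^{\gamma/(\gamma-1)}\bigr\rfloor$ (all nodes are hub nodes if $j_0\ge n$). Then the expected query cost $\mathrm E[\mathrm{Cost}]$ for a uniformly random node $u$ satisfies 1. if $\gamma>2$: $\mathrm E[\mathrm{Cost}]\le C\,\dfrac{\log(n/\delta)}{\varepsilon^2}$; 2. if $\gamma=2$: $\mathrm E[\mathrm{Cost}]\le C\,\dfrac{\log(n/\delta)\,\log n}{\varepsilon^2}$; 3. if $1<\gamma<2$, $\ \varepsilon\ge\dfrac{(\log n)^{(\gamma-1)/(2-\gamma)}}{n^{(\gamma-1)/\gamma}\,\bar d^{\,2-\gamma}}$ and $\delta\ge n^{-a}$: $\ \mathrm E[\mathrm{Cost}]\le C\min\Bigl\{\dfrac{n^{1/\gamma}}{\varepsilon^{2-1/\gamma}},\dfrac{n^{2/\gamma-1}}{\varepsilon^2}\Bigr\}$. Moreover, the index size is at most $C\,m$, and the preprocessing time is at most $T_{PR}+C\,m/\varepsilon$ (so it is $O(m/\varepsilon)$ whenever $T_{PR}=O(m/\varepsilon)$). -/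

import Mathlib

open scoped ENNReal

noncomputable section

namespace PRSim

open MeasureTheory

/-! ### Programs with a step count

One step is one operation of a random access machine with real registers: an arithmetic operation,
a comparison, an access to an array or to a hash map, appending to a list, a call of `rand()`. -/

/-- A deterministic computation: its result and the number of steps it takes. -/
structure Timed (α : Type) where
  val : α
  time : ℕ

instance : Monad Timed where
  pure a := ⟨a, 0⟩
  bind x f := ⟨(f x.val).val, x.time + (f x.val).time⟩

/-- Spend `k` steps. -/
def Timed.charge (k : ℕ) : Timed Unit := ⟨(), k⟩

/-- A randomized computation: the joint law of its result and of the number of steps it takes. -/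
def RandTimed (α : Type) : Type := PMF (α × ℕ)

instance : Monad RandTimed where
  pure a := PMF.pure (a, 0)
  bind x f := PMF.bind x fun p => PMF.map (fun q => (q.1, p.2 + q.2)) (f p.1)

/-- Spend `k` steps. -/
def RandTimed.charge (k : ℕ) : RandTimed Unit := PMF.pure ((), k)

/-- Draw a value with law `p`, independently of all other draws, in `time a` steps if the outcome
is `a`. -/
def RandTimed.draw {α : Type} (p : PMF α) (time : α → ℕ) : RandTimed α :=
  PMF.map (fun a => (a, time a)) p

/-- The expected number of steps. -/
def RandTimed.expectedTime {α : Type} (x : RandTimed α) : ℝ≥0∞ :=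
  ∑' q : α × ℕ, (show PMF (α × ℕ) from x) q * (q.2 : ℝ≥0∞)

theorem isProbabilityMeasure_map_unit {f : ℝ → ℕ} (hf : Measurable f) :
    IsProbabilityMeasure (((volume : Measure ℝ).restrict (Set.Ioo 0 1)).map f) := by
  constructor
  rw [Measure.map_apply hf MeasurableSet.univ]
  simp

/-- The law of `f r` for a random number `r` that is uniform in `(0, 1)`. -/
def lawOfRand (f : ℝ → ℕ) (hf : Measurable f) : PMF ℕ :=
  haveI := isProbabilityMeasure_map_unit hf
  (((volume : Measure ℝ).restrict (Set.Ioo 0 1)).map f).toPMF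

/-! ### Graphs -/

variable {n : ℕ}

open Classical in
/-- The in-neighbours of `v`. -/
def inNbrs (G : Digraph (Fin n)) (v : Fin n) : Finset (Fin n) :=
  Finset.univ.filter fun x => G.Adj x v

/-- The in-degree of `v`. -/
def dIn (G : Digraph (Fin n)) (v : Fin n) : ℕ := (inNbrs G v).card

open Classical in
/-- The edges `(x, y)` of the graph. -/
def edges (G : Digraph (Fin n)) : Finset (Fin n × Fin n) :=
  Finset.univ.filter fun e => G.Adj e.1 e.2

/-- The number `m` of edges. -/
def numEdges (G : Digraph (Fin n)) : ℕ := (edges G).card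

/-- The average degree `m / n`. -/
def avgDeg (G : Digraph (Fin n)) : ℝ := (numEdges G : ℝ) / n

/-! ### The `√c`-walk and reverse PageRank

The decay factor `c` ranges over the subtype of the open interval `(0, 1)`. -/

/-- `√c`. -/
def sq (c : Set.Ioo (0 : ℝ) 1) : ℝ := Real.sqrt c

theorem sq_pos (c : Set.Ioo (0 : ℝ) 1) : 0 < sq c := Real.sqrt_pos.2 c.2.1

theorem sq_lt_one (c : Set.Ioo (0 : ℝ) 1) : sq c < 1 := by
  rw [sq, Real.sqrt_lt' one_pos]
  simpa using c.2.2

theorem hasSum_numSteps (c : Set.Ioo (0 : ℝ) 1) :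
    HasSum (fun k : ℕ => ENNReal.ofReal (sq c ^ k * (1 - sq c))) 1 := by
  have h1 : 0 < 1 - sq c := sub_pos.2 (sq_lt_one c)
  have h0 : ∀ k : ℕ, 0 ≤ sq c ^ k * (1 - sq c) :=
    fun k => mul_nonneg (pow_nonneg (sq_pos c).le k) h1.le
  have h := (hasSum_geometric_of_lt_one (sq_pos c).le (sq_lt_one c)).mul_right (1 - sq c)
  rw [inv_mul_cancel₀ h1.ne'] at h
  have h2 : ∑' k : ℕ, ENNReal.ofReal (sq c ^ k * (1 - sq c)) = 1 := by
    rw [← ENNReal.ofReal_tsum_of_nonneg h0 h.summable, h.tsum_eq, ENNReal.ofReal_one]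
  exact h2 ▸ ENNReal.summable.hasSum

/-- The number of moves of a walk which, before each move, terminates with probability `1 - √c`. -/
def numSteps (c : Set.Ioo (0 : ℝ) 1) : PMF ℕ :=
  ⟨fun k => ENNReal.ofReal (sq c ^ k * (1 - sq c)), hasSum_numSteps c⟩

open Classical in
/-- One move of the walk: to a uniformly random in-neighbour of the current node. (All graphs
considered have an in-neighbour at every node; the other branch is never used.) -/
def move (G : Digraph (Fin n)) (v : Fin n) : PMF (Fin n) :=
  if h : (inNbrs G v).Nonempty then PMF.uniformOfFinset (inNbrs G v) h else PMF.pure v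

/-- The list of the nodes visited by `k` moves from `v`, beginning with `v`. -/
def trajectory (G : Digraph (Fin n)) : ℕ → Fin n → PMF (List (Fin n))
  | 0, v => PMF.pure [v]
  | k + 1, v => (move G v).bind fun x => (trajectory G k x).map fun l => v :: l

/-- The law of the `√c`-walk from `u`, as the list of the nodes it visits. -/
def walk (G : Digraph (Fin n)) (c : Set.Ioo (0 : ℝ) 1) (u : Fin n) : PMF (List (Fin n)) :=
  (numSteps c).bind fun k => trajectory G k u

/-- `π(u, w)`: the probability that the `√c`-walk from `u` terminates at `w`. -/
def rppr (G : Digraph (Fin n)) (c : Set.Ioo (0 : ℝ) 1) (u w : Fin n) : ℝ :=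
  ((walk G c u).map (fun l => l.getLastD u) w).toReal

/-- `π(w)`: the probability that the `√c`-walk from a uniformly random node terminates at `w`. -/
def reversePageRank (G : Digraph (Fin n)) (c : Set.Ioo (0 : ℝ) 1) (w : Fin n) : ℝ :=
  (∑ u, rppr G c u w) / n

/-! ### Preprocessing

A hash map is a finitely supported function: it stores the keys with a non-zero entry only, and to
iterate over it takes time proportional to their number. -/

/-- The constant `c₁ = 12 / (1 - √c)²`. -/
def c₁ (c : Set.Ioo (0 : ℝ) 1) : ℝ := 12 / (1 - sq c) ^ 2

/-- The residue threshold `r_max = ε / c₁`. -/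
def rMax (c : Set.Ioo (0 : ℝ) 1) (ε : ℝ) : ℝ := ε / c₁ c

/-- Builds the out-adjacency lists, each sorted by ascending in-degree, by counting sort from the
list of the edges. -/
def sortAdjacency (G : Digraph (Fin n)) : Timed (Fin n → List (Fin n)) := do
  -- the in-degrees
  Timed.charge n
  let d ← (edges G).toList.foldlM (fun (d : Fin n → ℕ) e => do
    Timed.charge 1
    pure (Function.update d e.2 (d e.2 + 1))) (fun _ => 0)
  -- the tuples `(x, y, d_in(y))`
  let tuples ← (edges G).toList.foldlM (fun (T : List (Fin n × Fin n × ℕ)) e => do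
    Timed.charge 1
    pure (T ++ [(e.1, e.2, d e.2)])) []
  -- counting sort of the tuples according to `d_in(y)`, with buckets `0, …, n`
  Timed.charge (n + 1)
  let buckets ← tuples.foldlM (fun (B : ℕ → List (Fin n × Fin n × ℕ)) t => do
    Timed.charge 1
    pure (Function.update B t.2.2 (B t.2.2 ++ [t]))) (fun _ => [])
  let sorted ← (List.range (n + 1)).foldlM (fun (S : List (Fin n × Fin n × ℕ)) k => do
    Timed.charge (1 + (buckets k).length)
    pure (S ++ buckets k)) []
  -- append `y` to the list of `x`, in the sorted order
  Timed.charge n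
  sorted.foldlM (fun (A : Fin n → List (Fin n)) t => do
    Timed.charge 1
    pure (Function.update A t.1 (A t.1 ++ [t.2.1]))) (fun _ => [])

open Classical in
/-- One level of the backward search, with `r` the residues of this level: each node `v` with
`r v > r_max` hands its residue on to its out-neighbours at the next level and gets the reserve
`(1 - √c) * r v`. Returns the residues of the next level and the reserves of this level. -/
def pushLevel (G : Digraph (Fin n)) (c : Set.Ioo (0 : ℝ) 1) (ε : ℝ) (adj : Fin n → List (Fin n))
    (r : Fin n →₀ ℝ) : Timed ((Fin n →₀ ℝ) × (Fin n →₀ ℝ)) :=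
  r.support.toList.foldlM (fun (st : (Fin n →₀ ℝ) × (Fin n →₀ ℝ)) v => do
    Timed.charge 1
    if rMax c ε < r v then do
      let next ← (adj v).foldlM (fun (next : Fin n →₀ ℝ) z => do
        Timed.charge 1
        pure (next + Finsupp.single z (sq c * (r v / dIn G z)))) st.1
      Timed.charge 1
      pure (next, st.2 + Finsupp.single v ((1 - sq c) * r v))
    else pure st) (0, 0)

open Classical in
/-- The list of the pairs `(v, ψ v)` with `ψ v > r_max`. -/
def collect (c : Set.Ioo (0 : ℝ) 1) (ε : ℝ) (ψ : Fin n →₀ ℝ) : Timed (List (Fin n × ℝ)) :=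
  ψ.support.toList.foldlM (fun (L : List (Fin n × ℝ)) v => do
    Timed.charge 1
    if rMax c ε < ψ v then pure (L ++ [(v, ψ v)]) else pure L) []

/-- The residues `r_ℓ(·, w)` when the backward search from `w` arrives at level `ℓ`. -/
def residue (G : Digraph (Fin n)) (c : Set.Ioo (0 : ℝ) 1) (ε : ℝ) (adj : Fin n → List (Fin n))
    (w : Fin n) : ℕ → (Fin n →₀ ℝ)
  | 0 => Finsupp.single w 1
  | ℓ + 1 => (pushLevel G c ε adj (residue G c ε adj w ℓ)).val.1

/-- Level `ℓ` of the backward search from `w`. It returns the list `L_ℓ(w)`. The search runs through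
the levels until no residue is left; from then on a level is empty and takes no steps. -/
def searchLevel (G : Digraph (Fin n)) (c : Set.Ioo (0 : ℝ) 1) (ε : ℝ) (adj : Fin n → List (Fin n))
    (w : Fin n) (ℓ : ℕ) : Timed (List (Fin n × ℝ)) := do
  let st ← pushLevel G c ε adj (residue G c ε adj w ℓ)
  collect c ε st.2

/-- What the preprocessing stores: the sorted out-adjacency lists, the set of hub nodes and the
lists `L_ℓ(w)` of the hub nodes `w`. -/
structure Index (n : ℕ) where
  adj : Fin n → List (Fin n)
  hubs : Finset (Fin n)
  lists : Fin n → ℕ → List (Fin n × ℝ)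

/-- The output of the preprocessing algorithm with the given hub nodes. -/
def buildIndex (G : Digraph (Fin n)) (c : Set.Ioo (0 : ℝ) 1) (ε : ℝ) (hubs : Finset (Fin n)) :
    Index n :=
  let adj := (sortAdjacency G).val
  { adj := adj
    hubs := hubs
    lists := fun w ℓ => (searchLevel G c ε adj w ℓ).val }

/-- The number of steps of the preprocessing algorithm: sorting the adjacency lists, calculating
all reverse PageRanks (`tPR` steps), selecting the largest ones (linear-time selection), and a
backward search from each hub node. -/
def preprocessingTime (G : Digraph (Fin n)) (c : Set.Ioo (0 : ℝ) 1) (ε : ℝ)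
    (hubs : Finset (Fin n)) (tPR : ℕ) : ℝ≥0∞ :=
  ((sortAdjacency G).time : ℝ≥0∞) + tPR + n +
    ∑ w ∈ hubs, (1 + ∑' ℓ : ℕ, ((searchLevel G c ε (sortAdjacency G).val w ℓ).time : ℝ≥0∞))

/-- The number of tuples in the lists of the index. -/
def Index.size (I : Index n) : ℝ≥0∞ :=
  ∑ w ∈ I.hubs, ∑' ℓ : ℕ, ((I.lists w ℓ).length : ℝ≥0∞)

/-! ### Variance Bounded Backward Walk -/

open Classical in
/-- The coin `rand() < √c`; the outcome `1` means that the inequality holds. -/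
def coin (c : Set.Ioo (0 : ℝ) 1) : PMF ℕ :=
  lawOfRand (fun r => if r < sq c then 1 else 0)
    (Measurable.ite measurableSet_Iio measurable_const measurable_const)

/-- The law of `⌊q / r⌋` for a random number `r`. For a natural number `d`, the condition
`d ≤ q / r` is equivalent to `d ≤ ⌊q / r⌋`. -/
def scanBound (q : ℝ) : PMF ℕ :=
  lawOfRand (fun r => ⌊q / r⌋₊) (Nat.measurable_floor.comp (measurable_const.div measurable_id))

open Classical in
/-- One level of the Variance Bounded Backward Walk: from the estimators of level `i` to those of
level `i + 1`. The out-adjacency lists are scanned only up to the first node with too large an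
in-degree. -/
def backwardStep (G : Digraph (Fin n)) (c : Set.Ioo (0 : ℝ) 1) (adj : Fin n → List (Fin n))
    (cur : Fin n →₀ ℝ) : RandTimed (Fin n →₀ ℝ) :=
  cur.support.toList.foldlM (fun (next : Fin n →₀ ℝ) x => do
    let b ← RandTimed.draw (coin c) (fun _ => 1)
    if b = 1 then do
      let q := cur x / (1 - sq c)
      let next ← ((adj x).takeWhile fun y => decide ((dIn G y : ℝ) ≤ q)).foldlM
        (fun (next : Fin n →₀ ℝ) y => do
          RandTimed.charge 1
          pure (next + Finsupp.single y (cur x / dIn G y))) next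
      let t ← RandTimed.draw (scanBound q) (fun _ => 1)
      (((adj x).dropWhile fun y => decide ((dIn G y : ℝ) ≤ q)).takeWhile
        fun y => decide (dIn G y ≤ t)).foldlM
        (fun (next : Fin n →₀ ℝ) y => do
          RandTimed.charge 1
          pure (next + Finsupp.single y (1 - sq c))) next
    else pure next) 0

/-- The Variance Bounded Backward Walk from `w` with target level `ℓ`; it returns the estimators
`π̂_ℓ(·, w)`. -/
def backwardWalk (G : Digraph (Fin n)) (c : Set.Ioo (0 : ℝ) 1) (adj : Fin n → List (Fin n))
    (w : Fin n) (ℓ : ℕ) : RandTimed (Fin n →₀ ℝ) :=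
  (List.range ℓ).foldlM (fun (cur : Fin n →₀ ℝ) _ => do
    RandTimed.charge 1
    backwardStep G c adj cur) (Finsupp.single w (1 - sq c))

/-! ### The query algorithm -/

/-- `d_r = c₁ / ε²`, rounded up: the number of samples in a round. -/
def dR (c : Set.Ioo (0 : ℝ) 1) (ε : ℝ) : ℕ := ⌈c₁ c / ε ^ 2⌉₊

/-- `f_r = 3 log (n / δ)`, rounded up: the number of rounds. -/
def fR (n : ℕ) (δ : ℝ) : ℕ := ⌈3 * Real.log (n / δ)⌉₊

/-- Sample a `√c`-walk from `u`, one step per visited node. -/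
def sampleWalk (G : Digraph (Fin n)) (c : Set.Ioo (0 : ℝ) 1) (u : Fin n) :
    RandTimed (List (Fin n)) :=
  RandTimed.draw (walk G c u) List.length

/-- Two walks meet: they visit the same node after exactly `i` moves, for some `i ≥ 1`. -/
def Meet (p q : List (Fin n)) : Prop :=
  ∃ i, 1 ≤ i ∧ ∃ x, p[i]? = some x ∧ q[i]? = some x

open Classical in
/-- One sample of the query algorithm. The state consists of the hash map of the estimators
`η̂π_ℓ(u, w)`, with keys `(w, ℓ)`, and of the estimators `ŝ_B^i(u, ·)` of the current round. -/
def sampleOnce (G : Digraph (Fin n)) (c : Set.Ioo (0 : ℝ) 1) (ε δ : ℝ) (I : Index n) (u : Fin n)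
    (st : ((Fin n × ℕ) →₀ ℝ) × (Fin n →₀ ℝ)) :
    RandTimed (((Fin n × ℕ) →₀ ℝ) × (Fin n →₀ ℝ)) := do
  let p ← sampleWalk G c u
  let w := p.getLastD u
  let ℓ := p.length - 1
  let p₁ ← sampleWalk G c w
  let p₂ ← sampleWalk G c w
  RandTimed.charge (min p₁.length p₂.length)
  if Meet p₁ p₂ then pure st
  else do
    RandTimed.charge 1
    let ηπ := st.1 + Finsupp.single (w, ℓ) (1 / ((dR c ε : ℝ) * fR n δ))
    if w ∈ I.hubs then pure (ηπ, st.2)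
    else do
      let h ← backwardWalk G c I.adj w ℓ
      let s ← h.support.toList.foldlM (fun (s : Fin n →₀ ℝ) v => do
        RandTimed.charge 1
        pure (s + Finsupp.single v (h v / ((1 - sq c) ^ 2 * dR c ε)))) st.2
      pure (ηπ, s)

/-- All `f_r` rounds of `d_r` samples: returns the estimators `η̂π_ℓ(u, w)` and the list of the
estimators `ŝ_B^i(u, ·)`. -/
def sampleRounds (G : Digraph (Fin n)) (c : Set.Ioo (0 : ℝ) 1) (ε δ : ℝ) (I : Index n)
    (u : Fin n) : RandTimed (((Fin n × ℕ) →₀ ℝ) × List (Fin n →₀ ℝ)) :=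
  (List.range (fR n δ)).foldlM
    (fun (acc : ((Fin n × ℕ) →₀ ℝ) × List (Fin n →₀ ℝ)) _ => do
      RandTimed.charge 1
      let st ← (List.range (dR c ε)).foldlM
        (fun st _ => sampleOnce G c ε δ I u st) (acc.1, (0 : Fin n →₀ ℝ))
      pure (st.1, acc.2 ++ [st.2])) (0, [])

open Classical in
/-- The median of a list of numbers. -/
def median (l : List ℝ) : ℝ := (l.mergeSort fun a b => decide (a ≤ b)).getD (l.length / 2) 0

open Classical in
/-- `ŝ_B(u, v) = Median_i ŝ_B^i(u, v)` for each `v` with a non-zero `ŝ_B^i(u, v)`. First the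
non-zero entries are gathered by `v`; the median of the numbers at `v`, all of them non-negative, is
then found by a linear-time selection among the non-zero ones. -/
def medians (ss : List (Fin n →₀ ℝ)) : RandTimed (Fin n →₀ ℝ) := do
  RandTimed.charge (ss.map fun s => s.support.card).sum
  (Finset.univ.filter fun v => ∃ s ∈ ss, s v ≠ 0).toList.foldlM (fun (sB : Fin n →₀ ℝ) v => do
    RandTimed.charge (1 + (ss.filter fun s => decide (s v ≠ 0)).length)
    pure (sB + Finsupp.single v (median (ss.map fun s => s v)))) 0

open Classical in
/-- The estimators `ŝ_I(u, ·)`: for each `(w, ℓ)` with `η̂π_ℓ(u, w) > ε / c₁` and `w` in the index,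
the list `L_ℓ(w)` is retrieved. -/
def retrieve (c : Set.Ioo (0 : ℝ) 1) (ε : ℝ) (I : Index n) (ηπ : (Fin n × ℕ) →₀ ℝ) :
    RandTimed (Fin n →₀ ℝ) :=
  ηπ.support.toList.foldlM (fun (sI : Fin n →₀ ℝ) k => do
    RandTimed.charge 1
    if ε / c₁ c < ηπ k ∧ k.1 ∈ I.hubs then
      (I.lists k.1 k.2).foldlM (fun (sI : Fin n →₀ ℝ) t => do
        RandTimed.charge 1
        pure (sI + Finsupp.single t.1 (ηπ k * t.2 / (1 - sq c) ^ 2))) sI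
    else pure sI) 0

/-- The query algorithm for the source node `u`; it returns the estimators `ŝ(u, ·)`. -/
def query (G : Digraph (Fin n)) (c : Set.Ioo (0 : ℝ) 1) (ε δ : ℝ) (I : Index n) (u : Fin n) :
    RandTimed (Fin n →₀ ℝ) := do
  let st ← sampleRounds G c ε δ I u
  let sB ← medians st.2
  let sI ← retrieve c ε I st.1
  RandTimed.charge (sB.support.card + sI.support.card)
  pure (sB + sI)

/-- The expected query cost for a uniformly random source node. -/
def expectedQueryCost (G : Digraph (Fin n)) (c : Set.Ioo (0 : ℝ) 1) (ε δ : ℝ) (I : Index n) :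
    ℝ≥0∞ :=
  (∑ u, (query G c ε δ I u).expectedTime) / n

/-! ### Power laws and hub nodes -/

/-- `w 0, w 1, …` lists the nodes in descending order of reverse PageRank, and the `j`-th largest
reverse PageRank (`j = 1, …, n`) is `j^(-1/γ) / n^(1 - 1/γ)` up to a factor between `κ₁` and
`κ₂`. -/
structure PowerLaw (G : Digraph (Fin n)) (c : Set.Ioo (0 : ℝ) 1) (γ κ₁ κ₂ : ℝ)
    (w : Equiv.Perm (Fin n)) : Prop where
  sorted : Antitone fun j => reversePageRank G c (w j)
  lower : ∀ j : Fin n, κ₁ * (((j : ℕ) + 1 : ℝ) ^ (-(1 / γ)) / (n : ℝ) ^ (1 - 1 / γ)) ≤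
    reversePageRank G c (w j)
  upper : ∀ j : Fin n, reversePageRank G c (w j) ≤
    κ₂ * (((j : ℕ) + 1 : ℝ) ^ (-(1 / γ)) / (n : ℝ) ^ (1 - 1 / γ))

/-- `j₀ = n (ε d̄)^(γ / (γ - 1))`, rounded down. -/
def j₀ (G : Digraph (Fin n)) (γ ε : ℝ) : ℕ := ⌊(n : ℝ) * (ε * avgDeg G) ^ (γ / (γ - 1))⌋₊

/-- The hub nodes: the first `min j₀ n` nodes in the order `w`. -/
def hubNodes (G : Digraph (Fin n)) (γ ε : ℝ) (w : Equiv.Perm (Fin n)) : Finset (Fin n) :=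
  (Finset.univ.filter fun j : Fin n => (j : ℕ) < j₀ G γ ε).map w.toEmbedding

end PRSim

end

open PRSim

/-! The proof is an amortized analysis in which the expected number of steps is always bounded
together with a potential of the resulting state (`RandTimed.wp`). Write θ = 1 - √c. The operator
`bwd` is adjoint to one move of the √c-walk: θ (bwd^ℓ β)(w) is the sum over u of β(u) times the
probability that the walk from u terminates at w after ℓ moves (`stopProb_mul_bwd_iterate`). For β =
1, summation over ℓ gives n π(w), here called `totalMass`.

Both backward procedures transport mass by `bwd`, and both pay for their steps with mass. In the
Variance Bounded Backward Walk each addend written is at least θ and its expected size is that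
prescribed by `bwd`; hence the walk from w costs O(ℓ + n π(w)) in expectation
(`wp_backwardWalk_le`). In the backward search only residues above ε/c₁ are pushed, so each push is
paid by c₁/ε times the mass moved. Summed over all targets w and with the out-degree as weight, this
yields O(m/ε) preprocessing time (`sum_tsum_bwd_iterate`), and the lists of w have at most (c₁/ε) n
π(w) entries. The value of j₀ is the one for which the power law turns the sum of these lengths over
the hub nodes into O(m).

For a uniformly random source a sample ends at w with probability π(w), so its expected cost is O(1
+ n ∑ π(w)²), the sum being over the non-hub nodes. Retrieval is controlled through an auxiliary set
T of nodes: lists of nodes in T are charged in full, and outside T a list is read only if η̂π >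
ε/c₁, so its length can be charged to η̂π, which is additive over the samples. This gives
`expectedQueryCost_le`, with T still free.

Under the power law the sums of π² are bounded for γ > 2 and logarithmic for γ = 2, up to the factor
1/n; there T = ∅ suffices. For γ < 2 the sum of π² over ranks above J decays like (J/n)^(-(2/γ-1)) /
n. The lower bound on ε makes j₀ so large that this decay absorbs the factor log n. The two terms of
the minimum come from taking T to be the first ⌊1/ε⌋ nodes and T = ∅. -/

noncomputable section

namespace PRSim

open MeasureTheory

/-! ### Expectations of discrete laws -/

/-- The expectation of `f` under `p`. -/
def expect {α : Type*} (p : PMF α) (f : α → ℝ≥0∞) : ℝ≥0∞ := ∑' a, p a * f a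

section expect
variable {α β : Type*}

theorem expect_mono (p : PMF α) {f g : α → ℝ≥0∞} (h : ∀ a, f a ≤ g a) :
    expect p f ≤ expect p g :=
  ENNReal.tsum_le_tsum fun a => mul_le_mul_right (h a) _

theorem expect_const (p : PMF α) (k : ℝ≥0∞) : expect p (fun _ => k) = k := by
  simp [expect, ENNReal.tsum_mul_right, p.tsum_coe]

theorem expect_add (p : PMF α) (f g : α → ℝ≥0∞) :
    expect p (fun a => f a + g a) = expect p f + expect p g := by
  simp [expect, mul_add, ENNReal.tsum_add]

theorem expect_pure (a : α) (f : α → ℝ≥0∞) : expect (PMF.pure a) f = f a := by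
  rw [expect, tsum_eq_single a]
  · simp
  · intro b hb
    simp [hb]

theorem expect_bind (p : PMF α) (g : α → PMF β) (f : β → ℝ≥0∞) :
    expect (p.bind g) f = expect p fun a => expect (g a) f := by
  simp only [expect, PMF.bind_apply, ← ENNReal.tsum_mul_right, ← ENNReal.tsum_mul_left]
  rw [ENNReal.tsum_comm]
  exact tsum_congr fun a => tsum_congr fun b => mul_assoc _ _ _

theorem expect_map (p : PMF α) (g : α → β) (f : β → ℝ≥0∞) :
    expect (p.map g) f = expect p fun a => f (g a) := by
  simp only [PMF.map, expect_bind, Function.comp_apply, expect_pure]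

end expect

/-! ### Expected time plus final potential -/

section wp
variable {α β σ : Type}

/-- The expectation of the number of steps plus the potential `F` of the result. -/
def RandTimed.wp (x : RandTimed α) (F : α → ℝ≥0∞) : ℝ≥0∞ :=
  expect (show PMF (α × ℕ) from x) fun q => F q.1 + q.2

namespace RandTimed

theorem expectedTime_eq_wp (x : RandTimed α) : x.expectedTime = x.wp fun _ => 0 := by
  simp [expectedTime, wp, expect]

theorem wp_pure (a : α) (F : α → ℝ≥0∞) : wp (pure a) F = F a := by
  refine (expect_pure (a, 0) _).trans ?_
  simp

theorem wp_bind (x : RandTimed α) (g : α → RandTimed β) (F : β → ℝ≥0∞) :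
    wp (x >>= g) F = wp x fun a => wp (g a) F := by
  refine (expect_bind _ _ _).trans ?_
  refine congrArg (expect _) (funext fun p => ?_)
  refine (expect_map _ _ _).trans ?_
  have h : (fun a : β × ℕ => F a.1 + ((p.2 + a.2 : ℕ) : ℝ≥0∞)) =
      fun a => (F a.1 + (a.2 : ℝ≥0∞)) + (p.2 : ℝ≥0∞) := by
    funext a
    push_cast
    ring
  change expect _ (fun a : β × ℕ => F a.1 + ((p.2 + a.2 : ℕ) : ℝ≥0∞)) = _
  rw [h]
  exact (expect_add _ _ _).trans (congrArg₂ _ rfl (expect_const _ _))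

theorem wp_charge (k : ℕ) (F : Unit → ℝ≥0∞) : wp (charge k) F = F () + k :=
  expect_pure _ _

theorem wp_draw (p : PMF α) (time : α → ℕ) (F : α → ℝ≥0∞) :
    wp (draw p time) F = expect p fun a => F a + time a :=
  expect_map _ _ _

theorem wp_mono (x : RandTimed α) {F F' : α → ℝ≥0∞} (h : ∀ a, F a ≤ F' a) :
    wp x F ≤ wp x F' :=
  expect_mono _ fun q => add_le_add_left (h q.1) _

theorem wp_add_const (x : RandTimed α) (F : α → ℝ≥0∞) (k : ℝ≥0∞) :
    wp x (fun a => F a + k) = wp x F + k := by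
  have h : (fun q : α × ℕ => F q.1 + k + (q.2 : ℝ≥0∞)) =
      fun q => (F q.1 + (q.2 : ℝ≥0∞)) + k := by
    funext q
    ring
  rw [wp, h, expect_add, expect_const]
  rfl

/-- The amortization principle: an iteration that raises potential plus time by at most its price,
whatever the state, may be charged that price, and prices add up. -/
theorem wp_foldlM_le (step : σ → β → RandTimed σ) (Φ : σ → ℝ≥0∞) (cost : β → ℝ≥0∞) (l : List β)
    (h : ∀ s, ∀ x ∈ l, wp (step s x) Φ ≤ Φ s + cost x) (s : σ) :
    wp (l.foldlM step s) Φ ≤ Φ s + (l.map cost).sum := by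
  induction l generalizing s with
  | nil => simp [wp_pure]
  | cons a l ih =>
    rw [List.foldlM_cons, wp_bind]
    refine (wp_mono _ fun s' => ih (fun s x hx => h s x (List.mem_cons_of_mem _ hx)) s').trans ?_
    rw [wp_add_const, List.map_cons, List.sum_cons, ← add_assoc]
    exact add_le_add_left (h s a List.mem_cons_self) _

/-- Here the potential depends on the number k of iterations still to come and pays for them in
advance. -/
theorem wp_foldlM_le_length (step : σ → β → RandTimed σ) (Φ : ℕ → σ → ℝ≥0∞)
    (h : ∀ k s x, wp (step s x) (Φ k) ≤ Φ (k + 1) s) (l : List β) (s : σ) :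
    wp (l.foldlM step s) (Φ 0) ≤ Φ l.length s := by
  induction l generalizing s with
  | nil => simp [wp_pure]
  | cons a l ih =>
    rw [List.foldlM_cons, wp_bind]
    exact (wp_mono _ ih).trans (h _ _ _)

end RandTimed

namespace Timed

theorem val_foldlM (step : σ → β → Timed σ) (l : List β) (s : σ) :
    (l.foldlM step s).val = l.foldl (fun s x => (step s x).val) s := by
  induction l generalizing s with
  | nil => rfl
  | cons a l ih => exact ih _

theorem time_foldlM (step : σ → β → Timed σ) (cost : β → ℕ) (h : ∀ s x, (step s x).time = cost x)
    (l : List β) (s : σ) : (l.foldlM step s).time = (l.map cost).sum := by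
  induction l generalizing s with
  | nil => rfl
  | cons a l ih =>
    rw [List.map_cons, List.sum_cons, ← ih (step s a).val, ← h s a]
    rfl

end Timed

end wp

/-! ### Weighted masses of hash maps -/

section mass
variable {K : Type*}

/-- The sum of the positive parts of the entries of `f`, weighted with `β`. -/
def mass (β : K → ℝ≥0∞) (f : K →₀ ℝ) : ℝ≥0∞ := ∑' k, ENNReal.ofReal (f k) * β k

theorem mass_zero (β : K → ℝ≥0∞) : mass β 0 = 0 := by simp [mass]

/-- Since `mass` uses positive parts, it is subadditive for entries of any sign. No estimator or
residue has to be shown to be non-negative. -/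
theorem mass_add_le (β : K → ℝ≥0∞) (f g : K →₀ ℝ) : mass β (f + g) ≤ mass β f + mass β g := by
  rw [mass, mass, mass, ← ENNReal.tsum_add]
  refine ENNReal.tsum_le_tsum fun k => ?_
  rw [← add_mul]
  exact mul_le_mul_left ENNReal.ofReal_add_le _

theorem mass_single (β : K → ℝ≥0∞) (k : K) (x : ℝ) :
    mass β (Finsupp.single k x) = ENNReal.ofReal x * β k := by
  classical
  rw [mass, tsum_eq_single k]
  · simp
  · intro b hb
    simp [Ne.symm hb]

theorem mass_mono {β β' : K → ℝ≥0∞} (h : ∀ k, β k ≤ β' k) (f : K →₀ ℝ) : mass β f ≤ mass β' f :=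
  ENNReal.tsum_le_tsum fun k => mul_le_mul_right (h k) _

theorem mass_eq_sum (β : K → ℝ≥0∞) (f : K →₀ ℝ) :
    mass β f = ∑ k ∈ f.support, ENNReal.ofReal (f k) * β k := by
  refine tsum_eq_sum fun k hk => ?_
  rw [Finsupp.notMem_support_iff.1 hk]
  simp

theorem sum_toList_eq_sum (s : Finset K) (g : K → ℝ≥0∞) : (s.toList.map g).sum = ∑ k ∈ s, g k :=
  Finset.sum_map_toList s g

theorem card_support_add_single_le (f : K →₀ ℝ) (k : K) (x : ℝ) :
    ((f + Finsupp.single k x).support.card : ℝ≥0∞) ≤ f.support.card + 1 := by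
  classical
  have h : (f + Finsupp.single k x).support.card ≤ f.support.card + 1 :=
    (Finset.card_le_card Finsupp.support_add).trans ((Finset.card_union_le _ _).trans
      (Nat.add_le_add_left ((Finset.card_le_card Finsupp.support_single_subset).trans
        (Finset.card_singleton k).le) _))
  exact_mod_cast h

end mass

variable {n : ℕ}

/-! ### Random numbers -/

theorem expect_lawOfRand (f : ℝ → ℕ) (hf : Measurable f) (F : ℕ → ℝ≥0∞) :
    expect (lawOfRand f hf) F = ∫⁻ r in Set.Ioo 0 1, F (f r) := by
  have := isProbabilityMeasure_map_unit hf
  rw [← lintegral_map (measurable_of_countable F) hf, lintegral_countable']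
  refine tsum_congr fun k => ?_
  rw [mul_comm]
  rfl

theorem expect_coin (c : Set.Ioo (0 : ℝ) 1) (A : ℝ≥0∞) :
    expect (coin c) (fun b => if b = 1 then A else 0) ≤ ENNReal.ofReal (sq c) * A := by
  rw [coin, expect_lawOfRand]
  have h : ∀ r : ℝ, (if (if r < sq c then 1 else 0) = 1 then A else 0) =
      (Set.Iio (sq c)).indicator (fun _ => A) r := by
    intro r
    by_cases hr : r < sq c <;> simp [hr]
  simp only [h]
  rw [lintegral_indicator_const measurableSet_Iio, mul_comm,
    Measure.restrict_apply measurableSet_Iio]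
  refine mul_le_mul_left ?_ _
  refine (measure_mono (t := Set.Ioo 0 (sq c)) fun r hr => ⟨hr.2.1, hr.1⟩).trans ?_
  simp

/-- The event forces 0 < r ≤ q / d. Its probability is bounded by the length of this interval on the
whole line, so neither q < 0 nor q > d needs separate treatment. -/
theorem expect_scanBound (q : ℝ) {d : ℕ} (hd : d ≠ 0) (A : ℝ≥0∞) :
    expect (scanBound q) (fun t => if d ≤ t then A else 0) ≤ ENNReal.ofReal (q / d) * A := by
  rw [scanBound, expect_lawOfRand]
  have hd' : (0 : ℝ) < d := by exact_mod_cast Nat.pos_of_ne_zero hd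
  have h : ∀ r ∈ Set.Ioo (0 : ℝ) 1, (if d ≤ ⌊q / r⌋₊ then A else 0) ≤
      (Set.Ioc 0 (q / d)).indicator (fun _ => A) r := by
    intro r hr
    split_ifs with h1
    · rw [Nat.le_floor_iff' hd, le_div_iff₀ hr.1] at h1
      rw [Set.indicator_of_mem]
      exact ⟨hr.1, by rw [le_div_iff₀ hd']; linarith⟩
    · exact zero_le
  refine (setLIntegral_mono_ae' measurableSet_Ioo (Filter.Eventually.of_forall h)).trans ?_
  refine (setLIntegral_le_lintegral _ _).trans ?_
  rw [lintegral_indicator_const measurableSet_Ioc, mul_comm]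
  simp

/-! ### Sums over lists -/

section lists
variable {α : Type*}

theorem sum_map_le_sum_map {l : List α} {f g : α → ℝ≥0∞} (h : ∀ x ∈ l, f x ≤ g x) :
    (l.map f).sum ≤ (l.map g).sum := by
  induction l with
  | nil => simp
  | cons a l ih =>
    simp only [List.map_cons, List.sum_cons]
    exact add_le_add (h a List.mem_cons_self) (ih fun x hx => h x (List.mem_cons_of_mem _ hx))

/-- A prefix is bounded by all entries that satisfy the predicate. For this reason the cost bounds
never use that the adjacency lists are sorted. -/
theorem sum_map_takeWhile_le (l : List α) (p : α → Bool) (f : α → ℝ≥0∞) :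
    ((l.takeWhile p).map f).sum ≤ (l.map fun y => if p y then f y else 0).sum := by
  induction l with
  | nil => simp
  | cons a l ih =>
    by_cases h : p a
    · simpa [h] using add_le_add_right ih _
    · simp [h]

theorem expect_sum_map {β : Type*} (p : PMF β) (l : List α) (f : α → β → ℝ≥0∞) :
    expect p (fun b => (l.map fun y => f y b).sum) = (l.map fun y => expect p (f y)).sum := by
  induction l with
  | nil => simp [expect_const]
  | cons a l ih => simp only [List.map_cons, List.sum_cons, expect_add, ih]

theorem mul_sum_map (l : List α) (k : ℝ≥0∞) (f : α → ℝ≥0∞) :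
    (l.map fun y => k * f y).sum = k * (l.map f).sum := List.sum_map_mul_left ..

theorem sum_map_const (l : List α) (k : ℝ≥0∞) : (l.map fun _ => k).sum = l.length * k := by
  simp

end lists

/-! ### The backward operator -/

/-- Each list `adj v` consists of distinct out-neighbours of `v`. -/
def IsAdjacency (G : Digraph (Fin n)) (adj : Fin n → List (Fin n)) : Prop :=
  ∀ v, (adj v).Nodup ∧ ∀ z ∈ adj v, G.Adj v z

open Classical in
/-- The out-neighbours of `v`. -/
def outNbrs (G : Digraph (Fin n)) (v : Fin n) : Finset (Fin n) :=
  Finset.univ.filter fun z => G.Adj v z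

theorem IsAdjacency.sum_le {G : Digraph (Fin n)} {adj : Fin n → List (Fin n)}
    (h : IsAdjacency G adj) (v : Fin n) (g : Fin n → ℝ≥0∞) :
    ((adj v).map g).sum ≤ ∑ z ∈ outNbrs G v, g z := by
  classical
  rw [← List.sum_toFinset g (h v).1]
  refine Finset.sum_le_sum_of_subset fun z hz => ?_
  simpa [outNbrs] using (h v).2 z (List.mem_toFinset.1 hz)

/-- `(T β)(v) = ∑ √c β(z) / d_in(z)`, where `z` ranges over the out-neighbours of `v`. -/
def bwd (G : Digraph (Fin n)) (c : Set.Ioo (0 : ℝ) 1) (β : Fin n → ℝ≥0∞) (v : Fin n) : ℝ≥0∞ :=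
  ∑ z ∈ outNbrs G v, ENNReal.ofReal (sq c / dIn G z) * β z

theorem bwd_add (G : Digraph (Fin n)) (c : Set.Ioo (0 : ℝ) 1) (β β' : Fin n → ℝ≥0∞) :
    bwd G c (β + β') = bwd G c β + bwd G c β' := by
  funext v
  simp [bwd, mul_add, Finset.sum_add_distrib]

theorem bwd_smul (G : Digraph (Fin n)) (c : Set.Ioo (0 : ℝ) 1) (k : ℝ≥0∞) (β : Fin n → ℝ≥0∞) :
    bwd G c (k • β) = k • bwd G c β := by
  funext v
  simp only [bwd, Pi.smul_apply, smul_eq_mul, Finset.mul_sum]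
  exact Finset.sum_congr rfl fun z _ => mul_left_comm _ _ _

theorem dIn_pos {G : Digraph (Fin n)} {x y : Fin n} (h : G.Adj x y) : 0 < dIn G y :=
  Finset.card_pos.2 ⟨x, by simpa [inNbrs] using h⟩

/-! ### The Variance Bounded Backward Walk -/

theorem one_sub_sq_pos (c : Set.Ioo (0 : ℝ) 1) : 0 < 1 - sq c := sub_pos.2 (sq_lt_one c)

/-- `1 - √c`. -/
def stopProb (c : Set.Ioo (0 : ℝ) 1) : ℝ≥0∞ := ENNReal.ofReal (1 - sq c)

theorem stopProb_ne_zero (c : Set.Ioo (0 : ℝ) 1) : stopProb c ≠ 0 := by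
  simpa [stopProb] using sq_lt_one c

theorem stopProb_ne_top (c : Set.Ioo (0 : ℝ) 1) : stopProb c ≠ ⊤ := ENNReal.ofReal_ne_top

theorem stopProb_mul_inv (c : Set.Ioo (0 : ℝ) 1) : stopProb c * (stopProb c)⁻¹ = 1 :=
  ENNReal.mul_inv_cancel (stopProb_ne_zero c) (stopProb_ne_top c)

/-- The potential `5 |supp f| + mass g f` of an estimator. -/
def walkPotential (g : Fin n → ℝ≥0∞) (f : Fin n →₀ ℝ) : ℝ≥0∞ :=
  5 * (f.support.card : ℝ≥0∞) + mass g f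

/-- The 6 consists of the potential 5 of a possibly new key and the step itself. -/
theorem walkPotential_add_single_le (g : Fin n → ℝ≥0∞) (f : Fin n →₀ ℝ) (y : Fin n) (x : ℝ) :
    walkPotential g (f + Finsupp.single y x) + 1 ≤
      walkPotential g f + (6 + ENNReal.ofReal x * g y) := by
  have h1 := card_support_add_single_le f y x
  have h2 := mass_add_le g f (Finsupp.single y x)
  rw [mass_single] at h2
  calc walkPotential g (f + Finsupp.single y x) + 1
      ≤ 5 * ((f.support.card : ℝ≥0∞) + 1) + (mass g f + ENNReal.ofReal x * g y) + 1 := by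
        unfold walkPotential
        gcongr
    _ = _ := by
        unfold walkPotential
        ring

/-- An addend x ≥ 1 - √c carries enough mass to pay the constant cost 6 of writing it, at the rate 6
/ (1 - √c) per unit of mass. -/
theorem six_add_le (c : Set.Ioo (0 : ℝ) 1) {x : ℝ} (hx : 1 - sq c ≤ x) (a : ℝ≥0∞) :
    6 + ENNReal.ofReal x * a ≤ ENNReal.ofReal x * (a + 6 * (stopProb c)⁻¹) := by
  have h : stopProb c ≤ ENNReal.ofReal x := ENNReal.ofReal_le_ofReal hx
  calc 6 + ENNReal.ofReal x * a
      = 6 * (stopProb c * (stopProb c)⁻¹) + ENNReal.ofReal x * a := by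
        rw [stopProb_mul_inv, mul_one]
    _ ≤ 6 * (ENNReal.ofReal x * (stopProb c)⁻¹) + ENNReal.ofReal x * a := by gcongr
    _ = _ := by ring

/-- Both scans write only addends of size at least 1 - √c, so that writing is paid by mass. In the
first scan the addend to y is `cur x / dIn G y`; in the second it is 1 - √c with probability at most
q / d_in(y), which has the same expected size. The coin contributes the factor √c that turns this
into `bwd`. The 2 per key pays for the coin and for r. -/
theorem wp_backwardStep_le {G : Digraph (Fin n)} (c : Set.Ioo (0 : ℝ) 1)
    {adj : Fin n → List (Fin n)} (hadj : IsAdjacency G adj) (g : Fin n → ℝ≥0∞)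
    (cur : Fin n →₀ ℝ) :
    (backwardStep G c adj cur).wp (walkPotential g) ≤
      2 * (cur.support.card : ℝ≥0∞) + mass (bwd G c fun y => g y + 6 * (stopProb c)⁻¹) cur := by
  set g' : Fin n → ℝ≥0∞ := fun y => g y + 6 * (stopProb c)⁻¹ with hg'
  have hθ := one_sub_sq_pos c
  refine (RandTimed.wp_foldlM_le _ (walkPotential g)
    (fun x => 2 + ENNReal.ofReal (cur x) * bwd G c g' x) _ ?_ 0).trans ?_
  · intro next x _
    set S : ℝ≥0∞ := ((adj x).map fun y => ENNReal.ofReal (cur x / dIn G y) * g' y).sum with hS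
    have key : ∀ b, RandTimed.wp (if b = 1 then do
          let q := cur x / (1 - sq c)
          let next ← ((adj x).takeWhile fun y => decide ((dIn G y : ℝ) ≤ q)).foldlM
            (fun (next : Fin n →₀ ℝ) y => do
              RandTimed.charge 1
              pure (next + Finsupp.single y (cur x / dIn G y))) next
          let t ← RandTimed.draw (scanBound q) (fun _ => 1)
          (((adj x).dropWhile fun y => decide ((dIn G y : ℝ) ≤ q)).takeWhile
            fun y => decide (dIn G y ≤ t)).foldlM
            (fun (next : Fin n →₀ ℝ) y => do
              RandTimed.charge 1
              pure (next + Finsupp.single y (1 - sq c))) next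
        else pure next) (walkPotential g) ≤
        walkPotential g next + (if b = 1 then 1 + S else 0) := by
      intro b
      split_ifs with hb
      · simp only [RandTimed.wp_bind, RandTimed.wp_draw]
        set q := cur x / (1 - sq c) with hq
        set l₁ := (adj x).takeWhile fun y => decide ((dIn G y : ℝ) ≤ q) with hl₁
        set l₂ := (adj x).dropWhile fun y => decide ((dIn G y : ℝ) ≤ q) with hl₂
        have hl : l₁ ++ l₂ = adj x := List.takeWhile_append_dropWhile
        set S₁ : ℝ≥0∞ := (l₁.map fun y => ENNReal.ofReal (cur x / dIn G y) * g' y).sum with hS₁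
        set S₂ : ℝ≥0∞ := (l₂.map fun y => ENNReal.ofReal (cur x / dIn G y) * g' y).sum with hS₂
        have hSS : S = S₁ + S₂ := by rw [hS, ← hl, List.map_append, List.sum_append]
        have hd : ∀ y ∈ adj x, 0 < dIn G y := fun y hy => dIn_pos ((hadj x).2 y hy)
        -- The scan runs up to a random bound t; exchanging expectation and sum reduces it to the
        -- probability that one given y is reached.
        have second : ∀ f : Fin n →₀ ℝ, (expect (scanBound q) fun t => RandTimed.wp
            ((l₂.takeWhile fun y => decide (dIn G y ≤ t)).foldlM
              (fun (next : Fin n →₀ ℝ) y => do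
                RandTimed.charge 1
                pure (next + Finsupp.single y (1 - sq c))) f) (walkPotential g) +
              ((1 : ℕ) : ℝ≥0∞)) ≤ walkPotential g f + (1 + S₂) := by
          intro f
          calc _ ≤ expect (scanBound q) fun t => (l₂.map fun y => if dIn G y ≤ t then
                  stopProb c * g' y else 0).sum + (walkPotential g f + 1) := by
                refine expect_mono _ fun t => ?_
                rw [Nat.cast_one, ← add_assoc]
                refine add_le_add_left ?_ _
                refine (RandTimed.wp_foldlM_le _ (walkPotential g)
                  (fun y => stopProb c * g' y) _ (fun f y _ => ?_) f).trans ?_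
                · rw [RandTimed.wp_bind, RandTimed.wp_charge, RandTimed.wp_pure, Nat.cast_one]
                  refine (walkPotential_add_single_le _ _ _ _).trans ?_
                  exact add_le_add_right (six_add_le c le_rfl _) _
                · rw [add_comm]
                  refine add_le_add_left ?_ _
                  refine (sum_map_takeWhile_le _ _ _).trans (le_of_eq ?_)
                  simp
            _ = (l₂.map fun y => expect (scanBound q) fun t => if dIn G y ≤ t then
                  stopProb c * g' y else 0).sum + (walkPotential g f + 1) := by
                rw [expect_add, expect_const, expect_sum_map]
            _ ≤ S₂ + (walkPotential g f + 1) := by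
                refine add_le_add_left (sum_map_le_sum_map fun y hy => ?_) _
                have hy' := hd y (hl ▸ List.mem_append_right _ hy)
                refine (expect_scanBound q hy'.ne' _).trans ?_
                rw [← mul_assoc]
                refine mul_le_mul_left (le_of_eq ?_) _
                rw [stopProb, mul_comm, ← ENNReal.ofReal_mul hθ.le, hq]
                congr 1
                field_simp
            _ = _ := by ring
        refine (RandTimed.wp_mono _ second).trans ?_
        rw [RandTimed.wp_add_const]
        have first : RandTimed.wp (l₁.foldlM (fun (next : Fin n →₀ ℝ) y => do
              RandTimed.charge 1
              pure (next + Finsupp.single y (cur x / dIn G y))) next) (walkPotential g) ≤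
            walkPotential g next + S₁ := by
          refine RandTimed.wp_foldlM_le _ _ _ _ (fun f y hy => ?_) _
          rw [RandTimed.wp_bind, RandTimed.wp_charge, RandTimed.wp_pure, Nat.cast_one]
          refine (walkPotential_add_single_le _ _ _ _).trans ?_
          refine add_le_add_right (six_add_le c ?_ _) _
          -- The first scan keeps only y with d_in(y) ≤ q, which says that the addend is at least 1
          -- - √c.
          have h1 : (dIn G y : ℝ) ≤ q := by simpa using List.mem_takeWhile_imp hy
          have h2 : (0 : ℝ) < dIn G y := by
            exact_mod_cast hd y (hl ▸ List.mem_append_left _ hy)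
          rw [hq, le_div_iff₀ hθ] at h1
          rw [le_div_iff₀ h2]
          linarith
        refine (add_le_add_left first _).trans (le_of_eq ?_)
        rw [hSS]
        ring
      · simp [RandTimed.wp_pure]
    have hS' : ENNReal.ofReal (sq c) * S ≤ ENNReal.ofReal (cur x) * bwd G c g' x := by
      rw [hS, bwd, Finset.mul_sum, ← mul_sum_map]
      refine (hadj.sum_le x _).trans (Finset.sum_le_sum fun z _ => ?_)
      rw [← mul_assoc, ← mul_assoc]
      refine mul_le_mul_left (le_of_eq ?_) _
      rw [← ENNReal.ofReal_mul (sq_pos c).le,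
        ← ENNReal.ofReal_mul' (div_nonneg (sq_pos c).le (Nat.cast_nonneg _))]
      congr 1
      ring
    rw [RandTimed.wp_bind, RandTimed.wp_draw]
    calc _ ≤ expect (coin c) fun b =>
          (if b = 1 then 1 + S else 0) + (walkPotential g next + 1) := by
            refine expect_mono _ fun b => ?_
            refine (add_le_add_left (key b) _).trans (le_of_eq ?_)
            push_cast
            ring
      _ ≤ ENNReal.ofReal (sq c) * (1 + S) + (walkPotential g next + 1) := by
            rw [expect_add, expect_const]
            exact add_le_add_left (expect_coin c _) _
      _ = ENNReal.ofReal (sq c) + ENNReal.ofReal (sq c) * S + (walkPotential g next + 1) := by ring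
      _ ≤ 1 + ENNReal.ofReal (cur x) * bwd G c g' x + (walkPotential g next + 1) := by
            gcongr
            exact ENNReal.ofReal_le_one.2 (sq_lt_one c).le
      _ = walkPotential g next + ((1 + 1) + ENNReal.ofReal (cur x) * bwd G c g' x) := by ring
      _ = _ := by rw [one_add_one_eq_two]
  · rw [sum_toList_eq_sum, Finset.sum_add_distrib, ← mass_eq_sum]
    simp [walkPotential, mass_zero, mul_comm]

/-- The final potential 5 per key prepays the use of the result: one step to add the entry to ŝ_B
and 4 for the median. -/
theorem wp_backwardWalk_le {G : Digraph (Fin n)} (c : Set.Ioo (0 : ℝ) 1)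
    {adj : Fin n → List (Fin n)} (hadj : IsAdjacency G adj) (w : Fin n) (ℓ : ℕ) :
    (backwardWalk G c adj w ℓ).wp (fun h => 5 * (h.support.card : ℝ≥0∞)) ≤
      ℓ + 5 + 6 * ∑ i ∈ Finset.range ℓ, (bwd G c)^[i + 1] 1 w := by
  -- The weight with k levels to go. It solves the recursion pot (k + 1) = bwd (pot k + 6 / (1 -
  -- √c)) with pot 0 = 0 imposed by the one-level estimate.
  let pot : ℕ → Fin n → ℝ≥0∞ := fun k =>
    (6 * (stopProb c)⁻¹) • ∑ i ∈ Finset.range k, (bwd G c)^[i + 1] 1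
  have hpot : ∀ k, bwd G c (fun y => pot k y + 6 * (stopProb c)⁻¹) = pot (k + 1) := by
    intro k
    have hsum : ∀ k, bwd G c (∑ i ∈ Finset.range k, (bwd G c)^[i + 1] 1) =
        ∑ i ∈ Finset.range k, (bwd G c)^[i + 1 + 1] 1 := by
      intro k
      induction k with
      | zero => funext v; simp [bwd]
      | succ k ih =>
        rw [Finset.sum_range_succ, bwd_add, ih, Finset.sum_range_succ,
          ← Function.iterate_succ_apply' (bwd G c) (k + 1)]
    have h1 : (fun y => pot k y + 6 * (stopProb c)⁻¹) =
        (6 * (stopProb c)⁻¹) • ((∑ i ∈ Finset.range k, (bwd G c)^[i + 1] 1) + 1) := by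
      funext y
      simp [pot, mul_add]
    rw [h1, bwd_smul, bwd_add, hsum]
    simp only [pot]
    rw [Finset.sum_range_succ']
    rfl
  have h0 : (fun h : Fin n →₀ ℝ => 5 * (h.support.card : ℝ≥0∞)) =
      fun h => (0 : ℕ) + walkPotential (pot 0) h := by
    funext h
    simp [walkPotential, pot, mass]
  rw [h0]
  refine (RandTimed.wp_foldlM_le_length _ (fun k h => (k : ℝ≥0∞) + walkPotential (pot k) h) ?_
    _ _).trans ?_
  · intro k s x
    rw [RandTimed.wp_bind, RandTimed.wp_charge]
    have h := wp_backwardStep_le c hadj (pot k) s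
    rw [hpot] at h
    have h1 : (fun h : Fin n →₀ ℝ => (k : ℝ≥0∞) + walkPotential (pot k) h) =
        fun h => walkPotential (pot k) h + k := funext fun _ => add_comm _ _
    rw [h1, RandTimed.wp_add_const]
    have h2 : 2 * (s.support.card : ℝ≥0∞) ≤ 5 * s.support.card := by
      gcongr
      norm_num
    calc _ ≤ 5 * (s.support.card : ℝ≥0∞) + mass (pot (k + 1)) s + k + (1 : ℕ) := by
          gcongr
          exact h.trans (add_le_add_left h2 _)
      _ = _ := by
          simp only [walkPotential]
          push_cast
          ring
  · have h1 : ((Finsupp.single w (1 - sq c)).support.card : ℝ≥0∞) ≤ 1 := by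
      have h : (Finsupp.single w (1 - sq c)).support.card ≤ 1 :=
        (Finset.card_le_card Finsupp.support_single_subset).trans (Finset.card_singleton w).le
      exact_mod_cast h
    rw [List.length_range, add_assoc]
    refine add_le_add_right ?_ _
    -- The walk starts with mass 1 - √c at w, which cancels the factor 1 / (1 - √c) of the weight.
    rw [walkPotential, mass_single]
    refine add_le_add ((mul_le_mul_right h1 _).trans_eq (mul_one _)) (le_of_eq ?_)
    simp only [pot, Pi.smul_apply, smul_eq_mul, Finset.sum_apply]
    change stopProb c * _ = _
    rw [← mul_assoc, mul_left_comm, stopProb_mul_inv, mul_one]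

/-! ### The law of the walk -/

/-- The probability that the `√c`-walk from `u` terminates at `w` after exactly `ℓ` moves. -/
def termProb (G : Digraph (Fin n)) (c : Set.Ioo (0 : ℝ) 1) : ℕ → Fin n → Fin n → ℝ≥0∞
  | 0, u, w => if u = w then stopProb c else 0
  | ℓ + 1, u, w => ∑ v ∈ inNbrs G u, ENNReal.ofReal (sq c / dIn G u) * termProb G c ℓ v w

theorem sum_inNbrs_comm (G : Digraph (Fin n)) (f : Fin n → Fin n → ℝ≥0∞) :
    ∑ u, ∑ v ∈ inNbrs G u, f u v = ∑ v, ∑ u ∈ outNbrs G v, f u v := by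
  refine Finset.sum_comm' fun u v => ?_
  simp [inNbrs, outNbrs]

/-- Duality of walk and backward operator: by induction on ℓ, the sum over edges (v, u) is arranged
by u for the walk and by v for `bwd`. -/
theorem stopProb_mul_bwd_iterate (G : Digraph (Fin n)) (c : Set.Ioo (0 : ℝ) 1) (ℓ : ℕ)
    (β : Fin n → ℝ≥0∞) (w : Fin n) :
    stopProb c * (bwd G c)^[ℓ] β w = ∑ u, termProb G c ℓ u w * β u := by
  induction ℓ generalizing β with
  | zero => simp [termProb]
  | succ ℓ ih =>
    rw [Function.iterate_succ_apply, ih]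
    simp only [termProb, bwd, Finset.sum_mul, Finset.mul_sum]
    rw [sum_inNbrs_comm]
    exact Finset.sum_congr rfl fun v _ => Finset.sum_congr rfl fun u _ => by ring

/-- `n π(w)`: the expected number of walks that terminate at `w` if one starts at every node. -/
def totalMass (G : Digraph (Fin n)) (c : Set.Ioo (0 : ℝ) 1) (w : Fin n) : ℝ≥0∞ :=
  ∑ u, ∑' ℓ, termProb G c ℓ u w

theorem tsum_stopProb_mul_bwd (G : Digraph (Fin n)) (c : Set.Ioo (0 : ℝ) 1) (w : Fin n) :
    ∑' ℓ, stopProb c * (bwd G c)^[ℓ] 1 w = totalMass G c w := by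
  simp only [stopProb_mul_bwd_iterate, Pi.one_apply, mul_one, totalMass]
  rw [Summable.tsum_finsetSum fun _ _ => ENNReal.summable]

theorem sum_bwd_iterate_le (G : Digraph (Fin n)) (c : Set.Ioo (0 : ℝ) 1) (w : Fin n) (ℓ : ℕ) :
    ∑ i ∈ Finset.range ℓ, (bwd G c)^[i + 1] 1 w ≤ (stopProb c)⁻¹ * totalMass G c w := by
  have h : ∑ i ∈ Finset.range ℓ, (bwd G c)^[i + 1] 1 w ≤ ∑' i, (bwd G c)^[i] 1 w :=
    (ENNReal.sum_le_tsum _).trans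
      (ENNReal.tsum_comp_le_tsum_of_injective (add_left_injective 1) fun i => (bwd G c)^[i] 1 w)
  refine h.trans (le_of_eq ?_)
  rw [← tsum_stopProb_mul_bwd, ENNReal.tsum_mul_left, ← mul_assoc, mul_comm (stopProb c)⁻¹,
    stopProb_mul_inv, one_mul]

theorem expect_move {G : Digraph (Fin n)} {u : Fin n} (hu : (inNbrs G u).Nonempty)
    (f : Fin n → ℝ≥0∞) :
    expect (move G u) f = ∑ v ∈ inNbrs G u, (dIn G u : ℝ≥0∞)⁻¹ * f v := by
  classical
  rw [expect, move, dif_pos hu, tsum_eq_sum (s := inNbrs G u)]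
  · refine Finset.sum_congr rfl fun v hv => ?_
    rw [PMF.uniformOfFinset_apply_of_mem _ hv, dIn]
  · intro v hv
    rw [PMF.uniformOfFinset_apply_of_notMem _ hv, zero_mul]

/-- The default d of `getLastD` varies in the induction: after the head v is removed, v becomes the
default for the rest. -/
theorem expect_trajectory {G : Digraph (Fin n)} (hG : ∀ v, (inNbrs G v).Nonempty)
    (c : Set.Ioo (0 : ℝ) 1) (k : ℕ) (u d : Fin n) (F : Fin n → ℕ → ℝ≥0∞) :
    ENNReal.ofReal (sq c ^ k * (1 - sq c)) *
      expect (trajectory G k u) (fun l => F (l.getLastD d) (l.length - 1)) =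
      ∑ w, termProb G c k u w * F w k := by
  -- Replacing `length - 1` by `length` keeps truncated subtraction out of the induction.
  suffices H : ∀ F : Fin n → ℕ → ℝ≥0∞, ENNReal.ofReal (sq c ^ k * (1 - sq c)) *
      expect (trajectory G k u) (fun l => F (l.getLastD d) l.length) =
      ∑ w, termProb G c k u w * F w (k + 1) from H fun w ℓ => F w (ℓ - 1)
  clear F
  intro F
  induction k generalizing u d F with
  | zero => simp [trajectory, expect_pure, termProb, stopProb]
  | succ k ih =>
    have hd : (0 : ℝ) < dIn G u := by exact_mod_cast Finset.card_pos.2 (hG u)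
    have h0 : 0 ≤ sq c ^ k * (1 - sq c) :=
      mul_nonneg (pow_nonneg (sq_pos c).le k) (one_sub_sq_pos c).le
    simp only [trajectory, expect_bind, expect_map, List.getLastD_cons, List.length_cons]
    rw [expect_move (hG u), Finset.mul_sum]
    simp only [termProb, Finset.sum_mul]
    rw [Finset.sum_comm]
    refine Finset.sum_congr rfl fun v _ => ?_
    have h1 : ENNReal.ofReal (sq c ^ (k + 1) * (1 - sq c)) * (dIn G u : ℝ≥0∞)⁻¹ =
        ENNReal.ofReal (sq c / dIn G u) * ENNReal.ofReal (sq c ^ k * (1 - sq c)) := by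
      rw [ENNReal.ofReal_div_of_pos hd, ENNReal.ofReal_natCast, pow_succ', mul_assoc,
        ENNReal.ofReal_mul (sq_pos c).le, div_eq_mul_inv]
      ring
    rw [← mul_assoc, h1, mul_assoc, ih v u fun w ℓ => F w (ℓ + 1), Finset.mul_sum]
    exact Finset.sum_congr rfl fun w _ => (mul_assoc _ _ _).symm

theorem expect_walk {G : Digraph (Fin n)} (hG : ∀ v, (inNbrs G v).Nonempty)
    (c : Set.Ioo (0 : ℝ) 1) (u d : Fin n) (F : Fin n → ℕ → ℝ≥0∞) :
    expect (walk G c u) (fun l => F (l.getLastD d) (l.length - 1)) =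
      ∑' ℓ, ∑ w, termProb G c ℓ u w * F w ℓ := by
  rw [walk, expect_bind]
  exact tsum_congr fun k => expect_trajectory hG c k u d F

theorem tsum_sum_termProb {G : Digraph (Fin n)} (hG : ∀ v, (inNbrs G v).Nonempty)
    (c : Set.Ioo (0 : ℝ) 1) (u : Fin n) : ∑' ℓ, ∑ w, termProb G c ℓ u w = 1 := by
  have h := expect_walk hG c u u fun _ _ => 1
  rw [expect_const] at h
  simpa using h.symm

theorem expect_trajectory_length (G : Digraph (Fin n)) (k : ℕ) (u : Fin n) (F : ℕ → ℝ≥0∞) :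
    expect (trajectory G k u) (fun l => F l.length) = F (k + 1) := by
  induction k generalizing u F with
  | zero => simp [trajectory, expect_pure]
  | succ k ih =>
    simp only [trajectory, expect_bind, expect_map, List.length_cons]
    simp only [ih _ fun ℓ => F (ℓ + 1), expect_const]

theorem expect_walk_length (G : Digraph (Fin n)) (c : Set.Ioo (0 : ℝ) 1) (u : Fin n) :
    expect (walk G c u) (fun l => (l.length : ℝ≥0∞)) = (stopProb c)⁻¹ := by
  have hθ := one_sub_sq_pos c
  have hnorm : ‖sq c‖ < 1 := by
    rw [Real.norm_of_nonneg (sq_pos c).le]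
    exact sq_lt_one c
  -- ∑ (k + 1) x^k = 1 / (1 - x)², where k + 1 is the number of nodes visited by k moves.
  have h := (hasSum_choose_mul_geometric_of_norm_lt_one 1 hnorm).mul_right (1 - sq c)
  rw [walk, expect_bind]
  simp only [expect_trajectory_length G _ u fun ℓ => (ℓ : ℝ≥0∞)]
  have h1 : ∀ k : ℕ, (numSteps c k : ℝ≥0∞) * ((k + 1 : ℕ) : ℝ≥0∞) =
      ENNReal.ofReal (((k + 1).choose 1 : ℕ) * sq c ^ k * (1 - sq c)) := by
    intro k
    rw [Nat.choose_one_right, mul_assoc, ENNReal.ofReal_mul (Nat.cast_nonneg _),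
      ENNReal.ofReal_natCast, mul_comm]
    rfl
  rw [expect, tsum_congr h1, ← ENNReal.ofReal_tsum_of_nonneg _ h.summable, h.tsum_eq, stopProb,
    ← ENNReal.ofReal_inv_of_pos hθ]
  · congr 1
    field_simp
  · intro k
    have := sq_pos c
    positivity

theorem totalMass_eq {G : Digraph (Fin n)} (hG : ∀ v, (inNbrs G v).Nonempty)
    (c : Set.Ioo (0 : ℝ) 1) (w : Fin n) :
    totalMass G c w = ENNReal.ofReal (n * reversePageRank G c w) := by
  classical
  have hn : (n : ℝ) ≠ 0 := by
    have := w.pos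
    positivity
  rw [reversePageRank, mul_div_cancel₀ _ hn, totalMass, ENNReal.ofReal_sum_of_nonneg]
  · refine Finset.sum_congr rfl fun u _ => ?_
    rw [rppr, ENNReal.ofReal_toReal (PMF.apply_ne_top _ _)]
    have h := expect_walk hG c u u fun x _ => if x = w then 1 else 0
    rw [← expect_map (walk G c u) (fun l => l.getLastD u) fun x => if x = w then 1 else 0,
      expect, tsum_eq_single w] at h
    · simpa using h.symm
    · intro b hb
      simp [hb]
  · intro u _
    exact ENNReal.toReal_nonneg

/-! ### Counting edges -/

theorem sum_card_outNbrs (G : Digraph (Fin n)) : ∑ v, (outNbrs G v).card = numEdges G := by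
  classical
  simp only [numEdges, edges, outNbrs, Finset.card_filter]
  rw [Fintype.sum_prod_type]

theorem sum_dIn (G : Digraph (Fin n)) : ∑ v, dIn G v = numEdges G := by
  classical
  simp only [numEdges, edges, dIn, inNbrs, Finset.card_filter]
  rw [Fintype.sum_prod_type_right]

theorem le_numEdges {G : Digraph (Fin n)} (hG : ∀ v, (inNbrs G v).Nonempty) : n ≤ numEdges G := by
  have h : ∑ _v : Fin n, 1 ≤ ∑ v, dIn G v :=
    Finset.sum_le_sum fun v _ => Finset.card_pos.2 (hG v)
  simpa [sum_dIn] using h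

theorem numEdges_le (G : Digraph (Fin n)) : numEdges G ≤ n * n := by
  have h := Finset.card_le_univ (edges G)
  simpa [numEdges] using h

/-! ### Folds over lists -/

section foldl
variable {α κ τ σ : Type*}

theorem foldl_append_singleton (f : α → τ) (l : List α) (T : List τ) :
    l.foldl (fun T e => T ++ [f e]) T = T ++ l.map f := by
  induction l generalizing T with
  | nil => simp
  | cons a l ih => simp [ih]

theorem foldl_append (B : α → List τ) (l : List α) (S : List τ) :
    l.foldl (fun S k => S ++ B k) S = S ++ l.flatMap B := by
  induction l generalizing S with
  | nil => simp
  | cons a l ih => simp [ih]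

theorem foldl_update_append [DecidableEq κ] (key : α → κ) (f : α → τ) (l : List α)
    (B : κ → List τ) (k : κ) :
    l.foldl (fun B t => Function.update B (key t) (B (key t) ++ [f t])) B k =
      B k ++ (l.filter fun t => key t = k).map f := by
  induction l generalizing B with
  | nil => simp
  | cons a l ih =>
    rw [List.foldl_cons, ih]
    by_cases h : key a = k
    · subst h
      simp
    · simp [h, Function.update_of_ne (Ne.symm h)]

theorem foldl_update_bucket [DecidableEq κ] (key : α → κ) (l : List α) :
    l.foldl (fun B t => Function.update B (key t) (B (key t) ++ [t])) (fun _ => []) =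
      fun k => l.filter fun t => key t = k := by
  funext k
  simpa using foldl_update_append key (fun t => t) l (fun _ => []) k

theorem foldl_potential_le (f : σ → α → σ) (Φ : σ → ℝ≥0∞) (cost : α → ℝ≥0∞)
    (h : ∀ s x, Φ (f s x) ≤ Φ s + cost x) (l : List α) (s : σ) :
    Φ (l.foldl f s) ≤ Φ s + (l.map cost).sum := by
  induction l generalizing s with
  | nil => simp
  | cons a l ih =>
    rw [List.foldl_cons, List.map_cons, List.sum_cons, ← add_assoc]
    exact (ih _).trans (add_le_add_left (h s a) _)

end foldl

namespace Timed
variable {α β : Type}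

theorem val_bind (x : Timed α) (g : α → Timed β) : (x >>= g).val = (g x.val).val := rfl

theorem time_bind (x : Timed α) (g : α → Timed β) :
    (x >>= g).time = x.time + (g x.val).time := rfl

theorem val_pure (a : α) : (pure a : Timed α).val = a := rfl

theorem time_pure (a : α) : (pure a : Timed α).time = 0 := rfl

theorem time_charge (k : ℕ) : (charge k).time = k := rfl

end Timed

/-! ### Sorting the adjacency lists -/

/-- The outcome of the counting sort of the tuples `T` by their last entry. -/
def sortedTuples (T : List (Fin n × Fin n × ℕ)) : List (Fin n × Fin n × ℕ) :=
  (List.range (n + 1)).flatMap fun k => T.filter fun t => t.2.2 = k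

/-- The key d by which the tuples are sorted stays anonymous, since the cost analysis does not
depend on its values. -/
theorem sortAdjacency_spec (G : Digraph (Fin n)) : ∃ d : Fin n → ℕ,
    (∀ x, (sortAdjacency G).val x =
      ((sortedTuples ((edges G).toList.map fun e => (e.1, e.2, d e.2))).filter
        fun t => t.1 = x).map fun t => t.2.1) ∧
    (sortAdjacency G).time = 4 * n + 2 + 3 * numEdges G +
      2 * (sortedTuples ((edges G).toList.map fun e => (e.1, e.2, d e.2))).length := by
  refine ⟨(edges G).toList.foldl (fun d e => Function.update d e.2 (d e.2 + 1)) fun _ => 0,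
    fun x => ?_, ?_⟩
  rotate_left
  · simp only [sortAdjacency, Timed.time_bind, Timed.time_charge, Timed.val_foldlM,
      Timed.val_bind, Timed.val_pure, foldl_append_singleton, foldl_append]
    rw [Timed.time_foldlM _ (fun _ => 1) (fun _ _ => rfl),
      Timed.time_foldlM _ (fun _ => 1) (fun _ _ => rfl),
      Timed.time_foldlM _ (fun _ => 1) (fun _ _ => rfl),
      Timed.time_foldlM _ (fun k => 1 + _) (fun _ _ => rfl),
      Timed.time_foldlM _ (fun _ => 1) (fun _ _ => rfl)]
    simp only [foldl_update_bucket (fun t : Fin n × Fin n × ℕ => t.2.2)]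
    simp only [List.nil_append]
    rw [List.sum_map_add]
    simp only [List.map_const', List.sum_replicate, List.length_map, List.length_range,
      Finset.length_toList, smul_eq_mul, mul_one, sortedTuples, List.length_flatMap]
    rw [show (edges G).card = numEdges G from rfl]
    ring
  · simp only [sortAdjacency, Timed.val_foldlM, Timed.val_bind, Timed.val_pure,
      foldl_append_singleton, foldl_append]
    rw [foldl_update_append (fun t : Fin n × Fin n × ℕ => t.1) (fun t => t.2.1)]
    simp only [foldl_update_bucket (fun t : Fin n × Fin n × ℕ => t.2.2)]
    simp only [List.nil_append, sortedTuples]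

theorem nodup_sortedTuples {T : List (Fin n × Fin n × ℕ)} (hT : T.Nodup) :
    (sortedTuples T).Nodup := by
  rw [sortedTuples, List.nodup_flatMap]
  refine ⟨fun k _ => hT.filter _, List.nodup_range.imp fun {a b} hab => ?_⟩
  rw [Function.onFun, List.disjoint_left]
  intro t ha hb
  simp only [List.mem_filter, decide_eq_true_eq] at ha hb
  exact hab (ha.2.symm.trans hb.2)

theorem subset_of_sortedTuples (T : List (Fin n × Fin n × ℕ)) : sortedTuples T ⊆ T := by
  intro t ht
  simp only [sortedTuples, List.mem_flatMap, List.mem_filter] at ht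
  obtain ⟨k, _, h, _⟩ := ht
  exact h

theorem nodup_tuples (G : Digraph (Fin n)) (d : Fin n → ℕ) :
    ((edges G).toList.map fun e => (e.1, e.2, d e.2)).Nodup := by
  refine (Finset.nodup_toList _).map fun e e' h => ?_
  simp only [Prod.mk.injEq] at h
  exact Prod.ext h.1 h.2.1

/-- Upper bounds on costs need only that the lists contain true out-neighbours, each once. No
repetition arises because a tuple is determined by its first two entries. -/
theorem isAdjacency_sortAdjacency (G : Digraph (Fin n)) :
    IsAdjacency G (sortAdjacency G).val := by
  obtain ⟨d, h, -⟩ := sortAdjacency_spec G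
  set T := (edges G).toList.map fun e => (e.1, e.2, d e.2) with hT
  have hmem : ∀ t ∈ sortedTuples T, G.Adj t.1 t.2.1 ∧ t.2.2 = d t.2.1 := by
    intro t ht
    have := subset_of_sortedTuples T ht
    rw [hT, List.mem_map] at this
    obtain ⟨e, he, rfl⟩ := this
    exact ⟨by simpa [edges] using he, rfl⟩
  intro x
  rw [h]
  constructor
  · refine ((nodup_sortedTuples (nodup_tuples G d)).filter _).map_on fun t ht t' ht' htt => ?_
    simp only [List.mem_filter, decide_eq_true_eq] at ht ht'
    refine Prod.ext (ht.2.trans ht'.2.symm) (Prod.ext htt ?_)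
    rw [(hmem t ht.1).2, (hmem t' ht'.1).2, htt]
  · intro z hz
    simp only [List.mem_map, List.mem_filter, decide_eq_true_eq] at hz
    obtain ⟨t, ⟨ht, rfl⟩, rfl⟩ := hz
    exact (hmem t ht).1

theorem time_sortAdjacency_le (G : Digraph (Fin n)) :
    (sortAdjacency G).time ≤ 4 * n + 2 + 5 * numEdges G := by
  obtain ⟨d, -, h⟩ := sortAdjacency_spec G
  rw [h]
  -- A duplicate-free list contained in the list of tuples is no longer than it. That no key exceeds
  -- the last bucket n is therefore irrelevant.
  have := ((nodup_sortedTuples (nodup_tuples G d)).subperm (subset_of_sortedTuples _)).length_le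
  rw [List.length_map, Finset.length_toList] at this
  change _ ≤ numEdges G at this
  omega

/-! ### The backward search -/

section search
variable {G : Digraph (Fin n)} (c : Set.Ioo (0 : ℝ) 1) {ε : ℝ} {adj : Fin n → List (Fin n)}

open Classical in
theorem val_pushLevel (r : Fin n →₀ ℝ) :
    (pushLevel G c ε adj r).val = r.support.toList.foldl
      (fun (st : (Fin n →₀ ℝ) × (Fin n →₀ ℝ)) v =>
        if rMax c ε < r v then
          ((adj v).foldl (fun next z => next + Finsupp.single z (sq c * (r v / dIn G z))) st.1,
            st.2 + Finsupp.single v ((1 - sq c) * r v))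
        else st) (0, 0) := by
  rw [pushLevel, Timed.val_foldlM]
  congr 1
  funext st v
  simp only [Timed.val_bind]
  split_ifs
  · simp only [Timed.val_bind, Timed.val_foldlM, Timed.val_pure]
  · rfl

open Classical in
theorem time_pushLevel (r : Fin n →₀ ℝ) :
    ((pushLevel G c ε adj r).time : ℝ≥0∞) = r.support.card +
      ∑ v ∈ r.support, if rMax c ε < r v then ((adj v).length : ℝ≥0∞) + 1 else 0 := by
  rw [pushLevel, Timed.time_foldlM _
    (fun v => 1 + if rMax c ε < r v then (adj v).length + 1 else 0)]
  · rw [Nat.cast_list_sum, List.map_map, sum_toList_eq_sum]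
    simp [Finset.sum_add_distrib]
  · intro s v
    simp only [Timed.time_bind, Timed.time_charge]
    split_ifs
    · simp only [Timed.time_bind, Timed.time_charge, Timed.time_pure]
      rw [Timed.time_foldlM _ (fun _ => 1) (fun _ _ => rfl)]
      simp
    · simp [Timed.time_pure]

open Classical in
-- Pushing r(v) moves at most r(v) (bwd β)(v) of weighted mass to the next level; nodes below the
-- threshold contribute nothing.
theorem mass_pushLevel_fst_le (hadj : IsAdjacency G adj) (β : Fin n → ℝ≥0∞) (r : Fin n →₀ ℝ) :
    mass β (pushLevel G c ε adj r).val.1 ≤ mass (bwd G c β) r := by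
  rw [val_pushLevel]
  refine (foldl_potential_le _ (fun st : (Fin n →₀ ℝ) × (Fin n →₀ ℝ) => mass β st.1)
    (fun v => ENNReal.ofReal (r v) * bwd G c β v) (fun st v => ?_) _ _).trans ?_
  · split_ifs
    · refine (foldl_potential_le _ (mass β) (fun z => ENNReal.ofReal (sq c * (r v / dIn G z)) * β z)
        (fun f z => ?_) _ _).trans (add_le_add_right ?_ _)
      · exact (mass_add_le _ _ _).trans_eq (by rw [mass_single])
      · refine (hadj.sum_le v _).trans ?_
        rw [bwd, Finset.mul_sum]
        refine Finset.sum_le_sum fun z _ => ?_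
        rw [← mul_assoc, ← ENNReal.ofReal_mul' (div_nonneg (sq_pos c).le (Nat.cast_nonneg _))]
        refine mul_le_mul_left (le_of_eq ?_) _
        congr 1
        ring
    · exact le_self_add
  · rw [sum_toList_eq_sum, ← mass_eq_sum]
    simp [mass_zero]

open Classical in
theorem card_pushLevel_fst_le (r : Fin n →₀ ℝ) :
    ((pushLevel G c ε adj r).val.1.support.card : ℝ≥0∞) ≤
      ∑ v ∈ r.support, if rMax c ε < r v then ((adj v).length : ℝ≥0∞) else 0 := by
  rw [val_pushLevel]
  refine (foldl_potential_le _ (fun st : (Fin n →₀ ℝ) × (Fin n →₀ ℝ) =>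
    (st.1.support.card : ℝ≥0∞))
    (fun v => if rMax c ε < r v then ((adj v).length : ℝ≥0∞) else 0) (fun st v => ?_) _ _).trans ?_
  · split_ifs
    · refine (foldl_potential_le _ (fun f : Fin n →₀ ℝ => (f.support.card : ℝ≥0∞)) (fun z => 1)
        (fun f z => card_support_add_single_le _ _ _) _ _).trans (add_le_add_right ?_ _)
      simp
    · exact le_self_add
  · rw [sum_toList_eq_sum]
    simp

open Classical in
theorem mass_pushLevel_snd_le (β : Fin n → ℝ≥0∞) (r : Fin n →₀ ℝ) :
    mass β (pushLevel G c ε adj r).val.2 ≤ stopProb c * mass β r := by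
  rw [val_pushLevel]
  refine (foldl_potential_le _ (fun st : (Fin n →₀ ℝ) × (Fin n →₀ ℝ) => mass β st.2)
    (fun v => stopProb c * (ENNReal.ofReal (r v) * β v)) (fun st v => ?_) _ _).trans ?_
  · split_ifs
    · refine (mass_add_le _ _ _).trans_eq ?_
      rw [mass_single, ENNReal.ofReal_mul (one_sub_sq_pos c).le, mul_assoc]
      rfl
    · exact le_self_add
  · rw [sum_toList_eq_sum, ← Finset.mul_sum, ← mass_eq_sum]
    simp [mass_zero]

open Classical in
theorem card_pushLevel_snd_le (r : Fin n →₀ ℝ) :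
    ((pushLevel G c ε adj r).val.2.support.card : ℝ≥0∞) ≤
      ∑ v ∈ r.support, if rMax c ε < r v then 1 else 0 := by
  rw [val_pushLevel]
  refine (foldl_potential_le _ (fun st : (Fin n →₀ ℝ) × (Fin n →₀ ℝ) =>
    (st.2.support.card : ℝ≥0∞))
    (fun v => if rMax c ε < r v then 1 else 0) (fun st v => ?_) _ _).trans ?_
  · split_ifs
    · exact card_support_add_single_le _ _ _
    · exact le_self_add
  · rw [sum_toList_eq_sum]
    simp

theorem rMax_pos (hε : 0 < ε) : 0 < rMax c ε := by
  have := one_sub_sq_pos c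
  unfold rMax c₁
  positivity

/-- `c₁ / ε`, the inverse of the residue threshold. -/
def invThreshold (c : Set.Ioo (0 : ℝ) 1) (ε : ℝ) : ℝ≥0∞ := ENNReal.ofReal (c₁ c / ε)

theorem one_le_of_rMax_lt (hε : 0 < ε) {x : ℝ} (hx : rMax c ε < x) :
    1 ≤ invThreshold c ε * ENNReal.ofReal x := by
  have h := rMax_pos c hε
  have h1 : (rMax c ε)⁻¹ = c₁ c / ε := by rw [rMax, inv_div]
  rw [invThreshold, ← h1, ← ENNReal.ofReal_mul (inv_nonneg.2 h.le), ENNReal.one_le_ofReal,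
    inv_mul_eq_div, le_div_iff₀ h]
  linarith

open Classical in
-- Markov's inequality: a node whose residue exceeds ε/c₁ is worth at least one unit at the rate
-- c₁/ε.
theorem sum_above_le (hε : 0 < ε) (β : Fin n → ℝ≥0∞) (r : Fin n →₀ ℝ) :
    (∑ v ∈ r.support, if rMax c ε < r v then β v else 0) ≤ invThreshold c ε * mass β r := by
  rw [mass_eq_sum, Finset.mul_sum]
  refine Finset.sum_le_sum fun v _ => ?_
  split_ifs with h
  · rw [← mul_assoc]
    exact le_mul_of_one_le_left' (one_le_of_rMax_lt c hε h)
  · exact zero_le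

theorem mass_residue_le (hadj : IsAdjacency G adj) (w : Fin n) (ℓ : ℕ) (β : Fin n → ℝ≥0∞) :
    mass β (residue G c ε adj w ℓ) ≤ (bwd G c)^[ℓ] β w := by
  induction ℓ generalizing β with
  | zero => simp [residue, mass_single]
  | succ ℓ ih => exact (mass_pushLevel_fst_le c hadj β _).trans (ih _)

open Classical in
theorem length_collect_le (ψ : Fin n →₀ ℝ) :
    ((collect c ε ψ).val.length : ℝ≥0∞) ≤ ∑ v ∈ ψ.support, if rMax c ε < ψ v then 1 else 0 := by
  rw [collect, Timed.val_foldlM]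
  refine (foldl_potential_le _ (fun L : List (Fin n × ℝ) => (L.length : ℝ≥0∞))
    (fun v => if rMax c ε < ψ v then 1 else 0) (fun L v => ?_) _ _).trans ?_
  · simp only [Timed.val_bind]
    split_ifs
    · simp [Timed.val_pure]
    · simp [Timed.val_pure]
  · rw [sum_toList_eq_sum]
    simp

theorem time_collect (ψ : Fin n →₀ ℝ) : (collect c ε ψ).time = ψ.support.card := by
  rw [collect, Timed.time_foldlM _ (fun _ => 1)]
  · simp
  · intro L v
    simp only [Timed.time_bind, Timed.time_charge]
    split_ifs <;> rfl

/-- Stored reserves exceed ε/c₁, while all reserves of the level sum to at most 1 - √c times the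
residue mass. -/
theorem length_searchLevel_le (hε : 0 < ε) (hadj : IsAdjacency G adj) (w : Fin n) (ℓ : ℕ) :
    ((searchLevel G c ε adj w ℓ).val.length : ℝ≥0∞) ≤
      invThreshold c ε * (stopProb c * (bwd G c)^[ℓ] 1 w) := by
  refine (length_collect_le c _).trans ((sum_above_le c hε 1 _).trans ?_)
  gcongr
  refine (mass_pushLevel_snd_le c _ _).trans ?_
  gcongr
  exact mass_residue_le c hadj w ℓ 1

theorem tsum_length_searchLevel_le (hε : 0 < ε) (hadj : IsAdjacency G adj) (w : Fin n) :
    ∑' ℓ, ((searchLevel G c ε adj w ℓ).val.length : ℝ≥0∞) ≤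
      invThreshold c ε * totalMass G c w := by
  rw [← tsum_stopProb_mul_bwd, ← ENNReal.tsum_mul_left]
  exact ENNReal.tsum_le_tsum fun ℓ => length_searchLevel_le c hε hadj w ℓ

/-- A pushed node costs its out-degree, one step for its reserve and one in `collect`. Scanning the
residues of level ℓ + 1 is charged to the pushes of level ℓ that created them, whence the factor 2;
the leading 1 is the residue of level 0. -/
theorem tsum_time_searchLevel_le (hε : 0 < ε) (hadj : IsAdjacency G adj) (w : Fin n) :
    ∑' ℓ, ((searchLevel G c ε adj w ℓ).time : ℝ≥0∞) ≤
      1 + 2 * ∑' ℓ, invThreshold c ε *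
        (bwd G c)^[ℓ] (fun v => ((outNbrs G v).card : ℝ≥0∞) + 2) w := by
  classical
  set r := fun ℓ => residue G c ε adj w ℓ with hr
  set X : ℕ → ℝ≥0∞ := fun ℓ => ∑ v ∈ (r ℓ).support,
    if rMax c ε < r ℓ v then ((adj v).length : ℝ≥0∞) + 2 else 0 with hX
  have hlen : ∀ v, ((adj v).length : ℝ≥0∞) ≤ (outNbrs G v).card := by
    intro v
    have := hadj.sum_le v fun _ => 1
    simpa using this
  have hX' : ∀ ℓ, X ℓ ≤ invThreshold c ε *
      (bwd G c)^[ℓ] (fun v => ((outNbrs G v).card : ℝ≥0∞) + 2) w := by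
    intro ℓ
    refine (sum_above_le c hε _ _).trans ?_
    gcongr
    refine (mass_mono (fun v => add_le_add_left (hlen v) 2) _).trans ?_
    exact mass_residue_le c hadj w ℓ _
  have htime : ∀ ℓ, ((searchLevel G c ε adj w ℓ).time : ℝ≥0∞) ≤ (r ℓ).support.card + X ℓ := by
    intro ℓ
    rw [searchLevel, Timed.time_bind, Nat.cast_add, time_pushLevel, time_collect, add_assoc]
    refine add_le_add_right ((add_le_add_right (card_pushLevel_snd_le c _) _).trans ?_) _
    rw [← Finset.sum_add_distrib]
    refine Finset.sum_le_sum fun v _ => ?_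
    simp only [hr]
    split_ifs
    · rw [add_assoc, one_add_one_eq_two]
    · simp
  have hcard : ∀ ℓ, ((r (ℓ + 1)).support.card : ℝ≥0∞) ≤ X ℓ := by
    intro ℓ
    refine (card_pushLevel_fst_le c _).trans (Finset.sum_le_sum fun v _ => ?_)
    simp only [hr]
    split_ifs
    · exact le_self_add
    · exact le_rfl
  have h0 : ((r 0).support.card : ℝ≥0∞) ≤ 1 := by
    have h : (Finsupp.single w (1 : ℝ)).support.card ≤ 1 :=
      (Finset.card_le_card Finsupp.support_single_subset).trans (Finset.card_singleton w).le
    exact_mod_cast h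
  calc _ ≤ ∑' ℓ, (((r ℓ).support.card : ℝ≥0∞) + X ℓ) := ENNReal.tsum_le_tsum htime
    _ = ((r 0).support.card + ∑' ℓ, ((r (ℓ + 1)).support.card : ℝ≥0∞)) + ∑' ℓ, X ℓ := by
        rw [ENNReal.tsum_add, tsum_eq_zero_add' ENNReal.summable]
    _ ≤ (1 + ∑' ℓ, X ℓ) + ∑' ℓ, X ℓ := by
        gcongr with ℓ
        exact hcard ℓ
    _ = 1 + 2 * ∑' ℓ, X ℓ := by ring
    _ ≤ _ := by
        gcongr with ℓ
        exact hX' ℓ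

end search

/-! ### Preprocessing time and index size -/

/-- By duality the left side counts, with weight β(u) / (1 - √c), the walks from each u according to
their end; each walk terminates somewhere with total probability 1. -/
theorem sum_tsum_bwd_iterate {G : Digraph (Fin n)} (hG : ∀ v, (inNbrs G v).Nonempty)
    (c : Set.Ioo (0 : ℝ) 1) (β : Fin n → ℝ≥0∞) :
    ∑ w, ∑' ℓ, (bwd G c)^[ℓ] β w = (stopProb c)⁻¹ * ∑ u, β u := by
  have h : ∀ w ℓ, (bwd G c)^[ℓ] β w = (stopProb c)⁻¹ * ∑ u, termProb G c ℓ u w * β u := by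
    intro w ℓ
    rw [← stopProb_mul_bwd_iterate, ← mul_assoc, mul_comm (stopProb c)⁻¹, stopProb_mul_inv,
      one_mul]
  simp only [h, ENNReal.tsum_mul_left, ← Finset.mul_sum]
  congr 1
  rw [← Summable.tsum_finsetSum fun _ _ => ENNReal.summable]
  simp only [Finset.sum_comm (s := Finset.univ) (t := Finset.univ) (f := fun w u =>
    termProb G c _ u w * β u), ← Finset.sum_mul]
  rw [Summable.tsum_finsetSum fun _ _ => ENNReal.summable]
  refine Finset.sum_congr rfl fun u _ => ?_
  rw [ENNReal.tsum_mul_right, tsum_sum_termProb hG, one_mul]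

/-- Searching from every node is already affordable, so the sum over the hub nodes is enlarged to
all nodes and no power law is needed. Constants and multiples of n are absorbed by 2 ≤ n ≤ m. -/
theorem preprocessingTime_le {G : Digraph (Fin n)} (hG : ∀ v, (inNbrs G v).Nonempty)
    (hn : 2 ≤ n) (c : Set.Ioo (0 : ℝ) 1) {ε : ℝ} (hε : 0 < ε) (hubs : Finset (Fin n)) (tPR : ℕ) :
    preprocessingTime G c ε hubs tPR ≤ tPR +
      (13 + 6 * (invThreshold c ε * (stopProb c)⁻¹)) * numEdges G := by
  have hadj := isAdjacency_sortAdjacency G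
  have hnm : (n : ℝ≥0∞) ≤ numEdges G := by exact_mod_cast le_numEdges hG
  have hsort : ((sortAdjacency G).time : ℝ≥0∞) ≤ 10 * numEdges G := by
    have := time_sortAdjacency_le G
    have h1 := le_numEdges hG
    have h2 : (sortAdjacency G).time ≤ 10 * numEdges G := by omega
    exact_mod_cast h2
  have hsearch : ∑ w ∈ hubs, (1 + ∑' ℓ : ℕ,
      ((searchLevel G c ε (sortAdjacency G).val w ℓ).time : ℝ≥0∞)) ≤
      2 * numEdges G + 6 * (invThreshold c ε * (stopProb c)⁻¹) * numEdges G := by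
    calc _ ≤ ∑ w ∈ hubs, (2 + 2 * ∑' ℓ, invThreshold c ε *
          (bwd G c)^[ℓ] (fun v => ((outNbrs G v).card : ℝ≥0∞) + 2) w) := by
          refine Finset.sum_le_sum fun w _ => ?_
          refine (add_le_add_right (tsum_time_searchLevel_le c hε hadj w) 1).trans_eq ?_
          rw [← add_assoc, one_add_one_eq_two]
      _ ≤ ∑ w, (2 + 2 * ∑' ℓ, invThreshold c ε *
          (bwd G c)^[ℓ] (fun v => ((outNbrs G v).card : ℝ≥0∞) + 2) w) :=
          Finset.sum_le_sum_of_subset (Finset.subset_univ _)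
      _ = 2 * n + 2 * (invThreshold c ε * ((stopProb c)⁻¹ * (numEdges G + 2 * n))) := by
          simp only [ENNReal.tsum_mul_left]
          rw [Finset.sum_add_distrib, ← Finset.mul_sum, ← Finset.mul_sum,
            sum_tsum_bwd_iterate hG, Finset.sum_add_distrib, ← Nat.cast_sum, sum_card_outNbrs]
          simp [mul_comm]
      _ ≤ 2 * numEdges G +
          2 * (invThreshold c ε * ((stopProb c)⁻¹ * (numEdges G + 2 * numEdges G))) := by gcongr
      _ = _ := by ring
  calc preprocessingTime G c ε hubs tPR
      ≤ 10 * numEdges G + tPR + numEdges G +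
        (2 * numEdges G + 6 * (invThreshold c ε * (stopProb c)⁻¹) * numEdges G) := by
        unfold preprocessingTime
        gcongr
    _ = _ := by ring

theorem size_buildIndex_le (G : Digraph (Fin n)) (c : Set.Ioo (0 : ℝ) 1) {ε : ℝ} (hε : 0 < ε)
    (hubs : Finset (Fin n)) :
    (buildIndex G c ε hubs).size ≤ invThreshold c ε * ∑ w ∈ hubs, totalMass G c w := by
  rw [Finset.mul_sum]
  exact Finset.sum_le_sum fun w _ =>
    tsum_length_searchLevel_le c hε (isAdjacency_sortAdjacency G) w

/-! ### Medians -/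

open Classical in
-- Double counting of the non-zero entries, by node and by round.
theorem sum_length_filter_ne_zero (ss : List (Fin n →₀ ℝ)) :
    ∑ v, ((ss.filter fun s => decide (s v ≠ 0)).length : ℝ≥0∞) =
      (ss.map fun s => (s.support.card : ℝ≥0∞)).sum := by
  induction ss with
  | nil => simp
  | cons a ss ih =>
    rw [List.map_cons, List.sum_cons, ← ih]
    have h : ∀ v, (((a :: ss).filter fun s => decide (s v ≠ 0)).length : ℝ≥0∞) =
        (if a v ≠ 0 then 1 else 0) + ((ss.filter fun s => decide (s v ≠ 0)).length : ℝ≥0∞) := by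
      intro v
      by_cases hv : a v = 0
      · simp [hv]
      · simp [hv, add_comm]
    simp only [h, Finset.sum_add_distrib]
    congr 1
    rw [Finset.sum_boole]
    congr 2
    ext v
    simp

/-- Each non-zero entry costs 1 for gathering. A node with k ≥ 1 such entries costs 1 + k for the
selection and 1 for the key of the result, at most 3k together. -/
theorem wp_medians_le (ss : List (Fin n →₀ ℝ)) :
    (medians ss).wp (fun sB => (sB.support.card : ℝ≥0∞)) ≤
      4 * (ss.map fun s => (s.support.card : ℝ≥0∞)).sum := by
  classical
  rw [medians, RandTimed.wp_bind, RandTimed.wp_charge]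
  set S := (ss.map fun s => (s.support.card : ℝ≥0∞)).sum with hS
  have hcast : (((ss.map fun s => s.support.card).sum : ℕ) : ℝ≥0∞) = S := by
    rw [Nat.cast_list_sum, List.map_map]
    rfl
  rw [hcast]
  have h : ∀ sB : Fin n →₀ ℝ, RandTimed.wp
      ((Finset.univ.filter fun v => ∃ s ∈ ss, s v ≠ 0).toList.foldlM
        (fun (sB : Fin n →₀ ℝ) v => do
          RandTimed.charge (1 + (ss.filter fun s => decide (s v ≠ 0)).length)
          pure (sB + Finsupp.single v (median (ss.map fun s => s v)))) sB)
      (fun sB : Fin n →₀ ℝ => (sB.support.card : ℝ≥0∞)) ≤ sB.support.card + 3 * S := by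
    intro sB
    refine (RandTimed.wp_foldlM_le _ (fun sB : Fin n →₀ ℝ => (sB.support.card : ℝ≥0∞))
      (fun v => 3 * ((ss.filter fun s => decide (s v ≠ 0)).length : ℝ≥0∞)) _ ?_ _).trans ?_
    · intro sB v hv
      rw [RandTimed.wp_bind, RandTimed.wp_charge, RandTimed.wp_pure]
      simp only [Finset.mem_toList, Finset.mem_filter, Finset.mem_univ, true_and] at hv
      obtain ⟨s, hs, hv⟩ := hv
      have h1 : 1 ≤ (ss.filter fun s => decide (s v ≠ 0)).length :=
        List.length_pos_of_mem (List.mem_filter.2 ⟨hs, by simpa using hv⟩)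
      set k := (ss.filter fun s => decide (s v ≠ 0)).length
      have h2 : 1 + (1 + k) ≤ 3 * k := by omega
      calc _ ≤ (sB.support.card : ℝ≥0∞) + 1 + ((1 + k : ℕ) : ℝ≥0∞) :=
            add_le_add_left (card_support_add_single_le _ _ _) _
        _ = (sB.support.card : ℝ≥0∞) + ((1 + (1 + k) : ℕ) : ℝ≥0∞) := by push_cast; ring
        _ ≤ (sB.support.card : ℝ≥0∞) + ((3 * k : ℕ) : ℝ≥0∞) := by gcongr
        _ = _ := by push_cast; ring
    · refine add_le_add_right ?_ _
      rw [sum_toList_eq_sum, ← Finset.mul_sum]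
      refine mul_le_mul_right ?_ _
      rw [hS, ← sum_length_filter_ne_zero]
      exact Finset.sum_le_sum_of_subset (Finset.subset_univ _)
  refine (add_le_add_left (h 0) _).trans (le_of_eq ?_)
  simp only [Finsupp.support_zero, Finset.card_empty, Nat.cast_zero, zero_add]
  ring

/-! ### Retrieving the lists of the index -/

open Classical in
theorem wp_retrieve_le (c : Set.Ioo (0 : ℝ) 1) (ε : ℝ) (I : Index n) (η : (Fin n × ℕ) →₀ ℝ) :
    (retrieve c ε I η).wp (fun sI => (sI.support.card : ℝ≥0∞)) ≤ η.support.card +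
      2 * ∑ k ∈ η.support, if rMax c ε < η k then ((I.lists k.1 k.2).length : ℝ≥0∞) else 0 := by
  refine (RandTimed.wp_foldlM_le _ (fun sI : Fin n →₀ ℝ => (sI.support.card : ℝ≥0∞))
    (fun k => 1 + 2 * if rMax c ε < η k then ((I.lists k.1 k.2).length : ℝ≥0∞) else 0)
    _ ?_ _).trans ?_
  · intro sI k _
    rw [RandTimed.wp_bind, RandTimed.wp_charge, Nat.cast_one, add_comm (1 : ℝ≥0∞), ← add_assoc]
    refine add_le_add_left ?_ _
    by_cases h : ε / c₁ c < η k ∧ k.1 ∈ I.hubs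
    · rw [if_pos h, if_pos (show rMax c ε < η k from h.1)]
      refine (RandTimed.wp_foldlM_le _ (fun sI : Fin n →₀ ℝ => (sI.support.card : ℝ≥0∞))
        (fun _ => 2) _ ?_ _).trans ?_
      · intro s t _
        rw [RandTimed.wp_bind, RandTimed.wp_charge, RandTimed.wp_pure]
        refine (add_le_add_left (card_support_add_single_le _ _ _) _).trans (le_of_eq ?_)
        rw [Nat.cast_one, add_assoc, one_add_one_eq_two]
      · rw [sum_map_const, mul_comm]
    · rw [if_neg h, RandTimed.wp_pure]
      exact le_self_add
  · rw [sum_toList_eq_sum, Finset.sum_add_distrib, ← Finset.mul_sum]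
    simp

/-- The contribution of the walks with `ℓ` moves to `n π(w)`. -/
def levelMass (G : Digraph (Fin n)) (c : Set.Ioo (0 : ℝ) 1) (w : Fin n) (ℓ : ℕ) : ℝ≥0∞ :=
  stopProb c * (bwd G c)^[ℓ] 1 w

theorem tsum_levelMass (G : Digraph (Fin n)) (c : Set.Ioo (0 : ℝ) 1) (w : Fin n) :
    ∑' ℓ, levelMass G c w ℓ = totalMass G c w := tsum_stopProb_mul_bwd G c w

theorem levelMass_le (G : Digraph (Fin n)) (c : Set.Ioo (0 : ℝ) 1) (w : Fin n) (ℓ : ℕ) :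
    levelMass G c w ℓ ≤ totalMass G c w := by
  rw [← tsum_levelMass]
  exact ENNReal.le_tsum ℓ

theorem sum_termProb (G : Digraph (Fin n)) (c : Set.Ioo (0 : ℝ) 1) (w : Fin n) (ℓ : ℕ) :
    ∑ u, termProb G c ℓ u w = levelMass G c w ℓ := by
  rw [levelMass, stopProb_mul_bwd_iterate]
  simp

open Classical in
/-- The weight of the key `(w, ℓ)` in the potential for the retrieval of the lists. -/
def keyWeight (G : Digraph (Fin n)) (c : Set.Ioo (0 : ℝ) 1) (ε : ℝ) (T : Finset (Fin n))
    (k : Fin n × ℕ) : ℝ≥0∞ :=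
  2 * invThreshold c ε ^ 2 * if k.1 ∈ T then 0 else levelMass G c k.1 k.2

/-- A key (w, ℓ) is visited once and its list has at most (c₁/ε) `levelMass` entries. For w in `T`
this is paid in full. For other w the threshold gives 1 ≤ (c₁/ε) η̂π, and the resulting bound is
linear in η̂π, hence a potential that grows additively with the samples. The factor 2 covers the
step and the new key per tuple. -/
theorem wp_retrieve_buildIndex_le (G : Digraph (Fin n)) (c : Set.Ioo (0 : ℝ) 1) {ε : ℝ}
    (hε : 0 < ε) (hubs T : Finset (Fin n)) (η : (Fin n × ℕ) →₀ ℝ) :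
    (retrieve c ε (buildIndex G c ε hubs) η).wp (fun sI => (sI.support.card : ℝ≥0∞)) ≤
      η.support.card + mass (keyWeight G c ε T) η +
        2 * (invThreshold c ε * ∑ w ∈ T, totalMass G c w) := by
  classical
  refine (wp_retrieve_le c ε _ η).trans ?_
  rw [add_assoc]
  refine add_le_add_right ?_ _
  have hterm : ∀ k ∈ η.support, (if rMax c ε < η k then
      (((buildIndex G c ε hubs).lists k.1 k.2).length : ℝ≥0∞) else 0) ≤
      (if k.1 ∈ T then invThreshold c ε * levelMass G c k.1 k.2 else 0) +
        ENNReal.ofReal (η k) *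
          (invThreshold c ε ^ 2 * if k.1 ∈ T then 0 else levelMass G c k.1 k.2) := by
    intro k _
    have hlen : (((buildIndex G c ε hubs).lists k.1 k.2).length : ℝ≥0∞) ≤
        invThreshold c ε * levelMass G c k.1 k.2 :=
      length_searchLevel_le c hε (isAdjacency_sortAdjacency G) k.1 k.2
    split_ifs with h hT
    · exact hlen.trans le_self_add
    · rw [zero_add]
      refine hlen.trans ?_
      calc _ ≤ (invThreshold c ε * ENNReal.ofReal (η k)) *
            (invThreshold c ε * levelMass G c k.1 k.2) :=
            le_mul_of_one_le_left' (one_le_of_rMax_lt c hε h)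
        _ = _ := by ring
    all_goals exact zero_le
  have hT : ∑ k ∈ η.support, (if k.1 ∈ T then invThreshold c ε * levelMass G c k.1 k.2 else 0) ≤
      invThreshold c ε * ∑ w ∈ T, totalMass G c w := by
    refine (ENNReal.sum_le_tsum _).trans (le_of_eq ?_)
    rw [ENNReal.tsum_prod', tsum_fintype, Finset.mul_sum,
      ← Finset.sum_filter_add_sum_filter_not Finset.univ (· ∈ T)]
    rw [Finset.sum_eq_zero (s := Finset.univ.filter (· ∉ T)), add_zero]
    · rw [Finset.filter_mem_eq_inter, Finset.univ_inter]
      refine Finset.sum_congr rfl fun w hw => ?_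
      simp only [hw, if_true]
      rw [ENNReal.tsum_mul_left, tsum_levelMass]
    · intro w hw
      simp [(Finset.mem_filter.1 hw).2]
  calc _ ≤ 2 * (invThreshold c ε * ∑ w ∈ T, totalMass G c w +
        ∑ k ∈ η.support, ENNReal.ofReal (η k) *
          (invThreshold c ε ^ 2 * if k.1 ∈ T then 0 else levelMass G c k.1 k.2)) := by
        refine mul_le_mul_right ((Finset.sum_le_sum hterm).trans ?_) _
        rw [Finset.sum_add_distrib]
        exact add_le_add_left hT _
    _ = _ := by
        rw [mul_add, add_comm, mass_eq_sum, Finset.mul_sum]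
        congr 1
        refine Finset.sum_congr rfl fun k _ => ?_
        rw [keyWeight]
        ring

/-! ### One sample -/

/-- The potential of the state of a round. -/
def samplePotential (B : Fin n × ℕ → ℝ≥0∞) (st : ((Fin n × ℕ) →₀ ℝ) × (Fin n →₀ ℝ)) : ℝ≥0∞ :=
  4 * (st.2.support.card : ℝ≥0∞) + (st.1.support.card + mass B st.1)

open Classical in
/-- The part of the expected cost of a sample that depends on the node `w` where the walk
terminates. -/
def endCost (G : Digraph (Fin n)) (c : Set.Ioo (0 : ℝ) 1) (hubs : Finset (Fin n)) (κ : ℝ≥0∞)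
    (B : Fin n × ℕ → ℝ≥0∞) (w : Fin n) (ℓ : ℕ) : ℝ≥0∞ :=
  κ * B (w, ℓ) + 6 * (stopProb c)⁻¹ * if w ∈ hubs then 0 else totalMass G c w

open Classical in
/-- The part of a sample that follows if the two walks from `w` do not meet. -/
def processSample (G : Digraph (Fin n)) (c : Set.Ioo (0 : ℝ) 1) (ε δ : ℝ) (I : Index n)
    (st : ((Fin n × ℕ) →₀ ℝ) × (Fin n →₀ ℝ)) (w : Fin n) (ℓ : ℕ) :
    RandTimed (((Fin n × ℕ) →₀ ℝ) × (Fin n →₀ ℝ)) := do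
  RandTimed.charge 1
  let ηπ := st.1 + Finsupp.single (w, ℓ) (1 / ((dR c ε : ℝ) * fR n δ))
  if w ∈ I.hubs then pure (ηπ, st.2)
  else do
    let h ← backwardWalk G c I.adj w ℓ
    let s ← h.support.toList.foldlM (fun (s : Fin n →₀ ℝ) v => do
      RandTimed.charge 1
      pure (s + Finsupp.single v (h v / ((1 - sq c) ^ 2 * dR c ε)))) st.2
    pure (ηπ, s)

/-- The increment of an entry of `η̂π` by one sample. -/
def sampleWeight (c : Set.Ioo (0 : ℝ) 1) (ε : ℝ) (n : ℕ) (δ : ℝ) : ℝ≥0∞ :=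
  ENNReal.ofReal (1 / ((dR c ε : ℝ) * fR n δ))

theorem samplePotential_add_single_le (c : Set.Ioo (0 : ℝ) 1) (ε δ : ℝ) (B : Fin n × ℕ → ℝ≥0∞)
    (η : (Fin n × ℕ) →₀ ℝ) (w : Fin n) (ℓ : ℕ) (s : Fin n →₀ ℝ) :
    samplePotential B (η + Finsupp.single (w, ℓ) (1 / ((dR c ε : ℝ) * fR n δ)), s) ≤
      4 * (s.support.card : ℝ≥0∞) +
        (η.support.card + mass B η + (1 + sampleWeight c ε n δ * B (w, ℓ))) := by
  have h1 := card_support_add_single_le η (w, ℓ) (1 / ((dR c ε : ℝ) * fR n δ))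
  have h2 := mass_add_le B η (Finsupp.single (w, ℓ) (1 / ((dR c ε : ℝ) * fR n δ)))
  rw [mass_single] at h2
  refine add_le_add_right ((add_le_add h1 h2).trans (le_of_eq ?_)) _
  rw [sampleWeight]
  ring

/-- The 7 is one step, one possibly new key of η̂π, and the 5 from the starting key of the backward
walk. -/
theorem wp_processSample_le {G : Digraph (Fin n)} (c : Set.Ioo (0 : ℝ) 1) (ε δ : ℝ) {I : Index n}
    (hadj : IsAdjacency G I.adj) (B : Fin n × ℕ → ℝ≥0∞)
    (st : ((Fin n × ℕ) →₀ ℝ) × (Fin n →₀ ℝ)) (w : Fin n) (ℓ : ℕ) :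
    (processSample G c ε δ I st w ℓ).wp (samplePotential B) ≤
      samplePotential B st + (7 + ℓ + endCost G c I.hubs (sampleWeight c ε n δ) B w ℓ) := by
  classical
  rw [processSample, RandTimed.wp_bind, RandTimed.wp_charge, Nat.cast_one]
  set κ := sampleWeight c ε n δ with hκ
  by_cases hw : w ∈ I.hubs
  · simp only [hw, if_true, RandTimed.wp_pure, endCost, mul_zero, add_zero]
    calc _ ≤ _ := add_le_add_left (samplePotential_add_single_le c ε δ B st.1 w ℓ st.2) 1
      _ = samplePotential B st + (2 + κ * B (w, ℓ)) := by
          rw [samplePotential]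
          ring
      _ ≤ _ := by
          gcongr
          calc (2 : ℝ≥0∞) ≤ 7 := by norm_num
            _ ≤ _ := le_self_add
  · simp only [hw, if_false, RandTimed.wp_bind, RandTimed.wp_pure, endCost]
    set K := (st.1.support.card : ℝ≥0∞) + mass B st.1 + (1 + κ * B (w, ℓ)) with hK
    have hfold : ∀ h : Fin n →₀ ℝ, RandTimed.wp
        (h.support.toList.foldlM (fun (s : Fin n →₀ ℝ) v => do
          RandTimed.charge 1
          pure (s + Finsupp.single v (h v / ((1 - sq c) ^ 2 * dR c ε)))) st.2)
        (fun s => samplePotential B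
          (st.1 + Finsupp.single (w, ℓ) (1 / ((dR c ε : ℝ) * fR n δ)), s)) ≤
        5 * (h.support.card : ℝ≥0∞) + (4 * (st.2.support.card : ℝ≥0∞) + K) := by
      intro h
      refine (RandTimed.wp_mono _ fun s =>
        samplePotential_add_single_le c ε δ B st.1 w ℓ s).trans ?_
      rw [RandTimed.wp_add_const, ← add_assoc (5 * _)]
      refine add_le_add_left ((RandTimed.wp_foldlM_le _
        (fun s : Fin n →₀ ℝ => 4 * (s.support.card : ℝ≥0∞)) (fun _ => 5) _ ?_ _).trans ?_) _
      · intro s v _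
        rw [RandTimed.wp_bind, RandTimed.wp_charge, RandTimed.wp_pure, Nat.cast_one]
        calc _ ≤ 4 * ((s.support.card : ℝ≥0∞) + 1) + 1 := by
              gcongr
              exact card_support_add_single_le _ _ _
          _ = 4 * (s.support.card : ℝ≥0∞) + (4 + 1) := by ring
          _ = _ := by norm_num
      · rw [sum_map_const, Finset.length_toList, add_comm, mul_comm (5 : ℝ≥0∞)]
    refine (add_le_add_left (RandTimed.wp_mono _ hfold) _).trans ?_
    rw [RandTimed.wp_add_const]
    calc _ ≤ (ℓ + 5 + 6 * ((stopProb c)⁻¹ * totalMass G c w)) +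
          (4 * (st.2.support.card : ℝ≥0∞) + K) + 1 := by
          refine add_le_add_left (add_le_add_left ?_ _) _
          refine (wp_backwardWalk_le c hadj w ℓ).trans ?_
          exact add_le_add_right (mul_le_mul_right (sum_bwd_iterate_le G c w ℓ) _) _
      _ = samplePotential B st + ((1 + 1 + 5) + ℓ +
          (κ * B (w, ℓ) + 6 * (stopProb c)⁻¹ * totalMass G c w)) := by
          rw [hK, samplePotential]
          ring
      _ = _ := by norm_num

/-- Five expected walk lengths occur: one for each of the three walks, one for the comparison of the
two walks from w, and one because the target level ℓ is bounded by the length of the first walk. -/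
theorem wp_sampleOnce_le {G : Digraph (Fin n)} (hG : ∀ v, (inNbrs G v).Nonempty)
    (c : Set.Ioo (0 : ℝ) 1) (ε δ : ℝ) {I : Index n} (hadj : IsAdjacency G I.adj)
    (u : Fin n) (B : Fin n × ℕ → ℝ≥0∞) (st : ((Fin n × ℕ) →₀ ℝ) × (Fin n →₀ ℝ)) :
    (sampleOnce G c ε δ I u st).wp (samplePotential B) ≤
      samplePotential B st + (5 * (stopProb c)⁻¹ + 7 + ∑' ℓ, ∑ w, termProb G c ℓ u w *
        endCost G c I.hubs (sampleWeight c ε n δ) B w ℓ) := by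
  classical
  set κ := sampleWeight c ε n δ with hκ
  have inner : ∀ p p₁ p₂ : List (Fin n), RandTimed.wp (do
      RandTimed.charge (min p₁.length p₂.length)
      if Meet p₁ p₂ then pure st
      else processSample G c ε δ I st (p.getLastD u) (p.length - 1)) (samplePotential B) ≤
      samplePotential B st + (7 + (p.length : ℝ≥0∞) +
        endCost G c I.hubs κ B (p.getLastD u) (p.length - 1)) + p₁.length := by
    intro p p₁ p₂
    rw [RandTimed.wp_bind, RandTimed.wp_charge]
    refine add_le_add ?_ (Nat.cast_le.2 (min_le_left _ _))
    split_ifs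
    · rw [RandTimed.wp_pure]
      exact le_self_add
    · refine (wp_processSample_le c ε δ hadj B st _ _).trans ?_
      gcongr
      exact Nat.sub_le _ _
  have hdef : sampleOnce G c ε δ I u st = (do
      let p ← sampleWalk G c u
      let p₁ ← sampleWalk G c (p.getLastD u)
      let p₂ ← sampleWalk G c (p.getLastD u)
      RandTimed.charge (min p₁.length p₂.length)
      if Meet p₁ p₂ then pure st
      else processSample G c ε δ I st (p.getLastD u) (p.length - 1)) := rfl
  rw [hdef, RandTimed.wp_bind]
  simp only [sampleWalk, RandTimed.wp_draw]
  calc _ ≤ expect (walk G c u) fun p => ((samplePotential B st + (7 + (p.length : ℝ≥0∞) +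
        endCost G c I.hubs κ B (p.getLastD u) (p.length - 1)) + (stopProb c)⁻¹) +
          (stopProb c)⁻¹ + (stopProb c)⁻¹) + p.length := by
        refine expect_mono _ fun p => add_le_add_left ?_ _
        rw [RandTimed.wp_bind, RandTimed.wp_draw]
        calc _ ≤ expect (walk G c (p.getLastD u)) fun p₁ =>
              (samplePotential B st + (7 + (p.length : ℝ≥0∞) +
                endCost G c I.hubs κ B (p.getLastD u) (p.length - 1)) + p₁.length +
                (stopProb c)⁻¹) + p₁.length := by
              refine expect_mono _ fun p₁ => add_le_add_left ?_ _
              rw [RandTimed.wp_bind, RandTimed.wp_draw]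
              refine (expect_mono _ fun p₂ => add_le_add_left (inner p p₁ p₂) _).trans ?_
              rw [expect_add, expect_const, expect_walk_length]
          _ = _ := by
              simp only [expect_add, expect_const, expect_walk_length]
    _ = _ := by
        simp only [expect_add, expect_const, expect_walk_length]
        rw [expect_walk hG c u u fun w ℓ => endCost G c I.hubs κ B w ℓ]
        ring

/-! ### The query -/

theorem wp_sampleRounds_le {G : Digraph (Fin n)} (c : Set.Ioo (0 : ℝ) 1) (ε δ : ℝ) {I : Index n}
    (u : Fin n) (B : Fin n × ℕ → ℝ≥0∞) {A : ℝ≥0∞}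
    (hA : ∀ st, (sampleOnce G c ε δ I u st).wp (samplePotential B) ≤ samplePotential B st + A) :
    (sampleRounds G c ε δ I u).wp (fun st =>
      4 * (st.2.map fun s => (s.support.card : ℝ≥0∞)).sum +
        (st.1.support.card + mass B st.1)) ≤ fR n δ * (1 + dR c ε * A) := by
  refine (RandTimed.wp_foldlM_le _ (fun st : ((Fin n × ℕ) →₀ ℝ) × List (Fin n →₀ ℝ) =>
      4 * (st.2.map fun s => (s.support.card : ℝ≥0∞)).sum +
        (st.1.support.card + mass B st.1)) (fun _ => 1 + dR c ε * A) _ ?_ _).trans ?_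
  · intro acc i _
    rw [RandTimed.wp_bind, RandTimed.wp_charge, RandTimed.wp_bind]
    simp only [RandTimed.wp_pure]
    set S := (acc.2.map fun s => (s.support.card : ℝ≥0∞)).sum with hS
    -- The estimator of a finished round keeps its weight 4 when it is appended to the list, so the
    -- potential is unchanged.
    have h : ∀ st : ((Fin n × ℕ) →₀ ℝ) × (Fin n →₀ ℝ),
        4 * ((acc.2 ++ [st.2]).map fun s => (s.support.card : ℝ≥0∞)).sum +
          (st.1.support.card + mass B st.1) = samplePotential B st + 4 * S := by
      intro st
      simp only [List.map_append, List.sum_append, List.map_cons, List.map_nil, List.sum_cons,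
        List.sum_nil, samplePotential, hS]
      ring
    simp only [h]
    rw [RandTimed.wp_add_const]
    have h2 := RandTimed.wp_foldlM_le (fun st (_ : ℕ) => sampleOnce G c ε δ I u st)
      (samplePotential B) (fun _ => A) (List.range (dR c ε)) (fun st _ _ => hA st)
      (acc.1, (0 : Fin n →₀ ℝ))
    rw [sum_map_const, List.length_range] at h2
    calc _ ≤ samplePotential B (acc.1, (0 : Fin n →₀ ℝ)) + dR c ε * A + 4 * S + (1 : ℕ) := by
          gcongr
      _ = _ := by
          simp only [samplePotential, Finsupp.support_zero, Finset.card_empty, Nat.cast_zero,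
            mul_zero, zero_add, Nat.cast_one]
          ring
  · rw [sum_map_const, List.length_range]
    simp [mass_zero]

theorem expectedTime_query_le {G : Digraph (Fin n)} (hG : ∀ v, (inNbrs G v).Nonempty)
    (c : Set.Ioo (0 : ℝ) 1) {ε : ℝ} (hε : 0 < ε) (δ : ℝ) (hubs T : Finset (Fin n)) (u : Fin n) :
    (query G c ε δ (buildIndex G c ε hubs) u).expectedTime ≤
      fR n δ * (1 + dR c ε * (5 * (stopProb c)⁻¹ + 7 + ∑' ℓ, ∑ w, termProb G c ℓ u w *
        endCost G c hubs (sampleWeight c ε n δ) (keyWeight G c ε T) w ℓ)) +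
        2 * (invThreshold c ε * ∑ w ∈ T, totalMass G c w) := by
  rw [RandTimed.expectedTime_eq_wp, query, RandTimed.wp_bind]
  set B := keyWeight G c ε T with hB
  set R := 2 * (invThreshold c ε * ∑ w ∈ T, totalMass G c w) with hR
  have h : ∀ st : ((Fin n × ℕ) →₀ ℝ) × List (Fin n →₀ ℝ), RandTimed.wp (do
      let sB ← medians st.2
      let sI ← retrieve c ε (buildIndex G c ε hubs) st.1
      RandTimed.charge (sB.support.card + sI.support.card)
      pure (sB + sI)) (fun _ => 0) ≤
      4 * (st.2.map fun s => (s.support.card : ℝ≥0∞)).sum +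
        (st.1.support.card + mass B st.1) + R := by
    intro st
    simp only [RandTimed.wp_bind, RandTimed.wp_charge, RandTimed.wp_pure, zero_add, Nat.cast_add]
    have h1 : ∀ sB : Fin n →₀ ℝ, (retrieve c ε (buildIndex G c ε hubs) st.1).wp
        (fun sI => (sB.support.card : ℝ≥0∞) + sI.support.card) ≤
        sB.support.card + (st.1.support.card + mass B st.1 + R) := by
      intro sB
      simp only [add_comm (sB.support.card : ℝ≥0∞), RandTimed.wp_add_const]
      exact add_le_add_left (wp_retrieve_buildIndex_le G c hε hubs T st.1) _
    refine (RandTimed.wp_mono _ h1).trans ?_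
    rw [RandTimed.wp_add_const, add_assoc (4 * _)]
    exact add_le_add_left (wp_medians_le st.2) _
  refine (RandTimed.wp_mono _ h).trans ?_
  rw [RandTimed.wp_add_const]
  exact add_le_add_left (wp_sampleRounds_le c ε δ u B fun st =>
    wp_sampleOnce_le hG c ε δ (isAdjacency_sortAdjacency G) u B st) _

open Classical in
-- The squares arise here: summed over all sources, the walks ending at w have mass n π(w), and each
-- of them incurs a cost proportional to at most n π(w).
theorem sum_tsum_endCost_le (G : Digraph (Fin n)) (c : Set.Ioo (0 : ℝ) 1) (ε : ℝ)
    (hubs T : Finset (Fin n)) (κ : ℝ≥0∞) :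
    ∑ u, ∑' ℓ, ∑ w, termProb G c ℓ u w * endCost G c hubs κ (keyWeight G c ε T) w ℓ ≤
      κ * (2 * invThreshold c ε ^ 2 * ∑ w ∈ Tᶜ, totalMass G c w ^ 2) +
        6 * (stopProb c)⁻¹ * ∑ w ∈ hubsᶜ, totalMass G c w ^ 2 := by
  have hcompl : ∀ S : Finset (Fin n), ∑ w ∈ Sᶜ, totalMass G c w ^ 2 =
      ∑ w, if w ∈ S then 0 else totalMass G c w ^ 2 := by
    intro S
    rw [Finset.sum_ite, Finset.sum_const_zero, zero_add]
    congr 1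
    ext w
    simp
  have hswap : ∑ u, ∑' ℓ, ∑ w, termProb G c ℓ u w * endCost G c hubs κ (keyWeight G c ε T) w ℓ =
      ∑ w, ∑' ℓ, levelMass G c w ℓ * endCost G c hubs κ (keyWeight G c ε T) w ℓ := by
    rw [← Summable.tsum_finsetSum fun _ _ => ENNReal.summable,
      ← Summable.tsum_finsetSum fun _ _ => ENNReal.summable]
    refine tsum_congr fun ℓ => ?_
    rw [Finset.sum_comm]
    exact Finset.sum_congr rfl fun w _ => by rw [← Finset.sum_mul, sum_termProb]
  rw [hswap, hcompl, hcompl, Finset.mul_sum, Finset.mul_sum, Finset.mul_sum,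
    ← Finset.sum_add_distrib]
  refine Finset.sum_le_sum fun w _ => ?_
  have hle : ∀ ℓ, endCost G c hubs κ (keyWeight G c ε T) w ℓ ≤
      κ * (2 * invThreshold c ε ^ 2 * if w ∈ T then 0 else totalMass G c w) +
        6 * (stopProb c)⁻¹ * if w ∈ hubs then 0 else totalMass G c w := by
    intro ℓ
    unfold endCost keyWeight
    refine add_le_add_left (mul_le_mul_right (mul_le_mul_right ?_ _) _) _
    split_ifs
    · exact le_rfl
    · exact levelMass_le G c w ℓ
  refine (ENNReal.tsum_le_tsum fun ℓ => mul_le_mul_right (hle ℓ) _).trans (le_of_eq ?_)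
  rw [ENNReal.tsum_mul_right, tsum_levelMass]
  split_ifs <;> ring

/-- The set `T` exists only in the analysis and is chosen later according to the regime. -/
theorem expectedQueryCost_le {G : Digraph (Fin n)} (hG : ∀ v, (inNbrs G v).Nonempty)
    (hn : n ≠ 0) (c : Set.Ioo (0 : ℝ) 1) {ε : ℝ} (hε : 0 < ε) (δ : ℝ)
    (hubs T : Finset (Fin n)) :
    expectedQueryCost G c ε δ (buildIndex G c ε hubs) ≤
      fR n δ + fR n δ * dR c ε * (5 * (stopProb c)⁻¹ + 7) +
        2 * (invThreshold c ε * ∑ w ∈ T, totalMass G c w) +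
        (2 * invThreshold c ε ^ 2 * ∑ w ∈ Tᶜ, totalMass G c w ^ 2 +
          fR n δ * dR c ε * (6 * (stopProb c)⁻¹ * ∑ w ∈ hubsᶜ, totalMass G c w ^ 2)) / n := by
  set κ := sampleWeight c ε n δ with hκ
  have hn' : (n : ℝ≥0∞) ≠ 0 := by exact_mod_cast hn
  -- The n_r samples together add at most 1 to η̂π, so the retrieval term carries no factor n_r.
  have hκ1 : (fR n δ : ℝ≥0∞) * dR c ε * κ ≤ 1 := by
    rw [hκ, sampleWeight, ← ENNReal.ofReal_natCast, ← ENNReal.ofReal_natCast (dR c ε),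
      ← ENNReal.ofReal_mul (Nat.cast_nonneg _),
      ← ENNReal.ofReal_mul (mul_nonneg (Nat.cast_nonneg _) (Nat.cast_nonneg _)),
      ENNReal.ofReal_le_one, mul_comm (fR n δ : ℝ), one_div]
    exact mul_inv_le_one
  set K : ℝ≥0∞ := fR n δ + fR n δ * dR c ε * (5 * (stopProb c)⁻¹ + 7) +
        2 * (invThreshold c ε * ∑ w ∈ T, totalMass G c w) with hK
  unfold expectedQueryCost
  calc _ ≤ (∑ u, (K + fR n δ * dR c ε * ∑' ℓ, ∑ w, termProb G c ℓ u w *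
        endCost G c hubs κ (keyWeight G c ε T) w ℓ)) / n := by
        gcongr with u
        refine (expectedTime_query_le hG c hε δ hubs T u).trans (le_of_eq ?_)
        rw [hK]
        ring
    _ ≤ (n * K + fR n δ * dR c ε *
        (κ * (2 * invThreshold c ε ^ 2 * ∑ w ∈ Tᶜ, totalMass G c w ^ 2) +
        6 * (stopProb c)⁻¹ * ∑ w ∈ hubsᶜ, totalMass G c w ^ 2)) / n := by
        gcongr
        rw [Finset.sum_add_distrib, ← Finset.mul_sum, Finset.sum_const, Finset.card_univ,
          Fintype.card_fin, nsmul_eq_mul]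
        gcongr
        exact sum_tsum_endCost_le G c ε hubs T κ
    _ = K + (fR n δ * dR c ε * κ * (2 * invThreshold c ε ^ 2 * ∑ w ∈ Tᶜ, totalMass G c w ^ 2) +
          fR n δ * dR c ε * (6 * (stopProb c)⁻¹ * ∑ w ∈ hubsᶜ, totalMass G c w ^ 2)) / n := by
        rw [ENNReal.add_div, mul_comm (n : ℝ≥0∞), ENNReal.mul_div_cancel_right hn' (by simp)]
        congr 2
        ring
    _ ≤ _ := by
        exact add_le_add_right (ENNReal.div_le_div_right (add_le_add_left
          (mul_le_of_le_one_left zero_le hκ1) _) _) _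

/-! ### Sums of powers -/

/-- `(1 - 1 / (x + 1))^r ≤ 1 - r / (x + 1)`, multiplied by `(x + 1)^r`. -/
theorem rpow_le_succ_rpow_mul {x r : ℝ} (hx : 0 ≤ x) (h0 : 0 ≤ r) (h1 : r ≤ 1) :
    x ^ r ≤ (1 - r / (x + 1)) * (x + 1) ^ r := by
  have hx1 : 0 < x + 1 := by linarith
  -- Bernoulli's inequality for exponents in [0, 1], at s = -1 / (x + 1).
  have hb := rpow_one_add_le_one_add_mul_self (s := -(1 / (x + 1))) (p := r)
    (neg_le_neg ((div_le_one hx1).2 (by linarith))) h0 h1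
  have e1 : 1 + -(1 / (x + 1)) = x / (x + 1) := by
    field_simp
    ring
  rw [e1, Real.div_rpow hx hx1.le, div_le_iff₀ (Real.rpow_pos_of_pos hx1 _)] at hb
  refine hb.trans (le_of_eq ?_)
  ring

/-- Comparison with the integral of x^(-q), carried out as an induction whose step is Bernoulli's
inequality. -/
theorem sum_range_rpow_neg_le {q : ℝ} (h0 : 0 ≤ q) (h1 : q < 1) (J : ℕ) :
    ∑ j ∈ Finset.range J, ((j : ℝ) + 1) ^ (-q) ≤ (J : ℝ) ^ (1 - q) / (1 - q) := by
  have hq : 0 < 1 - q := sub_pos.2 h1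
  induction J with
  | zero => simp [Real.zero_rpow hq.ne']
  | succ J ih =>
    rw [Finset.sum_range_succ]
    refine (add_le_add_left ih _).trans ?_
    rw [div_add' _ _ _ hq.ne', div_le_div_iff_of_pos_right hq]
    push_cast
    have hx : (0 : ℝ) < J + 1 := by positivity
    have hb := rpow_le_succ_rpow_mul (Nat.cast_nonneg J : (0 : ℝ) ≤ J) hq.le (by linarith)
    have e2 : ((J : ℝ) + 1) ^ (-q) = ((J : ℝ) + 1) ^ (1 - q) / (J + 1) := by
      rw [← Real.rpow_sub_one hx.ne']
      congr 1
      ring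
    rw [e2]
    refine (add_le_add_left hb _).trans (le_of_eq ?_)
    ring

/-- Each term is at most 2/r times the decrement of x^(-r), and these decrements telescope. -/
theorem sum_Ico_rpow_neg_le {r : ℝ} (h0 : 0 < r) (h1 : r ≤ 1) (J n : ℕ) :
    ∑ j ∈ Finset.Ico J n, ((j : ℝ) + 1) ^ (-(1 + r)) ≤ 2 / r * ((J : ℝ) + 1) ^ (-r) := by
  rcases lt_or_ge n J with h | h
  · rw [Finset.Ico_eq_empty (by omega), Finset.sum_empty]
    positivity
  suffices H : ∑ j ∈ Finset.Ico J n, ((j : ℝ) + 1) ^ (-(1 + r)) ≤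
      2 / r * (((J : ℝ) + 1) ^ (-r) - ((n : ℝ) + 1) ^ (-r)) by
    refine H.trans (mul_le_mul_of_nonneg_left ?_ (by positivity))
    have : 0 ≤ ((n : ℝ) + 1) ^ (-r) := by positivity
    linarith
  induction n, h using Nat.le_induction with
  | base => simp
  | succ m hm ih =>
    rw [Finset.sum_Ico_succ_top hm]
    set x : ℝ := (m : ℝ) + 1 with hx
    have hx1 : 1 ≤ x := by
      have : (0 : ℝ) ≤ m := Nat.cast_nonneg m
      linarith
    have hx0 : 0 < x := by linarith
    have e : ((m + 1 : ℕ) : ℝ) + 1 = x + 1 := by push_cast; rfl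
    rw [e]
    have hb := rpow_le_succ_rpow_mul hx0.le h0.le h1
    have hA : 0 < x ^ r := Real.rpow_pos_of_pos hx0 _
    have hB : 0 < (x + 1) ^ r := Real.rpow_pos_of_pos (by linarith) _
    have hstep : x ^ (-(1 + r)) ≤ 2 / r * (x ^ (-r) - (x + 1) ^ (-r)) := by
      have e1 : x ^ (-(1 + r)) = (x ^ r)⁻¹ * x⁻¹ := by
        rw [← Real.rpow_neg hx0.le, ← Real.rpow_neg_one x, ← Real.rpow_add hx0]
        congr 1
        ring
      have e2 : (x + 1) ^ (-r) ≤ (1 - r / (x + 1)) * x ^ (-r) := by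
        rw [Real.rpow_neg (by linarith), Real.rpow_neg hx0.le, inv_eq_one_div,
          div_le_iff₀ hB, mul_assoc, mul_comm (x ^ r)⁻¹, ← mul_assoc, ← div_eq_mul_inv,
          le_div_iff₀ hA, one_mul]
        exact hb
      calc x ^ (-(1 + r)) = x⁻¹ * x ^ (-r) := by rw [e1, Real.rpow_neg hx0.le, mul_comm]
        -- The loss of the factor 2 is 1/x ≤ 2/(x + 1), valid as x ≥ 1.
        _ ≤ 2 / (x + 1) * x ^ (-r) := by
            refine mul_le_mul_of_nonneg_right ?_ (by positivity)
            rw [inv_eq_one_div, div_le_div_iff₀ hx0 (by linarith)]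
            linarith
        _ = 2 / r * (x ^ (-r) - (1 - r / (x + 1)) * x ^ (-r)) := by
            field_simp
            ring
        _ ≤ _ := by gcongr
    calc _ ≤ _ := add_le_add ih hstep
      _ = _ := by ring

theorem sum_range_inv_le (n : ℕ) :
    ∑ j ∈ Finset.range n, ((j : ℝ) + 1) ^ (-(1 : ℝ)) ≤ 1 + Real.log n := by
  refine le_trans (le_of_eq ?_) (harmonic_le_one_add_log n)
  rw [harmonic]
  push_cast
  simp only [Real.rpow_neg_one]

/-! ### Reverse PageRanks under a power law -/

/-- The first `min J n` nodes in the order `w`. -/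
def topNodes (w : Equiv.Perm (Fin n)) (J : ℕ) : Finset (Fin n) :=
  (Finset.univ.filter fun j : Fin n => (j : ℕ) < J).map w.toEmbedding

theorem sum_topNodes {M : Type*} [AddCommMonoid M] (w : Equiv.Perm (Fin n)) (J : ℕ)
    (f : Fin n → M) (g : ℕ → M) (h : ∀ j : Fin n, f (w j) = g j) :
    ∑ v ∈ topNodes w J, f v = ∑ j ∈ Finset.range (min J n), g j := by
  rw [topNodes, Finset.sum_map, Finset.sum_filter]
  simp only [Equiv.coe_toEmbedding, h]
  rw [Fin.sum_univ_eq_sum_range (fun j => if j < J then g j else 0) n, ← Finset.sum_filter]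
  congr 1
  ext j
  simp
  omega

theorem sum_compl_topNodes {M : Type*} [AddCommMonoid M] (w : Equiv.Perm (Fin n)) (J : ℕ)
    (f : Fin n → M) (g : ℕ → M) (h : ∀ j : Fin n, f (w j) = g j) :
    ∑ v ∈ (topNodes w J)ᶜ, f v = ∑ j ∈ Finset.Ico J n, g j := by
  have e : (topNodes w J)ᶜ =
      (Finset.univ.filter fun j : Fin n => ¬ (j : ℕ) < J).map w.toEmbedding := by
    ext v
    simp [topNodes]
  rw [e, Finset.sum_map, Finset.sum_filter]
  simp only [Equiv.coe_toEmbedding, h]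
  rw [Fin.sum_univ_eq_sum_range (fun j => if ¬ j < J then g j else 0) n, ← Finset.sum_filter]
  congr 1
  ext j
  simp
  omega

/-- The power-law bound `K n^(1/γ) j^(-1/γ)` for `n π(w_j)`. -/
theorem totalMass_le {G : Digraph (Fin n)} (hG : ∀ v, (inNbrs G v).Nonempty)
    {c : Set.Ioo (0 : ℝ) 1} {γ κ₁ κ₂ : ℝ} {w : Equiv.Perm (Fin n)}
    (h : PowerLaw G c γ κ₁ κ₂ w) (j : Fin n) :
    totalMass G c (w j) ≤
      ENNReal.ofReal (|κ₂| * (n : ℝ) ^ (1 / γ) * (((j : ℕ) : ℝ) + 1) ^ (-(1 / γ))) := by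
  have hn : (0 : ℝ) < n := by exact_mod_cast j.pos
  rw [totalMass_eq hG]
  refine ENNReal.ofReal_le_ofReal ?_
  have e : (n : ℝ) ^ (1 / γ) * (n : ℝ) ^ (1 - 1 / γ) = n := by
    rw [← Real.rpow_add hn, add_sub_cancel, Real.rpow_one]
  have hp : 0 < (n : ℝ) ^ (1 - 1 / γ) := Real.rpow_pos_of_pos hn _
  calc (n : ℝ) * reversePageRank G c (w j)
      ≤ n * (κ₂ * ((((j : ℕ) : ℝ) + 1) ^ (-(1 / γ)) / (n : ℝ) ^ (1 - 1 / γ))) := by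
        gcongr
        exact h.upper j
    _ ≤ n * (|κ₂| * ((((j : ℕ) : ℝ) + 1) ^ (-(1 / γ)) / (n : ℝ) ^ (1 - 1 / γ))) := by
        gcongr
        exact le_abs_self κ₂
    _ = _ := by
        nth_rewrite 1 [← e]
        field_simp

/-- The bound for `∑ n π(w_j)` over `j ≤ J`. -/
def headSum (n : ℕ) (γ K : ℝ) (J : ℕ) : ℝ :=
  K * (n : ℝ) ^ (1 / γ) * ∑ j ∈ Finset.range (min J n), ((j : ℝ) + 1) ^ (-(1 / γ))

/-- The bound for `n ∑ π(w_j)²` over `j > J`. -/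
def tailSum (n : ℕ) (γ K : ℝ) (J : ℕ) : ℝ :=
  K ^ 2 * (n : ℝ) ^ (2 / γ - 1) * ∑ j ∈ Finset.Ico J n, ((j : ℝ) + 1) ^ (-(2 / γ))

theorem headSum_nonneg (n : ℕ) (γ : ℝ) {K : ℝ} (hK : 0 ≤ K) (J : ℕ) : 0 ≤ headSum n γ K J := by
  unfold headSum
  positivity

theorem tailSum_nonneg (n : ℕ) (γ K : ℝ) (J : ℕ) : 0 ≤ tailSum n γ K J := by
  unfold tailSum
  positivity

theorem sum_topNodes_totalMass_le {G : Digraph (Fin n)} (hG : ∀ v, (inNbrs G v).Nonempty)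
    {c : Set.Ioo (0 : ℝ) 1} {γ κ₁ κ₂ : ℝ} {w : Equiv.Perm (Fin n)}
    (h : PowerLaw G c γ κ₁ κ₂ w) (J : ℕ) :
    ∑ v ∈ topNodes w J, totalMass G c v ≤ ENNReal.ofReal (headSum n γ |κ₂| J) := by
  rw [headSum, Finset.mul_sum, ENNReal.ofReal_sum_of_nonneg fun j _ => by positivity]
  rw [← sum_topNodes w J (fun v => ENNReal.ofReal (|κ₂| * (n : ℝ) ^ (1 / γ) *
    (((w.symm v : ℕ) : ℝ) + 1) ^ (-(1 / γ)))) _ fun j => by simp]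
  refine Finset.sum_le_sum fun v _ => ?_
  simpa using totalMass_le hG h (w.symm v)

theorem sum_compl_topNodes_totalMass_le {G : Digraph (Fin n)} (hG : ∀ v, (inNbrs G v).Nonempty)
    {c : Set.Ioo (0 : ℝ) 1} {γ κ₁ κ₂ : ℝ} {w : Equiv.Perm (Fin n)}
    (h : PowerLaw G c γ κ₁ κ₂ w) (hn : 0 < n) (J : ℕ) :
    ∑ v ∈ (topNodes w J)ᶜ, totalMass G c v ^ 2 ≤
      ENNReal.ofReal (n * tailSum n γ |κ₂| J) := by
  have hn' : (0 : ℝ) < n := by exact_mod_cast hn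
  have e : (n : ℝ) * tailSum n γ |κ₂| J = ∑ j ∈ Finset.Ico J n,
      (|κ₂| * (n : ℝ) ^ (1 / γ) * ((j : ℝ) + 1) ^ (-(1 / γ))) ^ 2 := by
    rw [tailSum, Finset.mul_sum, Finset.mul_sum]
    refine Finset.sum_congr rfl fun j _ => ?_
    have hj : (0 : ℝ) < (j : ℝ) + 1 := by positivity
    have e1 : (((j : ℝ) + 1) ^ (-(1 / γ))) ^ 2 = ((j : ℝ) + 1) ^ (-(2 / γ)) := by
      rw [← Real.rpow_natCast, ← Real.rpow_mul hj.le]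
      congr 1
      push_cast
      ring
    have e2 : ((n : ℝ) ^ (1 / γ)) ^ 2 = n * (n : ℝ) ^ (2 / γ - 1) := by
      rw [Real.rpow_sub_one hn'.ne', mul_div_cancel₀ _ hn'.ne', ← Real.rpow_natCast,
        ← Real.rpow_mul hn'.le]
      congr 1
      push_cast
      ring
    rw [mul_pow, mul_pow, e1, e2]
    ring
  rw [e, ENNReal.ofReal_sum_of_nonneg fun j _ => by positivity]
  rw [← sum_compl_topNodes w J (fun v => ENNReal.ofReal ((|κ₂| * (n : ℝ) ^ (1 / γ) *
    (((w.symm v : ℕ) : ℝ) + 1) ^ (-(1 / γ))) ^ 2)) _ fun j => by simp]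
  refine Finset.sum_le_sum fun v _ => ?_
  rw [ENNReal.ofReal_pow (by positivity)]
  have := totalMass_le hG h (w.symm v)
  rw [Equiv.apply_symm_apply] at this
  gcongr

/-! ### The expected cost in terms of the power law -/

/-- Used to absorb additive constants and the rounding in `fR` into multiples of the logarithm. -/
theorem one_half_lt_log {n : ℕ} {δ : ℝ} (hn : 2 ≤ n) (h0 : 0 < δ) (h1 : δ ≤ 1) :
    1 / 2 < Real.log (n / δ) := by
  have h2 : (2 : ℝ) ≤ n := by exact_mod_cast hn
  have h3 : (2 : ℝ) ≤ n / δ := by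
    rw [le_div_iff₀ h0]
    linarith
  have := Real.log_le_log (by norm_num) h3
  have := Real.log_two_gt_d9
  linarith

theorem c₁_pos (c : Set.Ioo (0 : ℝ) 1) : 0 < c₁ c := by
  have := one_sub_sq_pos c
  unfold c₁
  positivity

theorem fR_le {n : ℕ} {δ : ℝ} (hn : 2 ≤ n) (h0 : 0 < δ) (h1 : δ ≤ 1) :
    (fR n δ : ℝ) ≤ 5 * Real.log (n / δ) := by
  have h := one_half_lt_log hn h0 h1
  have := (Nat.ceil_lt_add_one (a := 3 * Real.log (n / δ)) (by linarith)).le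
  unfold fR
  linarith

theorem dR_le (c : Set.Ioo (0 : ℝ) 1) {ε : ℝ} (h0 : 0 < ε) (h1 : ε ≤ 1) :
    (dR c ε : ℝ) ≤ (c₁ c + 1) / ε ^ 2 := by
  have hc := c₁_pos c
  have := (Nat.ceil_lt_add_one (a := c₁ c / ε ^ 2) (by positivity)).le
  have h2 : 1 ≤ 1 / ε ^ 2 := by
    rw [le_div_iff₀ (by positivity)]
    nlinarith
  rw [add_div]
  unfold dR
  linarith

theorem ofReal_cost {f d t i A S S' N : ℝ} (hf : 0 ≤ f) (hd : 0 ≤ d) (ht : 0 ≤ t) (hi : 0 ≤ i)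
    (hA : 0 ≤ A) (hS : 0 ≤ S) (hS' : 0 ≤ S') (hN : 0 < N) :
    ENNReal.ofReal (f + f * d * (5 * t + 7) + 2 * (i * A) +
      (2 * i ^ 2 * S + f * d * (6 * t * S')) / N) =
    ENNReal.ofReal f + ENNReal.ofReal f * ENNReal.ofReal d * (5 * ENNReal.ofReal t + 7) +
      2 * (ENNReal.ofReal i * ENNReal.ofReal A) +
      (2 * ENNReal.ofReal i ^ 2 * ENNReal.ofReal S +
        ENNReal.ofReal f * ENNReal.ofReal d * (6 * ENNReal.ofReal t * ENNReal.ofReal S')) /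
        ENNReal.ofReal N := by
  rw [ENNReal.ofReal_add (by positivity) (by positivity),
    ENNReal.ofReal_add (by positivity) (by positivity),
    ENNReal.ofReal_add (by positivity) (by positivity), ENNReal.ofReal_div_of_pos hN,
    ENNReal.ofReal_add (by positivity) (by positivity), ENNReal.ofReal_mul (by positivity),
    ENNReal.ofReal_mul hf, ENNReal.ofReal_add (by positivity) (by positivity),
    ENNReal.ofReal_mul (by norm_num), ENNReal.ofReal_mul (by norm_num), ENNReal.ofReal_mul hi,
    ENNReal.ofReal_mul (by positivity), ENNReal.ofReal_mul (by norm_num), ENNReal.ofReal_pow hi,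
    ENNReal.ofReal_mul (by positivity), ENNReal.ofReal_mul hf, ENNReal.ofReal_mul (by positivity),
    ENNReal.ofReal_mul (by norm_num)]
  norm_num

/-- The factor of the sampling cost. -/
def sampleConst (c : Set.Ioo (0 : ℝ) 1) : ℝ :=
  5 + 5 * (c₁ c + 1) * (11 * (1 - sq c)⁻¹ + 7)

/-- The factor of the cost of retrieving the lists of the index. -/
def retrieveConst (c : Set.Ioo (0 : ℝ) 1) : ℝ := 2 * c₁ c + 2 * c₁ c ^ 2

theorem sampleConst_pos (c : Set.Ioo (0 : ℝ) 1) : 0 < sampleConst c := by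
  have := one_sub_sq_pos c
  have := c₁_pos c
  unfold sampleConst
  positivity

theorem retrieveConst_pos (c : Set.Ioo (0 : ℝ) 1) : 0 < retrieveConst c := by
  have := c₁_pos c
  unfold retrieveConst
  positivity

/-- `J` is the actual number of hub nodes, `J'` the free cut between lists charged in full and lists
charged to η̂π. The retrieval terms carry no logarithm. -/
theorem expectedQueryCost_le_ofReal {G : Digraph (Fin n)} (hG : ∀ v, (inNbrs G v).Nonempty)
    (hn : 2 ≤ n) {c : Set.Ioo (0 : ℝ) 1} {γ κ₁ κ₂ : ℝ} {w : Equiv.Perm (Fin n)}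
    (h : PowerLaw G c γ κ₁ κ₂ w) {ε δ : ℝ} (hε : 0 < ε) (hε1 : ε ≤ 1) (hδ : 0 < δ) (hδ1 : δ ≤ 1)
    (J J' : ℕ) :
    expectedQueryCost G c ε δ (buildIndex G c ε (topNodes w J)) ≤
      ENNReal.ofReal (sampleConst c * (Real.log (n / δ) * (1 + tailSum n γ |κ₂| J) / ε ^ 2) +
        retrieveConst c * (headSum n γ |κ₂| J' / ε + tailSum n γ |κ₂| J' / ε ^ 2)) := by
  have hn0 : 0 < n := by omega
  have hn' : (0 : ℝ) < n := by exact_mod_cast hn0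
  have hθ := one_sub_sq_pos c
  have hc := c₁_pos c
  have hA := headSum_nonneg n γ (abs_nonneg κ₂) J'
  have hS := tailSum_nonneg n γ |κ₂| J'
  have hS' := tailSum_nonneg n γ |κ₂| J
  have hL := one_half_lt_log hn hδ hδ1
  have hf := fR_le hn hδ hδ1
  have hd := dR_le c hε hε1
  have hf0 : (0 : ℝ) ≤ fR n δ := Nat.cast_nonneg _
  have hd0 : (0 : ℝ) ≤ dR c ε := Nat.cast_nonneg _
  calc expectedQueryCost G c ε δ (buildIndex G c ε (topNodes w J))
      ≤ fR n δ + fR n δ * dR c ε * (5 * (stopProb c)⁻¹ + 7) +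
        2 * (invThreshold c ε * ENNReal.ofReal (headSum n γ |κ₂| J')) +
        (2 * invThreshold c ε ^ 2 * ENNReal.ofReal (n * tailSum n γ |κ₂| J') +
          fR n δ * dR c ε * (6 * (stopProb c)⁻¹ *
            ENNReal.ofReal (n * tailSum n γ |κ₂| J))) / n := by
        refine (expectedQueryCost_le hG hn0.ne' c hε δ (topNodes w J) (topNodes w J')).trans ?_
        gcongr
        · exact sum_topNodes_totalMass_le hG h J'
        · exact sum_compl_topNodes_totalMass_le hG h hn0 J'
        · exact sum_compl_topNodes_totalMass_le hG h hn0 J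
    _ = ENNReal.ofReal (fR n δ + fR n δ * dR c ε * (5 * (1 - sq c)⁻¹ + 7) +
        2 * (c₁ c / ε * headSum n γ |κ₂| J') + (2 * (c₁ c / ε) ^ 2 * (n * tailSum n γ |κ₂| J') +
          fR n δ * dR c ε * (6 * (1 - sq c)⁻¹ * (n * tailSum n γ |κ₂| J))) / n) := by
        rw [ofReal_cost (by positivity) (by positivity) (by positivity) (by positivity) hA
          (by positivity) (by positivity) hn', ENNReal.ofReal_natCast, ENNReal.ofReal_natCast,
          ENNReal.ofReal_natCast, ENNReal.ofReal_inv_of_pos hθ]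
        rfl
    _ ≤ _ := by
        refine ENNReal.ofReal_le_ofReal ?_
        set L := Real.log (n / δ) with hLdef
        set A := headSum n γ |κ₂| J'
        set S := tailSum n γ |κ₂| J'
        set S' := tailSum n γ |κ₂| J
        set t := (1 - sq c)⁻¹ with ht
        have ht0 : 0 < t := inv_pos.2 hθ
        have hL0 : 0 < L := by linarith
        have hfd : (fR n δ : ℝ) * dR c ε ≤ 5 * (c₁ c + 1) * (L / ε ^ 2) := by
          calc _ ≤ (5 * L) * ((c₁ c + 1) / ε ^ 2) := by gcongr
            _ = _ := by ring
        have hf' : (fR n δ : ℝ) ≤ 5 * (L / ε ^ 2) := by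
          refine hf.trans (mul_le_mul_of_nonneg_left ?_ (by norm_num))
          rw [le_div_iff₀ (by positivity)]
          have : ε ^ 2 ≤ 1 := pow_le_one₀ hε.le hε1
          nlinarith
        have hLε : 0 ≤ L / ε ^ 2 := by positivity
        have hAε : 0 ≤ A / ε := by positivity
        have hSε : 0 ≤ S / ε ^ 2 := by positivity
        calc _ = (fR n δ : ℝ) + fR n δ * dR c ε * (5 * t + 7 + 6 * t * S') +
              2 * c₁ c * (A / ε) + 2 * c₁ c ^ 2 * (S / ε ^ 2) := by
              field_simp
              ring
          _ ≤ 5 * (L / ε ^ 2) + 5 * (c₁ c + 1) * (L / ε ^ 2) * (5 * t + 7 + 6 * t * S') +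
              2 * c₁ c * (A / ε) + 2 * c₁ c ^ 2 * (S / ε ^ 2) := by gcongr
          _ ≤ sampleConst c * (L / ε ^ 2 * (1 + S')) +
              retrieveConst c * (A / ε + S / ε ^ 2) := by
              -- The difference of the two sides, expanded.
              have key : 0 ≤ 5 * (L / ε ^ 2) * S' +
                5 * (c₁ c + 1) * (L / ε ^ 2) * (6 * t + (5 * t + 7) * S') +
                2 * c₁ c ^ 2 * (A / ε) + 2 * c₁ c * (S / ε ^ 2) := by positivity
              unfold sampleConst retrieveConst
              rw [← ht]
              linarith
          _ = _ := by ring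

/-! ### The three regimes of the power-law exponent -/

theorem headSum_zero (n : ℕ) (γ K : ℝ) : headSum n γ K 0 = 0 := by simp [headSum]

theorem tailSum_le_tailSum_zero (n : ℕ) (γ K : ℝ) (J : ℕ) :
    tailSum n γ K J ≤ tailSum n γ K 0 := by
  unfold tailSum
  refine mul_le_mul_of_nonneg_left ?_ (by positivity)
  exact Finset.sum_le_sum_of_subset_of_nonneg (Finset.Ico_subset_Ico_left (Nat.zero_le _))
    fun j _ _ => by positivity

theorem headSum_le {γ K x : ℝ} (hγ : 1 < γ) (hK : 0 ≤ K) {J : ℕ} (hx : (J : ℝ) ≤ x) :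
    headSum n γ K J ≤ K / (1 - 1 / γ) * ((n : ℝ) ^ (1 / γ) * x ^ (1 - 1 / γ)) := by
  have h1 : 1 / γ < 1 := (div_lt_one (by linarith)).2 hγ
  have h2 : 0 < 1 - 1 / γ := by linarith
  have h3 : 0 ≤ 1 / γ := by positivity
  have hm : ((min J n : ℕ) : ℝ) ≤ x := (Nat.cast_le.2 (min_le_left _ _)).trans hx
  calc headSum n γ K J
      ≤ K * (n : ℝ) ^ (1 / γ) * (((min J n : ℕ) : ℝ) ^ (1 - 1 / γ) / (1 - 1 / γ)) :=
        mul_le_mul_of_nonneg_left (sum_range_rpow_neg_le h3 h1 _) (by positivity)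
    _ ≤ K * (n : ℝ) ^ (1 / γ) * (x ^ (1 - 1 / γ) / (1 - 1 / γ)) := by gcongr
    _ = _ := by ring

/-- For 2/γ < 1 the sum of powers grows like n^(1 - 2/γ), which cancels the prefactor exactly. -/
theorem tailSum_le_of_two_lt {γ K : ℝ} (hγ : 2 < γ) (hn : 0 < n) (J : ℕ) :
    tailSum n γ K J ≤ K ^ 2 / (1 - 2 / γ) := by
  have hn' : (0 : ℝ) < n := by exact_mod_cast hn
  have h1 : 2 / γ < 1 := (div_lt_one (by linarith)).2 hγ
  have h3 : 0 ≤ 2 / γ := by positivity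
  refine (tailSum_le_tailSum_zero n γ K J).trans ?_
  have hs := sum_range_rpow_neg_le h3 h1 n
  have e : (n : ℝ) ^ (2 / γ - 1) * (n : ℝ) ^ (1 - 2 / γ) = 1 := by
    rw [← Real.rpow_add hn']
    simp
  rw [tailSum, Nat.Ico_zero_eq_range]
  calc _ ≤ K ^ 2 * (n : ℝ) ^ (2 / γ - 1) * ((n : ℝ) ^ (1 - 2 / γ) / (1 - 2 / γ)) := by gcongr
    _ = K ^ 2 * ((n : ℝ) ^ (2 / γ - 1) * (n : ℝ) ^ (1 - 2 / γ)) / (1 - 2 / γ) := by ring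
    _ = _ := by rw [e, mul_one]

theorem tailSum_two_le (K : ℝ) (n J : ℕ) : tailSum n 2 K J ≤ K ^ 2 * (1 + Real.log n) := by
  refine (tailSum_le_tailSum_zero n 2 K J).trans ?_
  rw [tailSum, Nat.Ico_zero_eq_range, div_self two_ne_zero, sub_self, Real.rpow_zero, mul_one]
  exact mul_le_mul_of_nonneg_left (sum_range_inv_le n) (sq_nonneg K)

theorem tailSum_le_of_lt_two {γ r K : ℝ} (hr : r = 2 / γ - 1) (h0 : 0 < r) (h1 : r ≤ 1) (n J : ℕ) :
    tailSum n γ K J ≤ K ^ 2 * (2 / r) * ((n : ℝ) ^ r * ((J : ℝ) + 1) ^ (-r)) := by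
  have h := sum_Ico_rpow_neg_le h0 h1 J n
  have e : 2 / γ = 1 + r := by linarith
  rw [tailSum, ← hr, e]
  calc _ ≤ K ^ 2 * (n : ℝ) ^ r * (2 / r * ((J : ℝ) + 1) ^ (-r)) := by gcongr
    _ = _ := by ring

theorem log_pos_of_two_le (hn : 2 ≤ n) : 1 / 2 < Real.log n := by
  simpa using one_half_lt_log hn one_pos le_rfl

/-! ### Consequences of the lower bound on ε for 1 < γ < 2 -/

section lt_two
variable {γ r D ε : ℝ}

/-- Raised to the power P = (2 - γ)/(γ - 1), the condition on ε reads log n ≤ ε^P n^r D^(P(2-γ)),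
while x^(-r) ≤ n^(-r) (ε D)^(-P). In the product ε and n cancel. -/
theorem log_mul_le_of_hubs (hγ : 1 < γ) (hγ2 : γ < 2) (hr : r = 2 / γ - 1) (hn : 2 ≤ n)
    (hD : 1 ≤ D) (hε : 0 < ε)
    (hcond : (Real.log n) ^ ((γ - 1) / (2 - γ)) /
      ((n : ℝ) ^ ((γ - 1) / γ) * D ^ (2 - γ)) ≤ ε) {x : ℝ}
    (hx : (n : ℝ) * (ε * D) ^ (γ / (γ - 1)) ≤ x) :
    Real.log n * x ^ (-r) ≤ D ^ (-(2 - γ)) := by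
  have hn' : (0 : ℝ) < n := by exact_mod_cast (by omega : 0 < n)
  have hD0 : 0 < D := by linarith
  have hlg : 0 < Real.log n := by linarith [log_pos_of_two_le hn]
  have hg1 : 0 < γ - 1 := by linarith
  have hg2 : 0 < 2 - γ := by linarith
  have hg0 : 0 < γ := by linarith
  set P := (2 - γ) / (γ - 1) with hP
  have hP0 : 0 < P := by positivity
  have hr0 : 0 < r := by
    rw [hr, sub_pos, lt_div_iff₀ hg0]
    linarith
  have h1 : Real.log n ≤ ε ^ P * (n : ℝ) ^ r * D ^ (P * (2 - γ)) := by
    rw [div_le_iff₀ (by positivity)] at hcond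
    have h := Real.rpow_le_rpow (by positivity) hcond hP0.le
    rw [← Real.rpow_mul hlg.le, show (γ - 1) / (2 - γ) * P = 1 by rw [hP]; field_simp,
      Real.rpow_one, Real.mul_rpow hε.le (by positivity),
      Real.mul_rpow (by positivity) (by positivity), ← Real.rpow_mul hn'.le,
      ← Real.rpow_mul hD0.le] at h
    refine h.trans (le_of_eq ?_)
    rw [show (γ - 1) / γ * P = r by rw [hP, hr]; field_simp, mul_comm (2 - γ) P]
    ring
  have h2 : x ^ (-r) ≤ (n : ℝ) ^ (-r) * ε ^ (-P) * D ^ (-P) := by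
    refine (Real.rpow_le_rpow_of_nonpos (by positivity) hx (by linarith)).trans (le_of_eq ?_)
    rw [Real.mul_rpow hn'.le (by positivity), ← Real.rpow_mul (by positivity),
      show γ / (γ - 1) * -r = -P by rw [hP, hr]; field_simp,
      Real.mul_rpow hε.le hD0.le]
    ring
  have e1 : ε ^ P * ε ^ (-P) = 1 := by rw [← Real.rpow_add hε]; simp
  have e2 : (n : ℝ) ^ r * (n : ℝ) ^ (-r) = 1 := by rw [← Real.rpow_add hn']; simp
  have e3 : D ^ (P * (2 - γ)) * D ^ (-P) = D ^ (-(2 - γ)) := by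
    rw [← Real.rpow_add hD0]
    congr 1
    rw [hP]
    field_simp
    ring
  calc Real.log n * x ^ (-r)
      ≤ (ε ^ P * (n : ℝ) ^ r * D ^ (P * (2 - γ))) * ((n : ℝ) ^ (-r) * ε ^ (-P) * D ^ (-P)) := by
        have : 0 < x := lt_of_lt_of_le (by positivity) hx
        gcongr
    _ = (ε ^ P * ε ^ (-P)) * ((n : ℝ) ^ r * (n : ℝ) ^ (-r)) * (D ^ (P * (2 - γ)) * D ^ (-P)) := by
        ring
    _ = _ := by rw [e1, e2, e3]; ring

/-- The constant lower bound for `(log n)^((γ - 1) / (2 - γ))`. -/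
def logConst (γ : ℝ) : ℝ := (1 / 2 : ℝ) ^ ((γ - 1) / (2 - γ))

theorem logConst_pos (γ : ℝ) : 0 < logConst γ := by
  unfold logConst
  positivity

theorem le_mul_of_condition (hγ : 1 < γ) (hγ2 : γ < 2) (hn : 2 ≤ n) (hD : 1 ≤ D)
    (hcond : (Real.log n) ^ ((γ - 1) / (2 - γ)) /
      ((n : ℝ) ^ ((γ - 1) / γ) * D ^ (2 - γ)) ≤ ε) :
    logConst γ * ((n : ℝ) ^ (1 / γ) * D ^ (-(2 - γ))) ≤ n * ε := by
  have hn' : (0 : ℝ) < n := by exact_mod_cast (by omega : 0 < n)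
  have hD0 : 0 < D := by linarith
  have hlg := log_pos_of_two_le hn
  have hexp : 0 ≤ (γ - 1) / (2 - γ) := div_nonneg (by linarith) (by linarith)
  have h1 : logConst γ ≤ (Real.log n) ^ ((γ - 1) / (2 - γ)) :=
    Real.rpow_le_rpow (by norm_num) hlg.le hexp
  have e1 : (n : ℝ) ^ (1 / γ) * (n : ℝ) ^ ((γ - 1) / γ) = n := by
    rw [← Real.rpow_add hn', show 1 / γ + (γ - 1) / γ = 1 by field_simp; ring, Real.rpow_one]
  have e2 : D ^ (-(2 - γ)) * D ^ (2 - γ) = 1 := by rw [← Real.rpow_add hD0]; simp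
  rw [div_le_iff₀ (by positivity)] at hcond
  have hpos : 0 < (n : ℝ) ^ ((γ - 1) / γ) * D ^ (2 - γ) := by positivity
  refine le_of_mul_le_mul_right ?_ hpos
  calc _ = logConst γ * ((n : ℝ) ^ (1 / γ) * (n : ℝ) ^ ((γ - 1) / γ)) *
        (D ^ (-(2 - γ)) * D ^ (2 - γ)) := by ring
    _ = logConst γ * n := by rw [e1, e2, mul_one]
    _ ≤ (Real.log n) ^ ((γ - 1) / (2 - γ)) * n := by gcongr
    _ ≤ ε * ((n : ℝ) ^ ((γ - 1) / γ) * D ^ (2 - γ)) * n := by gcongr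
    _ = _ := by ring

/-- Write n^r = n^(1/γ) n^(1/γ) / n, bound one factor n^(1/γ) together with the power of D by n ε,
and use ε ≤ ε^(1/γ). -/
theorem rpow_mul_le_of_condition (hγ : 1 < γ) (hγ2 : γ < 2) (hr : r = 2 / γ - 1) (hn : 2 ≤ n)
    (hD : 1 ≤ D) (hε : 0 < ε) (hε1 : ε ≤ 1)
    (hcond : (Real.log n) ^ ((γ - 1) / (2 - γ)) /
      ((n : ℝ) ^ ((γ - 1) / γ) * D ^ (2 - γ)) ≤ ε) :
    (n : ℝ) ^ r * D ^ (-(2 - γ)) ≤ (logConst γ)⁻¹ * (n * ε) ^ (1 / γ) := by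
  have hn' : (0 : ℝ) < n := by exact_mod_cast (by omega : 0 < n)
  have hD0 : 0 < D := by linarith
  have h := le_mul_of_condition hγ hγ2 hn hD hcond
  have hm := logConst_pos γ
  have e1 : (n : ℝ) ^ r = (n : ℝ) ^ (1 / γ) * (n : ℝ) ^ (1 / γ) / n := by
    rw [← Real.rpow_add hn', hr, ← Real.rpow_sub_one hn'.ne']
    congr 1
    ring
  have h2 : ε ≤ ε ^ (1 / γ) := by
    have h3 : 1 / γ ≤ 1 := (div_le_one (by linarith)).2 hγ.le
    simpa using Real.rpow_le_rpow_of_exponent_ge hε hε1 h3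
  rw [Real.mul_rpow hn'.le hε.le, inv_mul_eq_div, le_div_iff₀ hm, e1]
  calc _ = (n : ℝ) ^ (1 / γ) / n * (logConst γ * ((n : ℝ) ^ (1 / γ) * D ^ (-(2 - γ)))) := by ring
    _ ≤ (n : ℝ) ^ (1 / γ) / n * (n * ε) := by gcongr
    _ = (n : ℝ) ^ (1 / γ) * ε := by field_simp
    _ ≤ _ := by gcongr

/-- Since D ≤ n, the condition makes n ε at least a positive power of n, up to a constant. -/
theorem rpow_le_mul_eps (hγ : 1 < γ) (hγ2 : γ < 2) (hn : 2 ≤ n)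
    (hD : 1 ≤ D) (hDn : D ≤ n)
    (hcond : (Real.log n) ^ ((γ - 1) / (2 - γ)) /
      ((n : ℝ) ^ ((γ - 1) / γ) * D ^ (2 - γ)) ≤ ε) :
    logConst γ * (n : ℝ) ^ ((γ - 1) ^ 2 / γ) ≤ n * ε := by
  have hn' : (0 : ℝ) < n := by exact_mod_cast (by omega : 0 < n)
  have hm := logConst_pos γ
  have hD0 : 0 < D := by linarith
  have hg0 : γ ≠ 0 := by linarith
  refine le_trans ?_ (le_mul_of_condition hγ hγ2 hn hD hcond)
  have h1 : (n : ℝ) ^ (-(2 - γ)) ≤ D ^ (-(2 - γ)) :=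
    Real.rpow_le_rpow_of_nonpos hD0 hDn (by linarith)
  have e : (n : ℝ) ^ ((γ - 1) ^ 2 / γ) = (n : ℝ) ^ (1 / γ) * (n : ℝ) ^ (-(2 - γ)) := by
    rw [← Real.rpow_add hn']
    congr 1
    field_simp
    ring
  rw [e]
  gcongr

/-- As n ε dominates a power of n, so does (n ε)^(1/γ), and this beats the logarithm. -/
theorem exists_log_le (hγ : 1 < γ) (hγ2 : γ < 2) : ∃ C : ℝ, 0 < C ∧ ∀ (n : ℕ) (D ε : ℝ), 2 ≤ n →
    1 ≤ D → D ≤ n → (Real.log n) ^ ((γ - 1) / (2 - γ)) /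
      ((n : ℝ) ^ ((γ - 1) / γ) * D ^ (2 - γ)) ≤ ε →
    Real.log n ≤ C * (n * ε) ^ (1 / γ) := by
  have hm := logConst_pos γ
  have hg0 : 0 < γ := by linarith
  have hg1 : 0 < γ - 1 := by linarith
  set t := (γ - 1) ^ 2 / γ * (1 / γ) with ht
  have ht0 : 0 < t := by positivity
  refine ⟨(logConst γ ^ (1 / γ))⁻¹ / t, by positivity, fun n D ε hn hD hDn hcond => ?_⟩
  have h := Real.rpow_le_rpow (by positivity) (rpow_le_mul_eps hγ hγ2 hn hD hDn hcond)
    (by positivity : 0 ≤ 1 / γ)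
  rw [Real.mul_rpow hm.le (by positivity), ← Real.rpow_mul (Nat.cast_nonneg n), ← ht] at h
  refine (Real.log_le_rpow_div (Nat.cast_nonneg n) ht0).trans ?_
  rw [div_mul_eq_mul_div]
  gcongr
  rw [inv_mul_eq_div, le_div_iff₀ (by positivity), mul_comm]
  exact h

/-- The exponents satisfy r ≤ 1/γ, and n ε is bounded below by `logConst γ`, so passing to the
larger exponent costs only a constant. -/
theorem rpow_le_rpow_of_condition (hγ : 1 < γ) (hγ2 : γ < 2) (hr : r = 2 / γ - 1) (hn : 2 ≤ n)
    (hD : 1 ≤ D) (hDn : D ≤ n)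
    (hcond : (Real.log n) ^ ((γ - 1) / (2 - γ)) /
      ((n : ℝ) ^ ((γ - 1) / γ) * D ^ (2 - γ)) ≤ ε) :
    ((n : ℝ) * ε) ^ r ≤ logConst γ ^ (r - 1 / γ) * (n * ε) ^ (1 / γ) := by
  have hg0 : 0 < γ := by linarith
  have hm := logConst_pos γ
  have hn1 : (1 : ℝ) ≤ n := by exact_mod_cast (by omega : 1 ≤ n)
  have h1 : logConst γ ≤ n * ε := by
    refine le_trans ?_ (rpow_le_mul_eps hγ hγ2 hn hD hDn hcond)
    exact le_mul_of_one_le_right hm.le (Real.one_le_rpow hn1 (by positivity))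
  have hx : 0 < (n : ℝ) * ε := hm.trans_le h1
  have hexp : r - 1 / γ ≤ 0 := by
    rw [hr, show 2 / γ - 1 - 1 / γ = (1 - γ) / γ by field_simp; ring]
    exact div_nonpos_of_nonpos_of_nonneg (by linarith) hg0.le
  calc ((n : ℝ) * ε) ^ r = (n * ε) ^ (r - 1 / γ) * (n * ε) ^ (1 / γ) := by
        rw [← Real.rpow_add hx]
        congr 1
        ring
    _ ≤ _ := by
        have := Real.rpow_le_rpow_of_nonpos hm h1 hexp
        gcongr

end lt_two

/-! ### Bounds with constants -/

theorem one_le_avgDeg {G : Digraph (Fin n)} (hG : ∀ v, (inNbrs G v).Nonempty) (hn : 0 < n) :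
    1 ≤ avgDeg G := by
  rw [avgDeg, le_div_iff₀ (by exact_mod_cast hn), one_mul]
  exact_mod_cast le_numEdges hG

theorem avgDeg_le (G : Digraph (Fin n)) (hn : 0 < n) : avgDeg G ≤ n := by
  rw [avgDeg, div_le_iff₀ (by exact_mod_cast hn)]
  exact_mod_cast numEdges_le G

theorem hubNodes_eq (G : Digraph (Fin n)) (γ ε : ℝ) (w : Equiv.Perm (Fin n)) :
    hubNodes G γ ε w = topNodes w (j₀ G γ ε) := rfl

section bounds
variable (c : Set.Ioo (0 : ℝ) 1) (γ κ₁ κ₂ : ℝ)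

theorem exists_cost_le_of_two_lt (hγ : 2 < γ) : ∃ C : ℝ, 0 < C ∧
    ∀ (n : ℕ) (_ : 2 ≤ n) (G : Digraph (Fin n)) (_ : ∀ v, (inNbrs G v).Nonempty)
      (w : Equiv.Perm (Fin n)) (_ : PowerLaw G c γ κ₁ κ₂ w)
      (ε δ : ℝ) (_ : 0 < ε) (_ : ε < 1) (_ : 0 < δ) (_ : δ < 1),
      expectedQueryCost G c ε δ (buildIndex G c ε (hubNodes G γ ε w)) ≤
        ENNReal.ofReal (C * (Real.log (n / δ) / ε ^ 2)) := by
  have hs := sampleConst_pos c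
  have hr := retrieveConst_pos c
  set k := |κ₂| ^ 2 / (1 - 2 / γ) with hk
  have hk0 : 0 ≤ k := by
    have : 2 / γ < 1 := (div_lt_one (by linarith)).2 hγ
    have : 0 < 1 - 2 / γ := by linarith
    positivity
  -- The factor 2 of the retrieval term comes from 1 ≤ 2 log (n / δ).
  refine ⟨sampleConst c * (1 + k) + 2 * retrieveConst c * k, by positivity, ?_⟩
  intro n hn G hG w hw ε δ hε hε1 hδ hδ1
  rw [hubNodes_eq]
  refine (expectedQueryCost_le_ofReal hG hn hw hε hε1.le hδ hδ1.le _ 0).trans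
    (ENNReal.ofReal_le_ofReal ?_)
  have hL := one_half_lt_log hn hδ hδ1.le
  have h1 := tailSum_le_of_two_lt (K := |κ₂|) hγ (by omega : 0 < n) (j₀ G γ ε)
  have h2 := tailSum_le_of_two_lt (K := |κ₂|) hγ (by omega : 0 < n) 0
  rw [← hk] at h1 h2
  rw [headSum_zero, zero_div, zero_add]
  have hL0 : 0 < Real.log (n / δ) := by linarith
  calc _ ≤ sampleConst c * (Real.log (n / δ) * (1 + k) / ε ^ 2) +
        retrieveConst c * (2 * Real.log (n / δ) * k / ε ^ 2) := by
        gcongr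
        refine h2.trans ?_
        nlinarith
    _ = _ := by ring

theorem exists_cost_le_of_eq_two : ∃ C : ℝ, 0 < C ∧
    ∀ (n : ℕ) (_ : 2 ≤ n) (G : Digraph (Fin n)) (_ : ∀ v, (inNbrs G v).Nonempty)
      (w : Equiv.Perm (Fin n)) (_ : PowerLaw G c 2 κ₁ κ₂ w)
      (ε δ : ℝ) (_ : 0 < ε) (_ : ε < 1) (_ : 0 < δ) (_ : δ < 1),
      expectedQueryCost G c ε δ (buildIndex G c ε (hubNodes G 2 ε w)) ≤
        ENNReal.ofReal (C * (Real.log (n / δ) * Real.log n / ε ^ 2)) := by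
  have hs := sampleConst_pos c
  have hr := retrieveConst_pos c
  -- From log n > 1/2: 1 ≤ 2 log n and 1 + log n ≤ 3 log n. The 6 is 3 times the 2 in 1 ≤ 2 log (n /
  -- δ).
  refine ⟨sampleConst c * (2 + 3 * |κ₂| ^ 2) + 6 * retrieveConst c * |κ₂| ^ 2, by positivity, ?_⟩
  intro n hn G hG w hw ε δ hε hε1 hδ hδ1
  rw [hubNodes_eq]
  refine (expectedQueryCost_le_ofReal hG hn hw hε hε1.le hδ hδ1.le _ 0).trans
    (ENNReal.ofReal_le_ofReal ?_)
  have hL := one_half_lt_log hn hδ hδ1.le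
  have hlg := log_pos_of_two_le hn
  have h : ∀ J, tailSum n 2 |κ₂| J ≤ 3 * |κ₂| ^ 2 * Real.log n := by
    intro J
    refine (tailSum_two_le _ n J).trans ?_
    nlinarith [sq_nonneg |κ₂|]
  have h2 : 1 + tailSum n 2 |κ₂| (j₀ G 2 ε) ≤ (2 + 3 * |κ₂| ^ 2) * Real.log n := by
    linarith [h (j₀ G 2 ε)]
  rw [headSum_zero, zero_div, zero_add]
  have hL0 : 0 < Real.log (n / δ) := by linarith
  calc _ ≤ sampleConst c * (Real.log (n / δ) * ((2 + 3 * |κ₂| ^ 2) * Real.log n) / ε ^ 2) +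
        retrieveConst c * (2 * Real.log (n / δ) * (3 * |κ₂| ^ 2 * Real.log n) / ε ^ 2) := by
        gcongr
        refine (h 0).trans ?_
        have : 0 ≤ 3 * |κ₂| ^ 2 * Real.log n := by positivity
        nlinarith
    _ = _ := by ring

theorem exists_cost_le_of_lt_two (a : ℝ) (hγ : 1 < γ) (hγ2 : γ < 2) : ∃ C : ℝ, 0 < C ∧
    ∀ (n : ℕ) (_ : 2 ≤ n) (G : Digraph (Fin n)) (_ : ∀ v, (inNbrs G v).Nonempty)
      (w : Equiv.Perm (Fin n)) (_ : PowerLaw G c γ κ₁ κ₂ w)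
      (ε δ : ℝ) (_ : 0 < ε) (_ : ε < 1) (_ : 0 < δ) (_ : δ < 1),
      (Real.log n) ^ ((γ - 1) / (2 - γ)) /
          ((n : ℝ) ^ ((γ - 1) / γ) * (avgDeg G) ^ (2 - γ)) ≤ ε →
      (n : ℝ) ^ (-a) ≤ δ →
      expectedQueryCost G c ε δ (buildIndex G c ε (hubNodes G γ ε w)) ≤
        ENNReal.ofReal (C * min ((n : ℝ) ^ (1 / γ) / ε ^ (2 - 1 / γ))
          ((n : ℝ) ^ (2 / γ - 1) / ε ^ 2)) := by
  have hs := sampleConst_pos c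
  have hrc := retrieveConst_pos c
  have hg0 : 0 < γ := by linarith
  have hm := logConst_pos γ
  set r := 2 / γ - 1 with hr
  have hr0 : 0 < r := by
    rw [hr, sub_pos, lt_div_iff₀ hg0]
    linarith
  have hr1 : r ≤ 1 := by
    rw [hr, sub_le_iff_le_add, div_le_iff₀ hg0]
    linarith
  have hq : 0 < 1 - 1 / γ := by
    have : 1 / γ < 1 := (div_lt_one hg0).2 hγ
    linarith
  obtain ⟨C₃, hC₃, hlog⟩ := exists_log_le hγ hγ2
  set k := |κ₂| ^ 2 * (2 / r) with hk
  have hk0 : 0 ≤ k := by positivity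
  set s := sampleConst c * (1 + |a|) with hsdef
  have hs0 : 0 < s := by positivity
  -- `A₁` serves the first term of the minimum and `A₂` the second.
  set A₁ := s * (C₃ + k * (logConst γ)⁻¹) + retrieveConst c *
    (|κ₂| / (1 - 1 / γ) + k * logConst γ ^ (r - 1 / γ)) with hA₁
  set A₂ := s * (1 / r + k) + retrieveConst c * k with hA₂
  have hA₁0 : 0 < A₁ := by positivity
  have hA₂0 : 0 < A₂ := by positivity
  refine ⟨A₁ + A₂, by positivity, ?_⟩
  intro n hn G hG w hw ε δ hε hε1 hδ hδ1 hcond hδa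
  have hn0 : 0 < n := by omega
  have hn' : (0 : ℝ) < n := by exact_mod_cast hn0
  have hD := one_le_avgDeg hG hn0
  have hDn := avgDeg_le G hn0
  set D := avgDeg G with hDdef
  have hD0 : 0 < D := by linarith
  have hlg := log_pos_of_two_le hn
  have hL : Real.log (n / δ) ≤ (1 + |a|) * Real.log n := by
    have h1 := Real.log_le_log (by positivity) hδa
    rw [Real.log_rpow hn'] at h1
    rw [Real.log_div hn'.ne' hδ.ne']
    have h2 : a * Real.log n ≤ |a| * Real.log n := by gcongr; exact le_abs_self a
    linarith
  set T := tailSum n γ |κ₂| (j₀ G γ ε) with hT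
  have hT0 : 0 ≤ T := tailSum_nonneg _ _ _ _
  have hDle : D ^ (-(2 - γ)) ≤ 1 := Real.rpow_le_one_of_one_le_of_nonpos hD (by linarith)
  -- The hub nodes remove enough of the tail to absorb the logarithm; j₀ + 1 exceeds the real number
  -- of which j₀ is the floor.
  have hlgT : Real.log n * T ≤ k * ((n : ℝ) ^ r * D ^ (-(2 - γ))) := by
    have h1 := tailSum_le_of_lt_two (K := |κ₂|) hr hr0 hr1 n (j₀ G γ ε)
    have h2 := log_mul_le_of_hubs hγ hγ2 hr hn hD hε hcond
      (x := (j₀ G γ ε : ℝ) + 1) (Nat.lt_floor_add_one _).le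
    calc Real.log n * T
        ≤ Real.log n * (k * ((n : ℝ) ^ r * ((j₀ G γ ε : ℝ) + 1) ^ (-r))) := by gcongr
      _ = k * ((n : ℝ) ^ r * (Real.log n * ((j₀ G γ ε : ℝ) + 1) ^ (-r))) := by ring
      _ ≤ _ := by gcongr
  have hsample : sampleConst c * (Real.log (n / δ) * (1 + T) / ε ^ 2) ≤
      s * (Real.log n + k * ((n : ℝ) ^ r * D ^ (-(2 - γ)))) / ε ^ 2 := by
    calc _ ≤ sampleConst c * (((1 + |a|) * Real.log n) * (1 + T) / ε ^ 2) := by gcongr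
      _ = s * (Real.log n + Real.log n * T) / ε ^ 2 := by rw [hsdef]; ring
      _ ≤ _ := by gcongr
  -- Cut at 0: every list is charged to η̂π.
  have second : expectedQueryCost G c ε δ (buildIndex G c ε (hubNodes G γ ε w)) ≤
      ENNReal.ofReal ((A₁ + A₂) * ((n : ℝ) ^ r / ε ^ 2)) := by
    rw [hubNodes_eq]
    refine (expectedQueryCost_le_ofReal hG hn hw hε hε1.le hδ hδ1.le _ 0).trans
      (ENNReal.ofReal_le_ofReal ?_)
    rw [headSum_zero, zero_div, zero_add]
    have h1 := tailSum_le_of_lt_two (K := |κ₂|) hr hr0 hr1 n 0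
    rw [Nat.cast_zero, zero_add, Real.one_rpow, mul_one] at h1
    calc _ ≤ s * ((n : ℝ) ^ r / r + k * ((n : ℝ) ^ r * 1)) / ε ^ 2 +
          retrieveConst c * (k * (n : ℝ) ^ r / ε ^ 2) := by
          refine add_le_add (hsample.trans ?_) (by gcongr)
          gcongr
          exact Real.log_le_rpow_div hn'.le hr0
      _ = A₂ * ((n : ℝ) ^ r / ε ^ 2) := by rw [hA₂]; ring
      _ ≤ _ := by
          gcongr
          linarith
  have first : expectedQueryCost G c ε δ (buildIndex G c ε (hubNodes G γ ε w)) ≤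
      ENNReal.ofReal ((A₁ + A₂) * ((n : ℝ) ^ (1 / γ) / ε ^ (2 - 1 / γ))) := by
    rw [hubNodes_eq]
    -- Cut at rank 1/ε: with X = (n ε)^(1/γ), the head contributes O(X / ε²) and the tail O((n ε)^r
    -- / ε²), which is also O(X / ε²).
    refine (expectedQueryCost_le_ofReal hG hn hw hε hε1.le hδ hδ1.le _ ⌊1 / ε⌋₊).trans
      (ENNReal.ofReal_le_ofReal ?_)
    set X := ((n : ℝ) * ε) ^ (1 / γ) with hX
    have hX0 : 0 < X := by positivity
    have hXε : (n : ℝ) ^ (1 / γ) / ε ^ (2 - 1 / γ) = X / ε ^ 2 := by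
      rw [hX, Real.mul_rpow hn'.le hε.le, Real.rpow_sub hε, Real.rpow_two]
      field_simp
    rw [hXε]
    have hhead : headSum n γ |κ₂| ⌊1 / ε⌋₊ / ε ≤ |κ₂| / (1 - 1 / γ) * (X / ε ^ 2) := by
      have h1 := headSum_le (n := n) hγ (abs_nonneg κ₂)
        (Nat.floor_le (by positivity : 0 ≤ 1 / ε))
      have e : (n : ℝ) ^ (1 / γ) * (1 / ε) ^ (1 - 1 / γ) = X / ε := by
        rw [hX, Real.mul_rpow hn'.le hε.le, one_div ε, Real.inv_rpow hε.le, Real.rpow_sub hε,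
          Real.rpow_one]
        field_simp
      rw [e] at h1
      calc _ ≤ |κ₂| / (1 - 1 / γ) * (X / ε) / ε := by gcongr
        _ = _ := by field_simp
    have htail : tailSum n γ |κ₂| ⌊1 / ε⌋₊ ≤ k * (logConst γ ^ (r - 1 / γ) * X) := by
      refine (tailSum_le_of_lt_two (K := |κ₂|) hr hr0 hr1 n _).trans ?_
      refine mul_le_mul_of_nonneg_left ?_ hk0
      refine le_trans ?_ (rpow_le_rpow_of_condition hγ hγ2 hr hn hD hDn hcond)
      rw [Real.mul_rpow hn'.le hε.le]
      refine mul_le_mul_of_nonneg_left ?_ (by positivity)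
      refine (Real.rpow_le_rpow_of_nonpos (by positivity)
        (Nat.lt_floor_add_one (1 / ε)).le (by linarith)).trans (le_of_eq ?_)
      rw [one_div, Real.inv_rpow hε.le, Real.rpow_neg hε.le, inv_inv]
    have hlgX := hlog n D ε hn hD hDn hcond
    have hnD := rpow_mul_le_of_condition hγ hγ2 hr hn hD hε hε1.le hcond
    calc _ ≤ s * (C₃ * X + k * ((logConst γ)⁻¹ * X)) / ε ^ 2 +
          retrieveConst c * (|κ₂| / (1 - 1 / γ) * (X / ε ^ 2) +
            k * (logConst γ ^ (r - 1 / γ) * X) / ε ^ 2) := by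
          refine add_le_add (hsample.trans ?_) (by gcongr)
          gcongr
      _ = A₁ * (X / ε ^ 2) := by rw [hA₁]; ring
      _ ≤ _ := by
          gcongr
          linarith
  rcases min_choice ((n : ℝ) ^ (1 / γ) / ε ^ (2 - 1 / γ)) ((n : ℝ) ^ r / ε ^ 2) with h | h
  · rw [h]
    exact first
  · rw [h]
    exact second

theorem exists_size_le (hγ : 1 < γ) : ∃ C : ℝ, 0 < C ∧
    ∀ (n : ℕ) (_ : 2 ≤ n) (G : Digraph (Fin n)) (_ : ∀ v, (inNbrs G v).Nonempty)
      (w : Equiv.Perm (Fin n)) (_ : PowerLaw G c γ κ₁ κ₂ w) (ε : ℝ) (_ : 0 < ε),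
      (buildIndex G c ε (hubNodes G γ ε w)).size ≤ ENNReal.ofReal (C * numEdges G) := by
  have hc := c₁_pos c
  have hg0 : 0 < γ := by linarith
  have hg1 : 0 < γ - 1 := by linarith
  have hq : 0 < 1 - 1 / γ := by
    have : 1 / γ < 1 := (div_lt_one hg0).2 hγ
    linarith
  -- The added 1 only makes the constant positive without a hypothesis on κ₂.
  refine ⟨c₁ c * (|κ₂| / (1 - 1 / γ)) + 1, by positivity, ?_⟩
  intro n hn G hG w hw ε hε
  have hn0 : 0 < n := by omega
  have hn' : (0 : ℝ) < n := by exact_mod_cast hn0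
  have hD := one_le_avgDeg hG hn0
  have hD0 : 0 < avgDeg G := by linarith
  rw [hubNodes_eq]
  refine (size_buildIndex_le G c hε _).trans ?_
  refine (mul_le_mul_right (sum_topNodes_totalMass_le hG hw _) _).trans ?_
  rw [invThreshold, ← ENNReal.ofReal_mul (by positivity)]
  refine ENNReal.ofReal_le_ofReal ?_
  have h1 := headSum_le (n := n) hγ (abs_nonneg κ₂) (J := j₀ G γ ε)
    (Nat.floor_le (by positivity : 0 ≤ (n : ℝ) * (ε * avgDeg G) ^ (γ / (γ - 1))))
  -- The exponent in j₀ is the inverse of 1 - 1/γ, so the head sum is of order ε m and the factor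
  -- c₁/ε leaves O(m).
  have e : (n : ℝ) ^ (1 / γ) * ((n : ℝ) * (ε * avgDeg G) ^ (γ / (γ - 1))) ^ (1 - 1 / γ) =
      ε * numEdges G := by
    rw [Real.mul_rpow hn'.le (by positivity), ← Real.rpow_mul (by positivity),
      show γ / (γ - 1) * (1 - 1 / γ) = 1 by field_simp, Real.rpow_one, ← mul_assoc,
      ← Real.rpow_add hn', add_sub_cancel, Real.rpow_one, avgDeg]
    field_simp
  rw [e] at h1
  calc _ ≤ c₁ c / ε * (|κ₂| / (1 - 1 / γ) * (ε * numEdges G)) := by gcongr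
    _ = c₁ c * (|κ₂| / (1 - 1 / γ)) * numEdges G := by field_simp
    _ ≤ _ := by
        gcongr
        linarith

theorem exists_preprocessingTime_le : ∃ C : ℝ, 0 < C ∧
    ∀ (n : ℕ) (_ : 2 ≤ n) (G : Digraph (Fin n)) (_ : ∀ v, (inNbrs G v).Nonempty)
      (hubs : Finset (Fin n)) (ε : ℝ) (_ : 0 < ε) (_ : ε < 1) (tPR : ℕ),
      preprocessingTime G c ε hubs tPR ≤ tPR + ENNReal.ofReal (C * (numEdges G / ε)) := by
  have hc := c₁_pos c
  have hθ := one_sub_sq_pos c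
  refine ⟨13 + 6 * (c₁ c * (1 - sq c)⁻¹), by positivity, ?_⟩
  intro n hn G hG hubs ε hε hε1 tPR
  refine (preprocessingTime_le hG hn c hε hubs tPR).trans (add_le_add_right ?_ _)
  have e : (13 + 6 * (invThreshold c ε * (stopProb c)⁻¹)) * (numEdges G : ℝ≥0∞) =
      ENNReal.ofReal ((13 + 6 * (c₁ c / ε * (1 - sq c)⁻¹)) * numEdges G) := by
    rw [ENNReal.ofReal_mul (by positivity), ENNReal.ofReal_add (by positivity) (by positivity),
      ENNReal.ofReal_mul (by norm_num), ENNReal.ofReal_mul (by positivity),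
      ENNReal.ofReal_inv_of_pos hθ, ENNReal.ofReal_natCast]
    norm_num [invThreshold, stopProb]
  rw [e]
  refine ENNReal.ofReal_le_ofReal ?_
  have h : (13 : ℝ) ≤ 13 / ε := by
    rw [le_div_iff₀ hε]
    linarith
  calc _ ≤ (13 / ε + 6 * (c₁ c / ε * (1 - sq c)⁻¹)) * (numEdges G : ℝ) := by gcongr
    _ = _ := by ring

end bounds

end PRSim

end

theorem mainTheorem3 (c : Set.Ioo (0 : ℝ) 1) (γ κ₁ κ₂ a : ℝ) (hγ : 1 < γ) (hκ₁ : 0 < κ₁) :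
    ∃ C : ℝ, 0 < C ∧
      ∀ (n : ℕ) (_ : 2 ≤ n) (G : Digraph (Fin n)) (_ : ∀ v, (inNbrs G v).Nonempty)
        (w : Equiv.Perm (Fin n)) (_ : PowerLaw G c γ κ₁ κ₂ w)
        (ε δ : ℝ) (_ : 0 < ε) (_ : ε < 1) (_ : 0 < δ) (_ : δ < 1),
        (2 < γ →
          expectedQueryCost G c ε δ (buildIndex G c ε (hubNodes G γ ε w)) ≤
            ENNReal.ofReal (C * (Real.log (n / δ) / ε ^ 2))) ∧
        (γ = 2 →
          expectedQueryCost G c ε δ (buildIndex G c ε (hubNodes G γ ε w)) ≤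
            ENNReal.ofReal (C * (Real.log (n / δ) * Real.log n / ε ^ 2))) ∧
        (γ < 2 →
          (Real.log n) ^ ((γ - 1) / (2 - γ)) /
              ((n : ℝ) ^ ((γ - 1) / γ) * (avgDeg G) ^ (2 - γ)) ≤ ε →
          (n : ℝ) ^ (-a) ≤ δ →
          expectedQueryCost G c ε δ (buildIndex G c ε (hubNodes G γ ε w)) ≤
            ENNReal.ofReal (C * min ((n : ℝ) ^ (1 / γ) / ε ^ (2 - 1 / γ))
              ((n : ℝ) ^ (2 / γ - 1) / ε ^ 2))) ∧
        (buildIndex G c ε (hubNodes G γ ε w)).size ≤ ENNReal.ofReal (C * numEdges G) ∧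
        ∀ tPR : ℕ,
          preprocessingTime G c ε (hubNodes G γ ε w) tPR ≤
            tPR + ENNReal.ofReal (C * (numEdges G / ε)) := by
  obtain ⟨C₁, hC₁, h₁⟩ := exists_size_le c γ κ₁ κ₂ hγ
  obtain ⟨C₂, hC₂, h₂⟩ := exists_preprocessingTime_le c
  -- A single constant is obtained by adding those of the index size, the preprocessing and the
  -- regime of γ.
  have mono : ∀ {A B X : ℝ}, A ≤ B → 0 ≤ X → ENNReal.ofReal (A * X) ≤ ENNReal.ofReal (B * X) :=
    fun hAB hX => ENNReal.ofReal_le_ofReal (mul_le_mul_of_nonneg_right hAB hX)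
  have hlog : ∀ {n : ℕ} {δ : ℝ}, 2 ≤ n → 0 < δ → δ < 1 → 0 ≤ Real.log (n / δ) :=
    fun hn h0 h1 => by linarith [one_half_lt_log hn h0 h1.le]
  rcases lt_trichotomy γ 2 with h | h | h
  · obtain ⟨C₃, hC₃, h₃⟩ := exists_cost_le_of_lt_two c γ κ₁ κ₂ a hγ h
    refine ⟨C₁ + C₂ + C₃, by positivity, fun n hn G hG w hw ε δ hε hε1 hδ hδ1 =>
      ⟨fun h' => absurd h' h.not_gt, fun h' => absurd h' h.ne, fun _ hcond hδa => ?_,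
        (h₁ n hn G hG w hw ε hε).trans (mono (by linarith) (by positivity)), fun tPR =>
        (h₂ n hn G hG _ ε hε hε1 tPR).trans (add_le_add_right
          (mono (by linarith) (by positivity)) _)⟩⟩
    exact (h₃ n hn G hG w hw ε δ hε hε1 hδ hδ1 hcond hδa).trans
      (mono (by linarith) (by positivity))
  · subst h
    obtain ⟨C₃, hC₃, h₃⟩ := exists_cost_le_of_eq_two c κ₁ κ₂
    refine ⟨C₁ + C₂ + C₃, by positivity, fun n hn G hG w hw ε δ hε hε1 hδ hδ1 =>
      ⟨fun h' => absurd h' (lt_irrefl _), fun _ => ?_, fun h' => absurd h' (lt_irrefl _),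
        (h₁ n hn G hG w hw ε hε).trans (mono (by linarith) (by positivity)), fun tPR =>
        (h₂ n hn G hG _ ε hε hε1 tPR).trans (add_le_add_right
          (mono (by linarith) (by positivity)) _)⟩⟩
    have := hlog hn hδ hδ1
    have := log_pos_of_two_le hn
    exact (h₃ n hn G hG w hw ε δ hε hε1 hδ hδ1).trans (mono (by linarith) (by positivity))
  · obtain ⟨C₃, hC₃, h₃⟩ := exists_cost_le_of_two_lt c γ κ₁ κ₂ h
    refine ⟨C₁ + C₂ + C₃, by positivity, fun n hn G hG w hw ε δ hε hε1 hδ hδ1 =>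
      ⟨fun _ => ?_, fun h' => absurd h' h.ne', fun h' => absurd h' h.not_gt,
        (h₁ n hn G hG w hw ε hε).trans (mono (by linarith) (by positivity)), fun tPR =>
        (h₂ n hn G hG _ ε hε hε1 tPR).trans (add_le_add_right
          (mono (by linarith) (by positivity)) _)⟩⟩
    have := hlog hn hδ hδ1
    exact (h₃ n hn G hG w hw ε δ hε hε1 hδ hδ1).trans (mono (by linarith) (by positivity))
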